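/- Notation. For $x,\omega\in\mathbb R$, $a>0$ let $T_xf(t)=f(t-x)$, $M_\omega f(t)=e^{2\pi i\omega t}f(t)$, $D_af(t)=a^{-1/2}f(t/a)$ on $L^2(\mathbb R)$; $\langle\cdot,\cdot\rangle$ is linear in the first entry and $\hat f(\xi)=\int_{\mathbb R} f(t)e^{-2\pi i\xi t}\,dt$ (extended to $L^2$). Fix $0\le\alpha<1$ and put $\beta(\omega)=(1+|\omega|)^{-\alpha}$. For $z=(x,\omega)\in X=\mathbb R^2$ (with Lebesgue measure) put $\pi(\sigma(z))=T_xM_\omega D_{\beta(\omega)}$. For $\psi\in L^2(\mathbb R)\setminus\{0\}$ let $A_\sigma=A_{\sigma,\psi}$ be the operator defined weakly by $A_\sigma f=\int_X\langle f,\pi(\sigma(z))\psi\rangle\,\pi(\sigma(z))\psi\,dz$; $\psi$ is admissible if $A_\sigma$ is bounded and boundedly invertible on $L^2(\mathbb R)$. For admissible $\psi$ put $$V_\psi f(z)=\langle f,\pi(\sigma(z))\psi\rangle,\quad W_\psi f(z)=\langle f,A_\sigma^{-1}\pi(\sigma(z))\psi\rangle,\quad K^\kappa_{\psi,\varphi}(z,z^*)=\langle\pi(\sigma(z))\psi,\,A_\sigma^{-\kappa}\pi(\sigma(z^*))\varphi\rangle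 .$$ For $s\ge0$ let $v_s(x,\omega)=(1+|\omega|)^s$, $w_s(z,z^*)=\max\{v_s(z)/v_s(z^*),v_s(z^*)/v_s(z)\}$, and $L^p_{v_s}=\{F \text{ measurable}: Fv_s\in L^p(X)\}$ with $\|F\|_{L^p_{v_s}}=\|Fv_s\|_{L^p}$. Let $\mathcal H_{1,v_s}^\psi=\{f\in L^2: W_\psi f\in L^1_{v_s}\}$ and $\mathcal K_{1,v_s}^\psi=\{f\in L^2: V_\psi f\in L^1_{v_s}\}$, with norms $\|W_\psi f\|_{L^1_{v_s}}$ and $\|V_\psi f\|_{L^1_{v_s}}$; a prime denotes the space of bounded conjugate linear functionals. When $\pi(\sigma(z))\psi\in\mathcal H^\psi_{1,v_s}$ and $A_\sigma^{-1}\pi(\sigma(z))\psi\in\mathcal K^\psi_{1,v_s}$ for all $z$, the transforms $V_\psi$ and $W_\psi$ extend to $(\mathcal H^\psi_{1,v_s})'$ and $(\mathcal K^\psi_{1,v_s})'$ by duality, and for $1\le p\le\infty$ $$\mathcal H_{p,v_s}^\psi=\{F\in(\mathcal K^\psi_{1,v_s})': W_\psi F\in L^p_{v_s}\},\qquad \mathcal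 K_{p,v_s}^\psi=\{F\in(\mathcal H^\psi_{1,v_s})': V_\psi F\in L^p_{v_s}\},$$ with norms $\|W_\psi F\|_{L^p_{v_s}}$ and $\|V_\psi F\|_{L^p_{v_s}}$. Theorem. Let $0\le\alpha<1$, $s\ge0$ and $$r>\frac{2+2s+7\alpha-4\alpha^2}{2(1-\alpha)^2}.$$ Let $\psi,\varphi\in L^2(\mathbb R)$, $\psi\ne0$, be such that $\hat\psi,\hat\varphi\in C^2(\mathbb R)$ and, for some constant $C$, $|\hat\psi^{(l)}(\xi)|,|\hat\varphi^{(l)}(\xi)|\le C(1+|\xi|)^{-r}$ for $l=0,1,2$ and all $\xi\in\mathbb R$. Then: 1. $\psi$ is admissible, and for $\kappa=0,1,2$ $$\sup_{(x^*,\omega^*)\in\mathbb R^2}\int_{\mathbb R}\int_{\mathbb R}|K^\kappa_{\psi,\varphi}(x,\omega,x^*,\omega^*)|\,w_s(x,\omega,x^*,\omega^*)\,dx\,d\omega<\infty .$$ 2. The fundamental condition of generalized coorbit theory holds: with $\mathcal R(z,z^*)=\langle A_\sigma^{-1}\pi(\sigma(z))\psi,\pi(\sigma(z^*))\psi\rangle$,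 $$\operatorname*{ess\,sup}_{z^*\in X}\int_X|\mathcal R(z,z^*)|\,w_s(z,z^*)\,dz<\infty;$$ moreover $\pi(\sigma(z))\psi\in\mathcal H^\psi_{1,v_s}$ and $A_\sigma^{-1}\pi(\sigma(z))\psi\in\mathcal K^\psi_{1,v_s}$ for all $z\in X$. 3. For all $1\le p\le\infty$, $\mathcal H_{p,v_s}^\psi=\mathcal K_{p,v_s}^\psi$ with equivalent norms. 4. If also $\varphi\ne0$, then for all $1\le p\le\infty$, $\mathcal H_{p,v_s}^\psi=\mathcal H_{p,v_s}^\varphi$ with equivalent norms. -/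

import Mathlib

open MeasureTheory
open scoped ENNReal NNReal FourierTransform

noncomputable section

namespace AlphaMod

/-- The Hilbert space `L²(ℝ)` of complex-valued functions. -/
abbrev L2 : Type := Lp ℂ 2 (volume : Measure ℝ)

/-- The inner product of `L²(ℝ)`, linear in the first and conjugate linear in the second entry. -/
def ip (f g : L2) : ℂ := inner ℂ g f

/-! ### The affine Weyl-Heisenberg group and its Stone-von Neumann representation -/

/-- The affine Weyl-Heisenberg group, with elements `(x, ω, a, τ)`, `a > 0`. -/
@[ext]
structure AffineWH where
  x : ℝ
  ω : ℝ
  a : ℝ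
  τ : ℝ
  a_pos : 0 < a

instance : Mul AffineWH where
  mul g h := ⟨g.x + g.a * h.x, g.ω + 1 / g.a * h.ω, g.a * h.a, g.τ + h.τ + g.ω * g.a * h.x,
    mul_pos g.a_pos h.a_pos⟩

instance : One AffineWH where
  one := ⟨0, 0, 1, 0, one_pos⟩

instance : Inv AffineWH where
  inv g := ⟨-(g.x / g.a), -(g.ω * g.a), 1 / g.a, -g.τ + g.x * g.ω, one_div_pos.2 g.a_pos⟩

instance : Group AffineWH :=
  Group.ofLeftAxioms
    (by
      intro g h k
      have hg := g.a_pos.ne'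
      have hh := h.a_pos.ne'
      apply AffineWH.ext
      · change (g.x + g.a * h.x) + (g.a * h.a) * k.x = g.x + g.a * (h.x + h.a * k.x); ring
      · change (g.ω + 1 / g.a * h.ω) + 1 / (g.a * h.a) * k.ω
          = g.ω + 1 / g.a * (h.ω + 1 / h.a * k.ω)
        field_simp
        ring
      · change g.a * h.a * k.a = g.a * (h.a * k.a); ring
      · change (g.τ + h.τ + g.ω * g.a * h.x) + k.τ + (g.ω + 1 / g.a * h.ω) * (g.a * h.a) * k.x
          = g.τ + (h.τ + k.τ + h.ω * h.a * k.x) + g.ω * g.a * (h.x + h.a * k.x)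
        field_simp
        ring)
    (by
      intro g
      apply AffineWH.ext
      · change 0 + 1 * g.x = g.x; ring
      · change 0 + 1 / 1 * g.ω = g.ω; ring
      · change 1 * g.a = g.a; ring
      · change 0 + g.τ + 0 * 1 * g.x = g.τ; ring)
    (by
      intro g
      have hg := g.a_pos.ne'
      apply AffineWH.ext
      · change -(g.x / g.a) + 1 / g.a * g.x = 0; ring
      · change -(g.ω * g.a) + 1 / (1 / g.a) * g.ω = 0
        field_simp
        ring
      · change 1 / g.a * g.a = 1
        field_simp
      · change (-g.τ + g.x * g.ω) + g.τ + -(g.ω * g.a) * (1 / g.a) * g.x = 0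
        field_simp
        ring)

lemma memLp_translation (x : ℝ) (f : L2) : MemLp (fun t : ℝ => f (t - x)) 2 volume :=
  (Lp.memLp f).comp_measurePreserving (measurePreserving_sub_right volume x)

lemma memLp_modulation (ω : ℝ) (f : L2) :
    MemLp (fun t : ℝ => Complex.exp (2 * Real.pi * Complex.I * ω * t) * f t) 2 volume := by
  refine (Lp.memLp f).of_le ?_ (Filter.Eventually.of_forall fun t => ?_)
  · exact (Continuous.aestronglyMeasurable (by fun_prop)).mul (Lp.aestronglyMeasurable f)
  · rw [norm_mul]
    have h : (2 * Real.pi * Complex.I * ω * t : ℂ) = ((2 * Real.pi * ω * t : ℝ) : ℂ) * Complex.I := by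
      push_cast; ring
    rw [h, Complex.norm_exp_ofReal_mul_I, one_mul]

lemma memLp_dilation (a : ℝ) (ha : 0 < a) (f : L2) :
    MemLp (fun t : ℝ => ((1 / Real.sqrt a : ℝ) : ℂ) * f (t / a)) 2 volume := by
  refine MemLp.const_mul ?_ _
  have h : MemLp (⇑f) 2 (Measure.map (fun t : ℝ => t / a) volume) := by
    simp only [div_eq_mul_inv]
    rw [Real.map_volume_mul_right (inv_ne_zero ha.ne')]
    exact (Lp.memLp f).smul_measure ENNReal.ofReal_ne_top
  exact h.comp_of_map (by fun_prop)

/-- Translation `T_x f(t) = f(t - x)`. -/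
def translation (x : ℝ) (f : L2) : L2 := (memLp_translation x f).toLp _

/-- Modulation `M_ω f(t) = e^{2πiωt} f(t)`. -/
def modulation (ω : ℝ) (f : L2) : L2 := (memLp_modulation ω f).toLp _

/-- Dilation `D_a f(t) = a^{-1/2} f(t/a)`, `a > 0`. -/
def dilation (a : ℝ) (ha : 0 < a) (f : L2) : L2 := (memLp_dilation a ha f).toLp _

/-- The Stone-von Neumann representation `π(x, ω, a, τ) = e^{2πiτ} T_x M_ω D_a` on `L²(ℝ)`. -/
def rep (g : AffineWH) (f : L2) : L2 :=
  Complex.exp (2 * Real.pi * Complex.I * g.τ) •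
    translation g.x (modulation g.ω (dilation g.a g.a_pos f))

/-! ### The section and the frame operator -/

/-- The homogeneous space `G_{aWH} / {(0, 0, a, τ)}`, identified with `ℝ²` with points `(x, ω)`;
its invariant measure is Lebesgue measure `dx dω`. -/
abbrev X : Type := ℝ × ℝ

/-- `β(ω) = (1 + |ω|)^{-α}`. -/
def beta (α ω : ℝ) : ℝ := (1 + |ω|) ^ (-α)

lemma beta_pos (α ω : ℝ) : 0 < beta α ω := Real.rpow_pos_of_pos (by positivity) _

/-- The section `σ(x, ω) = (x, ω, β(ω), 0)`. -/
def sect (α : ℝ) (z : X) : AffineWH := ⟨z.1, z.2, beta α z.2, 0, beta_pos α z.2⟩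

/-- The vectors `π(σ(z))ψ`. -/
def atom (α : ℝ) (ψ : L2) (z : X) : L2 := rep (sect α z) ψ

/-- `A` is the (everywhere defined, bounded) operator given weakly by
`A f = ∫_X ⟨f, π(σ(z))ψ⟩ π(σ(z))ψ dμ(z)`. -/
def IsFrameOperator (α : ℝ) (ψ : L2) (A : L2 →L[ℂ] L2) : Prop :=
  ∀ f h : L2,
    Integrable (fun z : X => ip f (atom α ψ z) * ip (atom α ψ z) h) ∧
    ip (A f) h = ∫ z : X, ip f (atom α ψ z) * ip (atom α ψ z) h

lemma IsFrameOperator.unique {α : ℝ} {ψ : L2} {A B : L2 →L[ℂ] L2}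
    (hA : IsFrameOperator α ψ A) (hB : IsFrameOperator α ψ B) : A = B := by
  ext1 f
  refine ext_inner_left ℂ fun h => ?_
  exact (hA f h).2.trans (hB f h).2.symm

/-- `ψ ≠ 0` is admissible if its frame operator is bounded and boundedly invertible. -/
def Admissible (α : ℝ) (ψ : L2) : Prop :=
  ψ ≠ 0 ∧ ∃ A : L2 →L[ℂ] L2, IsFrameOperator α ψ A ∧ IsUnit A

open Classical in
/-- The frame operator `A_σ` of `ψ` (the value `0` is used only if no bounded one exists). -/
def frameOp (α : ℝ) (ψ : L2) : L2 →L[ℂ] L2 :=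
  if h : ∃ A : L2 →L[ℂ] L2, IsFrameOperator α ψ A then h.choose else 0

lemma frameOp_eq {α : ℝ} {ψ : L2} {A : L2 →L[ℂ] L2} (hA : IsFrameOperator α ψ A) :
    frameOp α ψ = A := by
  have h : ∃ A : L2 →L[ℂ] L2, IsFrameOperator α ψ A := ⟨A, hA⟩
  rw [frameOp, dif_pos h]
  exact h.choose_spec.unique hA

/-- `A_σ^{-1}`; the true inverse whenever `ψ` is admissible. -/
def frameInv (α : ℝ) (ψ : L2) : L2 →L[ℂ] L2 := Ring.inverse (frameOp α ψ)

/-- The vectors `A_σ^{-1} π(σ(z))ψ`. -/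
def dualAtom (α : ℝ) (ψ : L2) (z : X) : L2 := frameInv α ψ (atom α ψ z)

/-! ### Kernels and weights -/

/-- `K^κ_{ψ,φ}(z, z') = ⟨π(σ(z))ψ, A_σ^{-κ} π(σ(z'))φ⟩`, with `A_σ` the frame operator of `ψ`. -/
def kernelK (α : ℝ) (κ : ℕ) (ψ φ : L2) (z z' : X) : ℂ :=
  ip (atom α ψ z) ((frameInv α ψ ^ κ) (atom α φ z'))

/-- The reproducing kernel `R(z, z') = ⟨A_σ^{-1} π(σ(z))ψ, π(σ(z'))ψ⟩`. -/
def kernelR (α : ℝ) (ψ : L2) (z z' : X) : ℂ := ip (dualAtom α ψ z) (atom α ψ z')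

/-- `v_s(x, ω) = (1 + |ω|)^s`. -/
def polyWeight (s : ℝ) (z : X) : ℝ := (1 + |z.2|) ^ s

/-- `w(z, z') = max (v(z)/v(z')) (v(z')/v(z))`. -/
def ratioWeight (v : X → ℝ) (z z' : X) : ℝ := max (v z / v z') (v z' / v z)

/-- The fundamental condition
`ess sup_{z'} ∫_X |R(z, z')| w(z, z') dμ(z) < ∞`. -/
def FundamentalCondition (α : ℝ) (ψ : L2) (v : X → ℝ) : Prop :=
  essSup (fun z' : X => ∫⁻ z : X, ‖kernelR α ψ z z'‖ₑ * ENNReal.ofReal (ratioWeight v z z')) volume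
    < ∞

/-! ### Generalized coorbit spaces -/

/-- The norm of `L^p_v(X)`. -/
def wNorm (p : ℝ≥0∞) (v : X → ℝ) (F : X → ℂ) : ℝ≥0∞ :=
  eLpNorm (fun z => F z * (v z : ℂ)) p volume

/-- Membership in `L^p_v(X)`. -/
def MemLpv (p : ℝ≥0∞) (v : X → ℝ) (F : X → ℂ) : Prop :=
  MemLp (fun z => F z * (v z : ℂ)) p volume

/-- For a family `e` of vectors, the subspace of all `f ∈ L²(ℝ)` with `⟨f, e(·)⟩ ∈ L^1_v(X)`. -/
def reservoir (v : X → ℝ) (e : X → L2) : Submodule ℂ L2 where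
  carrier := {f | MemLpv 1 v fun z => ip f (e z)}
  add_mem' {f g} hf hg := by
    have h := MemLp.add hf hg
    refine MemLp.ae_eq (Filter.Eventually.of_forall fun z => ?_) h
    simp only [Pi.add_apply, ip, inner_add_right]
    ring
  zero_mem' := by
    simp only [Set.mem_ofPred_eq, MemLpv, ip, inner_zero_right, zero_mul]
    exact MemLp.zero'
  smul_mem' c f hf := by
    have h := MemLp.const_mul hf c
    refine MemLp.ae_eq (Filter.Eventually.of_forall fun z => ?_) h
    simp only [ip, inner_smul_right]
    ring

/-- `H_{1,v} = {f ∈ L² : W_ψ f ∈ L^1_v}`, where `W_ψ f(z) = ⟨f, A_σ^{-1} π(σ(z))ψ⟩`. -/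
def spaceH1 (α : ℝ) (ψ : L2) (v : X → ℝ) : Submodule ℂ L2 := reservoir v (dualAtom α ψ)

/-- `K_{1,v} = {f ∈ L² : V_ψ f ∈ L^1_v}`, where `V_ψ f(z) = ⟨f, π(σ(z))ψ⟩`. -/
def spaceK1 (α : ℝ) (ψ : L2) (v : X → ℝ) : Submodule ℂ L2 := reservoir v (atom α ψ)

/-- A conjugate linear functional on a subspace of `L²(ℝ)`. -/
structure AntiFunctional where
  domain : Submodule ℂ L2
  toFun : domain →ₛₗ[starRingEnd ℂ] ℂ

open Classical in
/-- The pairing `⟨F, u⟩`, for `u` in the domain of `F`. -/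
def AntiFunctional.pair (F : AntiFunctional) (u : L2) : ℂ :=
  if h : u ∈ F.domain then F.toFun ⟨u, h⟩ else 0

/-- The anti-dual of `reservoir v e` with its norm `f ↦ ‖⟨f, e(·)⟩‖_{L^1_v}`: all bounded
conjugate linear functionals on this space. -/
def antiDual (v : X → ℝ) (e : X → L2) : Set AntiFunctional :=
  {F | F.domain = reservoir v e ∧
    ∃ C : ℝ, ∀ u : F.domain, ‖F.toFun u‖ ≤ C * (wNorm 1 v fun z => ip (u : L2) (e z)).toReal}

/-- The extended transform `V_ψ F(z) = ⟨F, π(σ(z))ψ⟩`. -/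
def extV (α : ℝ) (ψ : L2) (F : AntiFunctional) (z : X) : ℂ := F.pair (atom α ψ z)

/-- The extended transform `W_ψ F(z) = ⟨F, A_σ^{-1} π(σ(z))ψ⟩`. -/
def extW (α : ℝ) (ψ : L2) (F : AntiFunctional) (z : X) : ℂ := F.pair (dualAtom α ψ z)

/-- `H_{p,v} = {F ∈ K_{1,v}' : W_ψ F ∈ L^p_v}`, normed by `‖W_ψ F‖_{L^p_v}`. -/
def spaceH (α : ℝ) (ψ : L2) (p : ℝ≥0∞) (v : X → ℝ) : Set AntiFunctional :=
  {F | F ∈ antiDual v (atom α ψ) ∧ MemLpv p v (extW α ψ F)}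

/-- `K_{p,v} = {F ∈ H_{1,v}' : V_ψ F ∈ L^p_v}`, normed by `‖V_ψ F‖_{L^p_v}`. -/
def spaceK (α : ℝ) (ψ : L2) (p : ℝ≥0∞) (v : X → ℝ) : Set AntiFunctional :=
  {F | F ∈ antiDual v (dualAtom α ψ) ∧ MemLpv p v (extV α ψ F)}

/-- Two norms are equivalent on the set `S`. -/
def EquivNormsOn (S : Set AntiFunctional) (N N' : AntiFunctional → ℝ≥0∞) : Prop :=
  ∃ C : ℝ≥0, ∀ F ∈ S, N F ≤ C * N' F ∧ N' F ≤ C * N F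

/-! ### The class of windows -/

/-- `ψ̂` is of class `C²` (has a `C²` representative `g`) and
`|ψ̂^{(l)}(ξ)| ≤ C (1 + |ξ|)^{-r}` for `l = 0, 1, 2`. -/
def FourierDecay (r : ℝ) (ψ : L2) : Prop :=
  ∃ g : ℝ → ℂ, ContDiff ℝ 2 g ∧ (⇑(𝓕 ψ : L2) =ᵐ[volume] g) ∧
    ∃ C : ℝ, ∀ l : ℕ, l ≤ 2 → ∀ ξ : ℝ, ‖iteratedDeriv l g ξ‖ ≤ C * (1 + |ξ|) ^ (-r)

end AlphaMod

end

open AlphaMod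

open AlphaMod

namespace AlphaMod

open scoped ComplexInnerProductSpace SchwartzMap ContDiff

/-! ### The Fourier transform on `L¹ ∩ L²` -/

/-! The operator `A_σ` is a Fourier multiplier. The Fourier transform of `π(σ(x,ω))ψ` is `e^{-2πixξ}
√β(ω) ψ̂(β(ω)(ξ-ω))`, so Plancherel in `x` leaves multiplication by `m(ξ) = ∫ β(ω) |ψ̂(β(ω)(ξ-ω))|²
dω` (`IsMolecule.frame_formula`). The symbol `m` is bounded, bounded below
(`exists_le_integral_profile`), and satisfies `|m'| ≲ β`
(`IsMolecule.exists_norm_deriv_frameSymbol_le`). Hence `1/m` and its powers are again bounded with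
derivative `≲ β`, and the vectors `A_σ^{-κ} π(σ(z))φ` keep the shape `e^{-2πixξ} P(ω,ξ)` with
`P(ω,·)` localized near `ω` at scale `1/β(ω)`: they are molecules (`isMolecule_fmul_atom`).

Localization is measured by the warping function `W`, whose derivative is `(1-α)β`. Thus `β(ω) dω`
is a multiple of `dW`, and with `d = 1 + |W(ω) - W(ξ)|` the passage from `ω` to `ξ` costs
`d^{s/(1-α)}` in the weight and `d^{α/(1-α)}` in `β`. The kernel of two molecule families is the
Fourier transform of `P(ω,·) conj P'(ω*,·)` at `x - x*`. Its `L¹` norm in `x` is controlled by the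
`L²` norms of this product and of its derivative (`lintegral_fourier_le`), which gives `(β(ω) +
β(ω*)) d^{-t}`. The integral over `ω` then converges for `t > 1 + s/(1-α) + α/(1-α)`
(`IsMolecule.lintegral_kernel_le`). The multiplier costs another `α/(1-α)` of decay, so `r > 1 +
s/(1-α) + 2α/(1-α)` suffices (`exponent_bound`).

For the coorbit spaces, atoms `e` and dual atoms `d` reproduce each other: `f = ∫ ⟨f, d(y)⟩ e(y)
dy`. A change of analyzing family is therefore an integral operator with a molecule kernel, bounded
on every weighted `L^p` by Schur's test. The expansion converges in the norm of the reservoir, so it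
passes to bounded functionals as `F(u) = ∫ F(e(y)) ⟨d(y), u⟩ dy` (`IsDualPair.pair_eq_integral`).
Consequently any two molecule frames define the same spaces (`IsMoleculeFrame.coorbit_eq`), and the
last two assertions are instances of this. -/

lemma integral_fourier_mul_eq {f g : ℝ → ℂ} (hf : Integrable f) (hg : Integrable g) :
    ∫ ξ, 𝓕 f ξ * g ξ = ∫ x, f x * 𝓕 g x := by
  have h := VectorFourier.integral_fourierIntegral_smul_eq_flip (L := innerₗ ℝ) (μ := volume)
    (ν := volume) Real.continuous_fourierChar continuous_inner hf hg
  rw [flip_innerₗ] at h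
  exact h

lemma continuous_fourier {f : ℝ → ℂ} (hf : Integrable f) : Continuous (𝓕 f) :=
  VectorFourier.fourierIntegral_continuous Real.continuous_fourierChar
    continuous_inner hf

/-- The `L²` transform agrees with that of tempered distributions. Against a smooth compactly
supported test function, the multiplication formula moves the transform back onto `f`, which
identifies it with the Fourier integral. -/
theorem fourier_toLp_ae {f : ℝ → ℂ} (h1 : Integrable f) (h2 : MemLp f 2 volume) :
    ⇑(𝓕 (h2.toLp f) : L2) =ᵐ[volume] 𝓕 f := by
  refine ae_eq_of_integral_contDiff_smul_eq
    ((Lp.memLp _).locallyIntegrable (by norm_num)) (continuous_fourier h1).locallyIntegrable ?_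
  intro g hg hgc
  have hc : HasCompactSupport (fun x => (g x : ℂ)) := hgc.comp_left (g := ((↑) : ℝ → ℂ)) rfl
  have hs : ContDiff ℝ ∞ (fun x => (g x : ℂ)) := Complex.ofRealCLM.contDiff.comp hg
  set θ : 𝓢(ℝ, ℂ) := hc.toSchwartzMap hs with hθ
  have hθg : ∀ x, θ x = (g x : ℂ) := fun x => rfl
  have key := congrArg (fun T : 𝓢'(ℝ, ℂ) => T θ)
    (Lp.fourier_toTemperedDistribution_eq (h2.toLp f))
  simp only [TemperedDistribution.fourier_apply, Lp.toTemperedDistribution_apply] at key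
  have e1 : ∫ x, g x • (𝓕 (h2.toLp f) : L2) x = ∫ x, θ x • (𝓕 (h2.toLp f) : L2) x := by
    simp [hθg]
  have e2 : ∫ x, (𝓕 θ) x • (h2.toLp f) x = ∫ x, 𝓕 (⇑θ) x * f x := by
    refine integral_congr_ae ?_
    filter_upwards [h2.coeFn_toLp] with x hx
    rw [hx, SchwartzMap.fourier_coe, smul_eq_mul]
  rw [e1, ← key, e2, integral_fourier_mul_eq θ.integrable h1]
  simp [hθg]

lemma fourierInv_eq_fourier_neg (f : ℝ → ℂ) (x : ℝ) : 𝓕⁻ f x = 𝓕 f (-x) :=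
  Real.fourierInv_eq_fourier_neg f x

lemma continuous_fourierInv {f : ℝ → ℂ} (hf : Integrable f) : Continuous (𝓕⁻ f) := by
  have : 𝓕⁻ f = fun x => 𝓕 f (-x) := funext fun x => fourierInv_eq_fourier_neg f x
  rw [this]
  exact (continuous_fourier hf).comp continuous_neg

lemma integral_fourierInv_mul_eq {f g : ℝ → ℂ} (hf : Integrable f) (hg : Integrable g) :
    ∫ ξ, 𝓕⁻ f ξ * g ξ = ∫ x, f x * 𝓕⁻ g x := by
  have e : ∀ x, 𝓕⁻ g x = 𝓕 (fun t => g (-t)) x := fun x => by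
    rw [Real.fourierInv_eq_fourier_comp_neg]
  simp only [e]
  rw [← integral_fourier_mul_eq hf hg.comp_neg]
  simp only [fourierInv_eq_fourier_neg]
  rw [← integral_neg_eq_self]
  simp

theorem fourierInv_toLp_ae {f : ℝ → ℂ} (h1 : Integrable f) (h2 : MemLp f 2 volume) :
    ⇑(𝓕⁻ (h2.toLp f) : L2) =ᵐ[volume] 𝓕⁻ f := by
  refine ae_eq_of_integral_contDiff_smul_eq
    ((Lp.memLp _).locallyIntegrable (by norm_num)) (continuous_fourierInv h1).locallyIntegrable ?_
  intro g hg hgc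
  have hc : HasCompactSupport (fun x => (g x : ℂ)) := hgc.comp_left (g := ((↑) : ℝ → ℂ)) rfl
  have hs : ContDiff ℝ ∞ (fun x => (g x : ℂ)) := Complex.ofRealCLM.contDiff.comp hg
  set θ : 𝓢(ℝ, ℂ) := hc.toSchwartzMap hs with hθ
  have hθg : ∀ x, θ x = (g x : ℂ) := fun x => rfl
  have key := congrArg (fun T : 𝓢'(ℝ, ℂ) => T θ)
    (Lp.fourierInv_toTemperedDistribution_eq (h2.toLp f))
  simp only [TemperedDistribution.fourierInv_apply, Lp.toTemperedDistribution_apply] at key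
  have e1 : ∫ x, g x • (𝓕⁻ (h2.toLp f) : L2) x = ∫ x, θ x • (𝓕⁻ (h2.toLp f) : L2) x := by
    simp [hθg]
  have e2 : ∫ x, (𝓕⁻ θ) x • (h2.toLp f) x = ∫ x, 𝓕⁻ (⇑θ) x * f x := by
    refine integral_congr_ae ?_
    filter_upwards [h2.coeFn_toLp] with x hx
    rw [hx, SchwartzMap.fourierInv_coe, smul_eq_mul]
  rw [e1, ← key, e2, integral_fourierInv_mul_eq θ.integrable h1]
  simp [hθg]

/-- Plancherel's theorem on `L¹ ∩ L²`. -/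
theorem eLpNorm_fourier_eq {f : ℝ → ℂ} (h1 : Integrable f) (h2 : MemLp f 2 volume) :
    eLpNorm (𝓕 f) 2 volume = eLpNorm f 2 volume := by
  rw [← eLpNorm_congr_ae (fourier_toLp_ae h1 h2), ← eLpNorm_congr_ae h2.coeFn_toLp,
    ← Lp.enorm_def, ← Lp.enorm_def, ← ofReal_norm, ← ofReal_norm, Lp.norm_fourier_eq]

lemma ip_eq_integral (f g : L2) : ip f g = ∫ t, f t * starRingEnd ℂ (g t) := by
  rw [ip, MeasureTheory.L2.inner_def]
  rfl

lemma ip_fourier (f g : L2) : ip (𝓕 f) (𝓕 g) = ip f g := Lp.inner_fourier_eq g f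

lemma ip_fourierInv (f g : L2) : ip (𝓕⁻ f) (𝓕⁻ g) = ip f g := by
  rw [← ip_fourier, FourierTransform.fourier_fourierInv_eq, FourierTransform.fourier_fourierInv_eq]

/-- Parseval's formula for the inverse Fourier integral on `L¹ ∩ L²`. -/
theorem parseval_fourierInv {f g : ℝ → ℂ} (hf1 : Integrable f) (hf2 : MemLp f 2 volume)
    (hg1 : Integrable g) (hg2 : MemLp g 2 volume) :
    ∫ x, 𝓕⁻ f x * starRingEnd ℂ (𝓕⁻ g x) = ∫ ξ, f ξ * starRingEnd ℂ (g ξ) := by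
  have h := ip_fourierInv (hf2.toLp f) (hg2.toLp g)
  rw [ip_eq_integral, ip_eq_integral] at h
  calc _ = _ := integral_congr_ae ?_
    _ = _ := h
    _ = _ := integral_congr_ae ?_
  · filter_upwards [fourierInv_toLp_ae hf1 hf2, fourierInv_toLp_ae hg1 hg2] with x h1 h2
    rw [h1, h2]
  · filter_upwards [hf2.coeFn_toLp, hg2.coeFn_toLp] with x h1 h2
    rw [h1, h2]

theorem eLpNorm_fourierInv_eq {f : ℝ → ℂ} (h1 : Integrable f) (h2 : MemLp f 2 volume) :
    eLpNorm (𝓕⁻ f) 2 volume = eLpNorm f 2 volume := by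
  have hn : ‖(𝓕⁻ (h2.toLp f) : L2)‖ = ‖h2.toLp f‖ := by
    rw [← Lp.norm_fourier_eq, FourierTransform.fourier_fourierInv_eq]
  rw [← eLpNorm_congr_ae (fourierInv_toLp_ae h1 h2), ← eLpNorm_congr_ae h2.coeFn_toLp,
    ← Lp.enorm_def, ← Lp.enorm_def, ← ofReal_norm, ← ofReal_norm, hn]

end AlphaMod

namespace AlphaMod

/-! ### The warping function -/

/-- The warping function `ω ↦ sgn(ω) ((1 + |ω|)^{1-α} - 1)`, which up to a constant factor is the
primitive of `β`. -/
noncomputable def warp (α ω : ℝ) : ℝ :=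
  if 0 ≤ ω then (1 + ω) ^ (1 - α) - 1 else 1 - (1 - ω) ^ (1 - α)

/-- The distance of two frequencies in the warped scale, plus one. -/
noncomputable def wdist (α ω ξ : ℝ) : ℝ := 1 + |warp α ω - warp α ξ|

lemma one_le_wdist (α ω ξ : ℝ) : 1 ≤ wdist α ω ξ := by
  unfold wdist; linarith [abs_nonneg (warp α ω - warp α ξ)]

lemma wdist_pos (α ω ξ : ℝ) : 0 < wdist α ω ξ := one_pos.trans_le (one_le_wdist α ω ξ)

lemma wdist_comm (α ω ξ : ℝ) : wdist α ω ξ = wdist α ξ ω := by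
  rw [wdist, wdist, abs_sub_comm]

lemma wdist_le_add (α ω ξ η : ℝ) : wdist α ω η ≤ wdist α ω ξ + wdist α η ξ := by
  rw [wdist_comm α η ξ]
  unfold wdist
  linarith [abs_sub_le (warp α ω) (warp α ξ) (warp α η)]

variable {α : ℝ}

lemma abs_warp (hα1 : α < 1) (ω : ℝ) : |warp α ω| = (1 + |ω|) ^ (1 - α) - 1 := by
  have h1 : (1 : ℝ) ≤ (1 + |ω|) ^ (1 - α) :=
    Real.one_le_rpow (by linarith [abs_nonneg ω]) (by linarith)
  unfold warp
  split_ifs with h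
  · rw [abs_of_nonneg h] at *
    exact abs_of_nonneg (by linarith)
  · rw [abs_of_neg (not_le.1 h)] at *
    rw [← sub_eq_add_neg] at *
    rw [abs_of_nonpos (by linarith)]
    ring

/-- Since `y^(a-1)` is decreasing, `B^(a-1)` may be exchanged for `A^(a-1)` in the favourable
direction whichever of `A`, `B` is larger. The prefactor thus depends on one chosen end point only.
-/
lemma abs_rpow_sub_rpow_le {a A B : ℝ} (ha0 : 0 ≤ a) (ha1 : a ≤ 1) (hA : 0 < A) (hB : 0 < B) :
    |A ^ a - B ^ a| ≤ A ^ (a - 1) * |A - B| := by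
  have eA : A ^ a = A ^ (a - 1) * A := by
    nth_rw 3 [← Real.rpow_one A]; rw [← Real.rpow_add hA]; ring_nf
  have eB : B ^ a = B ^ (a - 1) * B := by
    nth_rw 3 [← Real.rpow_one B]; rw [← Real.rpow_add hB]; ring_nf
  rcases le_total A B with h | h
  · have h1 : B ^ (a - 1) ≤ A ^ (a - 1) := Real.rpow_le_rpow_of_nonpos hA h (by linarith)
    have h2 : B ^ (a - 1) * B ≤ A ^ (a - 1) * B := mul_le_mul_of_nonneg_right h1 hB.le
    rw [abs_of_nonpos (by linarith : A - B ≤ 0),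
      abs_of_nonpos (by linarith [Real.rpow_le_rpow hA.le h ha0]), eA, eB]
    linarith
  · have h1 : A ^ (a - 1) ≤ B ^ (a - 1) := Real.rpow_le_rpow_of_nonpos hB h (by linarith)
    have h2 : A ^ (a - 1) * B ≤ B ^ (a - 1) * B := mul_le_mul_of_nonneg_right h1 hB.le
    rw [abs_of_nonneg (by linarith : 0 ≤ A - B),
      abs_of_nonneg (by linarith [Real.rpow_le_rpow hB.le h ha0]), eA, eB]
    linarith

lemma abs_rpow_one_add_abs_sub_le (hα0 : 0 ≤ α) (hα1 : α < 1) (ω ξ : ℝ) :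
    |(1 + |ω|) ^ (1 - α) - (1 + |ξ|) ^ (1 - α)| ≤ beta α ω * |(|ω| - |ξ|)| := by
  have h := abs_rpow_sub_rpow_le (a := 1 - α) (A := 1 + |ω|) (B := 1 + |ξ|)
    (by linarith) (by linarith) (by positivity) (by positivity)
  rwa [show 1 - α - 1 = -α by ring, add_sub_add_left_eq_sub] at h

lemma abs_warp_sub_le (hα0 : 0 ≤ α) (hα1 : α < 1) (ω ξ : ℝ) :
    |warp α ω - warp α ξ| ≤ 3 * (beta α ω * |ω - ξ|) := by
  have hβ := beta_pos α ω
  have key := abs_rpow_one_add_abs_sub_le hα0 hα1 ω ξ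
  have hm : beta α ω * |(|ω| - |ξ|)| ≤ beta α ω * |ω - ξ| :=
    mul_le_mul_of_nonneg_left (abs_abs_sub_abs_le _ _) hβ.le
  have hn : 0 ≤ beta α ω * |ω - ξ| := by positivity
  by_cases hs : 0 ≤ ω ↔ 0 ≤ ξ
  · have : |warp α ω - warp α ξ| = |(1 + |ω|) ^ (1 - α) - (1 + |ξ|) ^ (1 - α)| := by
      by_cases h : 0 ≤ ω
      · have h' := hs.1 h
        simp only [warp, if_pos h, if_pos h', abs_of_nonneg h, abs_of_nonneg h']
        ring_nf
      · have h' := fun H => h (hs.2 H)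
        simp only [warp, if_neg h, if_neg h', abs_of_neg (not_le.1 h), abs_of_neg (not_le.1 h')]
        rw [abs_sub_comm]
        ring_nf
    rw [this]
    linarith
  · have hd : |ω - ξ| = |ω| + |ξ| := by
      rcases le_or_gt 0 ω with h | h <;> rcases le_or_gt 0 ξ with h' | h'
      · exact absurd (by constructor <;> intro <;> linarith) hs
      · rw [abs_of_nonneg h, abs_of_neg h', abs_of_nonneg (by linarith)]; ring
      · rw [abs_of_neg h, abs_of_nonneg h', abs_of_neg (by linarith)]; ring
      · exact absurd (by constructor <;> intro <;> linarith) hs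
    -- For opposite signs `|ω| ≤ |ω - ξ|`. The bound on `|warp α ω|` uses `β(ω)|ω - ξ|` once, and
    -- the bound on `|warp α ξ|`, routed through `ω`, uses it twice; this is the constant 3.
    have k0 := abs_rpow_one_add_abs_sub_le hα0 hα1 ω 0
    simp only [abs_zero, add_zero, Real.one_rpow, sub_zero, abs_abs] at k0
    have k1 := (le_abs_self _).trans k0
    have k2 := (neg_le_abs _).trans key
    have k3 := abs_sub (warp α ω) (warp α ξ)
    rw [abs_warp hα1, abs_warp hα1] at k3
    have k4 : beta α ω * |ω| ≤ beta α ω * |ω - ξ| :=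
      mul_le_mul_of_nonneg_left (by rw [hd]; linarith [abs_nonneg ξ]) hβ.le
    linarith

lemma wdist_le (hα0 : 0 ≤ α) (hα1 : α < 1) (ω ξ : ℝ) :
    wdist α ω ξ ≤ 3 * (1 + beta α ω * |ω - ξ|) := by
  have := abs_warp_sub_le hα0 hα1 ω ξ
  unfold wdist
  linarith

/-- As `(1+|ω|)^(1-α) = 1 + |warp α ω|`, the triangle inequality for `warp` becomes multiplicative
through `1 + a + b ≤ (1 + a)(1 + b)`. -/
lemma one_add_abs_le (hα1 : α < 1) (ω ξ : ℝ) :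
    1 + |ω| ≤ (1 + |ξ|) * wdist α ω ξ ^ (1 / (1 - α)) := by
  have ha : 0 < 1 - α := by linarith
  have h : (1 + |ω|) ^ (1 - α) ≤ (1 + |ξ|) ^ (1 - α) * wdist α ω ξ := by
    have h1 := abs_warp hα1 ω
    have h2 := abs_warp hα1 ξ
    have h3 : |warp α ω| ≤ |warp α ξ| + |warp α ω - warp α ξ| := by
      have := abs_add_le (warp α ξ) (warp α ω - warp α ξ)
      rwa [add_sub_cancel] at this
    have h4 : 1 ≤ (1 + |ξ|) ^ (1 - α) :=
      Real.one_le_rpow (by linarith [abs_nonneg ξ]) ha.le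
    have h5 := abs_nonneg (warp α ω - warp α ξ)
    unfold wdist
    nlinarith
  have h6 := Real.rpow_le_rpow (by positivity) h (one_div_pos.2 ha).le
  rw [Real.mul_rpow (by positivity) (wdist_pos _ _ _).le, ← Real.rpow_mul (by positivity),
    ← Real.rpow_mul (by positivity), mul_one_div_cancel ha.ne', Real.rpow_one, Real.rpow_one] at h6
  exact h6

lemma one_add_abs_rpow_le (hα1 : α < 1) {s : ℝ} (hs : 0 ≤ s) (ω ξ : ℝ) :
    (1 + |ω|) ^ s ≤ (1 + |ξ|) ^ s * wdist α ω ξ ^ (s / (1 - α)) := by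
  have h := Real.rpow_le_rpow (by positivity) (one_add_abs_le hα1 ω ξ) hs
  rwa [Real.mul_rpow (by positivity) (Real.rpow_nonneg (wdist_pos _ _ _).le _),
    ← Real.rpow_mul (wdist_pos _ _ _).le, one_div_mul_eq_div] at h

lemma beta_le (hα0 : 0 ≤ α) (hα1 : α < 1) (ω ξ : ℝ) :
    beta α ω ≤ beta α ξ * wdist α ω ξ ^ (α / (1 - α)) := by
  have h := one_add_abs_rpow_le hα1 hα0 ξ ω
  rw [wdist_comm] at h
  unfold beta
  rw [Real.rpow_neg (by positivity), Real.rpow_neg (by positivity), inv_mul_eq_div,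
    le_div_iff₀ (by positivity), inv_mul_le_iff₀ (by positivity)]
  exact h

lemma beta_le_one (hα0 : 0 ≤ α) (ω : ℝ) : beta α ω ≤ 1 :=
  Real.rpow_le_one_of_one_le_of_nonpos (by linarith [abs_nonneg ω]) (by linarith)

lemma continuous_beta (α : ℝ) : Continuous (beta α) := by
  unfold beta
  exact (by fun_prop : Continuous fun ω : ℝ => 1 + |ω|).rpow_const
    fun ω => Or.inl (by positivity)

lemma polyWeight_pos (s : ℝ) (z : X) : 0 < polyWeight s z :=
  Real.rpow_pos_of_pos (by positivity) _

lemma ratioWeight_comm (v : X → ℝ) (z z' : X) : ratioWeight v z z' = ratioWeight v z' z :=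
  max_comm _ _

lemma ratioWeight_polyWeight_le (hα1 : α < 1) {s : ℝ} (hs : 0 ≤ s) (z z' : X) :
    ratioWeight (polyWeight s) z z' ≤ wdist α z.2 z'.2 ^ (s / (1 - α)) := by
  refine max_le ?_ ?_
  · rw [div_le_iff₀ (polyWeight_pos s z'), mul_comm]
    exact one_add_abs_rpow_le hα1 hs _ _
  · rw [div_le_iff₀ (polyWeight_pos s z), mul_comm, wdist_comm]
    exact one_add_abs_rpow_le hα1 hs _ _

/-- The point 0, where the two branches meet, is left out; being a null set it does not matter for
the change of variables. -/
lemma hasDerivAt_warp (ω : ℝ) (hω : ω ≠ 0) :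
    HasDerivAt (warp α) ((1 - α) * beta α ω) ω := by
  rcases lt_or_gt_of_ne hω with h | h
  · have h1 : HasDerivAt (fun t : ℝ => 1 - (1 - t) ^ (1 - α)) ((1 - α) * beta α ω) ω := by
      have h0 : (0 : ℝ) < 1 - ω := by linarith
      have := ((hasDerivAt_id' ω).const_sub 1).rpow_const (p := 1 - α) (Or.inl h0.ne')
      refine (this.const_sub 1).congr_deriv ?_
      rw [beta, abs_of_neg h]
      rw [show 1 - α - 1 = -α by ring]
      ring_nf
    refine h1.congr_of_eventuallyEq ?_
    filter_upwards [Iio_mem_nhds h] with t ht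
    rw [warp, if_neg (not_le.2 ht)]
  · have h1 : HasDerivAt (fun t : ℝ => (1 + t) ^ (1 - α) - 1) ((1 - α) * beta α ω) ω := by
      have h0 : (0 : ℝ) < 1 + ω := by linarith
      have := ((hasDerivAt_id' ω).const_add 1).rpow_const (p := 1 - α) (Or.inl h0.ne')
      refine (this.sub_const 1).congr_deriv ?_
      rw [beta, abs_of_pos h]
      rw [show 1 - α - 1 = -α by ring]
      ring_nf
    refine h1.congr_of_eventuallyEq ?_
    filter_upwards [Ioi_mem_nhds h] with t ht
    rw [warp, if_pos (le_of_lt ht)]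

lemma warp_strictMono (hα1 : α < 1) : StrictMono (warp α) := by
  have ha : 0 < 1 - α := by linarith
  intro ω ξ h
  by_cases h0 : 0 ≤ ω
  · have h1 : 0 ≤ ξ := by linarith
    rw [warp, warp, if_pos h0, if_pos h1]
    have := Real.rpow_lt_rpow (by linarith) (by linarith : 1 + ω < 1 + ξ) ha
    linarith
  · have h2 : 1 < (1 - ω) ^ (1 - α) := Real.one_lt_rpow (by linarith) ha
    by_cases h1 : 0 ≤ ξ
    · rw [warp, warp, if_neg h0, if_pos h1]
      have : 1 ≤ (1 + ξ) ^ (1 - α) := Real.one_le_rpow (by linarith) ha.le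
      linarith
    · rw [warp, warp, if_neg h0, if_neg h1]
      have := Real.rpow_lt_rpow (by linarith) (by linarith : 1 - ξ < 1 - ω) ha
      linarith

/-! ### Integrals in the warped scale -/

/-- The decay integral `∫ (1 + |u|)^{-N} du`. -/
noncomputable def decayInt (N : ℝ) : ℝ≥0∞ := ∫⁻ u : ℝ, ENNReal.ofReal ((1 + |u|) ^ (-N))

lemma decayInt_lt_top {N : ℝ} (hN : 1 < N) : decayInt N < ∞ := by
  have h : Integrable (fun x : ℝ => (1 + ‖x‖) ^ (-N)) :=
    integrable_one_add_norm (by simpa using hN)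
  have := h.2
  rw [hasFiniteIntegral_iff_ofReal (Filter.Eventually.of_forall fun x => by positivity)] at this
  exact this

/-- Substitution `u = warp α ω`, with `du = (1-α) β(ω) dω`. No condition on `N` is needed, as the
right-hand side may be infinite. -/
lemma lintegral_beta_wdist_le (hα1 : α < 1) {N : ℝ} (c : ℝ) :
    ∫⁻ ω, ENNReal.ofReal (beta α ω * wdist α ω c ^ (-N)) ≤
      ENNReal.ofReal (1 / (1 - α)) * decayInt N := by
  have ha : 0 < 1 - α := by linarith
  have h := lintegral_image_eq_lintegral_abs_deriv_mul (measurableSet_singleton (0 : ℝ)).compl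
    (fun ω hω => (hasDerivAt_warp (α := α) ω hω).hasDerivWithinAt)
    (warp_strictMono hα1).injective.injOn
    (fun u => ENNReal.ofReal ((1 + |u - warp α c|) ^ (-N)))
  have h1 : ∫⁻ u in warp α '' {0}ᶜ, ENNReal.ofReal ((1 + |u - warp α c|) ^ (-N)) ≤ decayInt N := by
    refine (setLIntegral_le_lintegral _ _).trans_eq ?_
    exact lintegral_sub_right_eq_self (fun u : ℝ => ENNReal.ofReal ((1 + |u|) ^ (-N))) _
  have h2 : ∫⁻ ω, ENNReal.ofReal (beta α ω * wdist α ω c ^ (-N)) =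
      ENNReal.ofReal (1 / (1 - α)) * ∫⁻ ω in {0}ᶜ, ENNReal.ofReal |(1 - α) * beta α ω| *
        ENNReal.ofReal ((1 + |warp α ω - warp α c|) ^ (-N)) := by
    rw [← lintegral_const_mul' _ _ ENNReal.ofReal_ne_top,
      setLIntegral_congr (ae_eq_univ.2 (by simp)), setLIntegral_univ]
    refine lintegral_congr fun ω => ?_
    have hβ := beta_pos α ω
    have hd : 0 ≤ wdist α ω c ^ (-N) := Real.rpow_nonneg (wdist_pos _ _ _).le _
    rw [← ENNReal.ofReal_mul (abs_nonneg _), ← ENNReal.ofReal_mul (by positivity),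
      abs_of_pos (by positivity)]
    congr 1
    unfold wdist
    field_simp
  rw [h2, ← h]
  gcongr

/-- The missing density `β(ξ)` is inserted by `1 ≤ β(ω)⁻¹ β(ξ) d^{α/(1-α)}`, which explains both the
factor `β(ω)⁻¹` and the loss in the exponent. -/
lemma lintegral_wdist_le (hα0 : 0 ≤ α) (hα1 : α < 1) {N : ℝ} (ω : ℝ) :
    ∫⁻ ξ, ENNReal.ofReal (wdist α ω ξ ^ (-N)) ≤
      ENNReal.ofReal (beta α ω)⁻¹ *
        (ENNReal.ofReal (1 / (1 - α)) * decayInt (N - α / (1 - α))) := by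
  refine le_trans ?_ (mul_le_mul_right (lintegral_beta_wdist_le hα1 ω) _)
  rw [← lintegral_const_mul' _ _ ENNReal.ofReal_ne_top]
  refine lintegral_mono fun ξ => ?_
  have hβ := beta_pos α ω
  rw [← ENNReal.ofReal_mul (by positivity)]
  refine ENNReal.ofReal_le_ofReal ?_
  have h := beta_le hα0 hα1 ω ξ
  have hd := wdist_pos α ω ξ
  have hN := Real.rpow_pos_of_pos hd (-N)
  rw [wdist_comm α ξ ω, show -(N - α / (1 - α)) = α / (1 - α) + -N by ring, Real.rpow_add hd,
    le_inv_mul_iff₀ hβ]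
  nlinarith

end AlphaMod

namespace AlphaMod

/-! ### Integrability of Fourier transforms -/

lemma lintegral_enorm_sq_eq (f : ℝ → ℂ) :
    ∫⁻ x, ‖f x‖ₑ ^ 2 = eLpNorm f 2 volume ^ 2 := by
  have := eLpNorm_nnreal_pow_eq_lintegral (f := f) (μ := (volume : Measure ℝ))
    (p := 2) (by norm_num)
  simp only [NNReal.coe_ofNat, ENNReal.rpow_ofNat, ENNReal.coe_ofNat] at this
  exact this.symm

lemma memLp_two_of_lintegral_sq {f : ℝ → ℂ} (hf : AEStronglyMeasurable f volume)
    (h : ∫⁻ x, ‖f x‖ₑ ^ 2 < ∞) : MemLp f 2 volume := by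
  refine ⟨hf, ?_⟩
  rw [lintegral_enorm_sq_eq] at h
  exact lt_top_iff_ne_top.2 fun H => by simp [H] at h

lemma lintegral_inv_one_add_sq_div {l : ℝ} (hl : 0 < l) :
    ∫⁻ x : ℝ, ENNReal.ofReal ((1 + (x / l) ^ 2)⁻¹) = ENNReal.ofReal (l * Real.pi) := by
  rw [← ofReal_integral_eq_lintegral_ofReal (integrable_inv_one_add_sq.comp_div hl.ne')
    (Filter.Eventually.of_forall fun x => by positivity),
    Measure.integral_comp_div (fun x : ℝ => (1 + x ^ 2)⁻¹), integral_univ_inv_one_add_sq,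
    abs_of_pos hl, smul_eq_mul]

/-- Pointwise form of the weighted Cauchy-Schwarz inequality, obtained by expanding a square. The
parameter `ε` stays free so that the two terms can be balanced after integration. -/
lemma le_div_add_mul_sq {ε W y : ℝ} (hε : 0 < ε) (hW : 0 < W) :
    y ≤ ε * W⁻¹ + ε⁻¹ * (W * y ^ 2) := by
  have h : 0 ≤ ε * W⁻¹ * (1 - ε⁻¹ * W * y) ^ 2 := by positivity
  have e : ε * W⁻¹ * (1 - ε⁻¹ * W * y) ^ 2 = ε * W⁻¹ + ε⁻¹ * (W * y ^ 2) - 2 * y := by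
    field_simp
    ring
  rw [e] at h
  rcases le_or_gt 0 y with hy | hy
  · linarith
  · have : 0 ≤ ε * W⁻¹ + ε⁻¹ * (W * y ^ 2) := by positivity
    linarith

/-- The `L¹` norm of the Fourier transform is controlled by `L²` norms of the function and of its
derivative, with a scaling parameter. -/
theorem lintegral_fourier_le {G : ℝ → ℂ} (hd : Differentiable ℝ G) (h1 : Integrable G)
    (h1' : Integrable (deriv G)) {l M : ℝ} (hl : 0 < l) (hM0 : 0 < M)
    (hM : ∫⁻ x, ‖G x‖ₑ ^ 2 ≤ ENNReal.ofReal M)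
    (hM' : ∫⁻ x, ‖deriv G x‖ₑ ^ 2 ≤ ENNReal.ofReal (l ^ 2 * M)) :
    ∫⁻ x, ‖𝓕 G x‖ₑ ≤ ENNReal.ofReal ((Real.pi + 2) * √(l * M)) := by
  have h2 : MemLp G 2 volume :=
    memLp_two_of_lintegral_sq h1.aestronglyMeasurable (hM.trans_lt ENNReal.ofReal_lt_top)
  have h2' : MemLp (deriv G) 2 volume :=
    memLp_two_of_lintegral_sq h1'.aestronglyMeasurable (hM'.trans_lt ENNReal.ofReal_lt_top)
  have k1 : ∫⁻ x, ‖𝓕 G x‖ₑ ^ 2 ≤ ENNReal.ofReal M := by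
    rwa [lintegral_enorm_sq_eq, eLpNorm_fourier_eq h1 h2, ← lintegral_enorm_sq_eq]
  have k2 : ∫⁻ x, ‖𝓕 (deriv G) x‖ₑ ^ 2 ≤ ENNReal.ofReal (l ^ 2 * M) := by
    rwa [lintegral_enorm_sq_eq, eLpNorm_fourier_eq h1' h2', ← lintegral_enorm_sq_eq]
  have k3 : ∀ x, |x| * ‖𝓕 G x‖ ≤ ‖𝓕 (deriv G) x‖ := by
    intro x
    rw [Real.fourier_deriv h1 hd h1']
    simp only [smul_eq_mul, norm_mul, Complex.norm_real, Complex.norm_I, Complex.norm_ofNat,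
      Real.norm_eq_abs, abs_of_pos Real.pi_pos, mul_one]
    have : 0 ≤ |x| * ‖𝓕 G x‖ := by positivity
    have h3 := Real.pi_gt_three
    nlinarith
  -- With the weight `1 + (x/l)²`, integration produces `ε l π` and `2 ε⁻¹ M`. This `ε` makes both
  -- multiples of `√(l M)`.
  set ε := √(M / l) with hεdef
  have hε : 0 < ε := Real.sqrt_pos.2 (by positivity)
  have hmeas : Measurable fun x => ‖𝓕 G x‖ₑ := (continuous_fourier h1).measurable.enorm
  have pw : ∀ x, ‖𝓕 G x‖ₑ ≤ ENNReal.ofReal ε * ENNReal.ofReal ((1 + (x / l) ^ 2)⁻¹) +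
      (ENNReal.ofReal ε⁻¹ * ‖𝓕 G x‖ₑ ^ 2 +
        ENNReal.ofReal (ε⁻¹ * (l ^ 2)⁻¹) * ‖𝓕 (deriv G) x‖ₑ ^ 2) := by
    intro x
    have h := le_div_add_mul_sq (y := ‖𝓕 G x‖) hε (by positivity : 0 < 1 + (x / l) ^ 2)
    rw [← ofReal_norm, ← ofReal_norm, ← ENNReal.ofReal_pow (norm_nonneg _),
      ← ENNReal.ofReal_pow (norm_nonneg _), ← ENNReal.ofReal_mul hε.le,
      ← ENNReal.ofReal_mul (by positivity), ← ENNReal.ofReal_mul (by positivity),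
      ← ENNReal.ofReal_add (by positivity) (by positivity),
      ← ENNReal.ofReal_add (by positivity) (by positivity)]
    refine ENNReal.ofReal_le_ofReal (h.trans ?_)
    have hsq : x ^ 2 * ‖𝓕 G x‖ ^ 2 ≤ ‖𝓕 (deriv G) x‖ ^ 2 := by
      rw [← sq_abs x, ← mul_pow]
      exact pow_le_pow_left₀ (by positivity) (k3 x) 2
    have : ε⁻¹ * ((1 + (x / l) ^ 2) * ‖𝓕 G x‖ ^ 2) =
        ε⁻¹ * ‖𝓕 G x‖ ^ 2 + ε⁻¹ * (l ^ 2)⁻¹ * (x ^ 2 * ‖𝓕 G x‖ ^ 2) := by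
      field_simp
    rw [this]
    gcongr
  calc ∫⁻ x, ‖𝓕 G x‖ₑ ≤ ∫⁻ x, (ENNReal.ofReal ε * ENNReal.ofReal ((1 + (x / l) ^ 2)⁻¹) +
      (ENNReal.ofReal ε⁻¹ * ‖𝓕 G x‖ₑ ^ 2 +
        ENNReal.ofReal (ε⁻¹ * (l ^ 2)⁻¹) * ‖𝓕 (deriv G) x‖ₑ ^ 2)) := lintegral_mono pw
    _ = ENNReal.ofReal ε * ENNReal.ofReal (l * Real.pi) +
      (ENNReal.ofReal ε⁻¹ * (∫⁻ x, ‖𝓕 G x‖ₑ ^ 2) +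
        ENNReal.ofReal (ε⁻¹ * (l ^ 2)⁻¹) * ∫⁻ x, ‖𝓕 (deriv G) x‖ₑ ^ 2) := by
      rw [lintegral_add_left (by fun_prop), lintegral_add_left (by fun_prop),
        lintegral_const_mul' _ _ ENNReal.ofReal_ne_top, lintegral_const_mul' _ _ ENNReal.ofReal_ne_top,
        lintegral_const_mul' _ _ ENNReal.ofReal_ne_top, lintegral_inv_one_add_sq_div hl]
    _ ≤ ENNReal.ofReal ε * ENNReal.ofReal (l * Real.pi) +
      (ENNReal.ofReal ε⁻¹ * ENNReal.ofReal M +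
        ENNReal.ofReal (ε⁻¹ * (l ^ 2)⁻¹) * ENNReal.ofReal (l ^ 2 * M)) := by gcongr
    _ = ENNReal.ofReal ((Real.pi + 2) * √(l * M)) := by
      have hpi := Real.pi_pos
      rw [← ENNReal.ofReal_mul hε.le, ← ENNReal.ofReal_mul (by positivity),
        ← ENNReal.ofReal_mul (by positivity), ← ENNReal.ofReal_add (by positivity) (by positivity),
        ← ENNReal.ofReal_add (by positivity) (by positivity)]
      congr 1
      have e1 : √(l * M) = ε * l := by
        rw [Real.sqrt_eq_iff_mul_self_eq (by positivity) (by positivity)]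
        have : ε * ε = M / l := Real.mul_self_sqrt (by positivity)
        calc l * M = (M / l) * l * l := by field_simp
          _ = ε * l * (ε * l) := by rw [← this]; ring
      have e2 : ε⁻¹ * M = ε * l := by
        have : ε * ε = M / l := Real.mul_self_sqrt (by positivity)
        rw [inv_mul_eq_iff_eq_mul₀ hε.ne', ← mul_assoc, this]
        field_simp
      have e3 : ε⁻¹ * (l ^ 2)⁻¹ * (l ^ 2 * M) = ε⁻¹ * M := by field_simp
      rw [e3, e2, e1]
      ring

/-! ### Molecules -/

/-- A family of vectors `e(x, ω)` whose Fourier transforms are `e^{-2πixξ} P(ω, ξ)` with a profile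
`P` that is localized in frequency near `ω` at the scale `1/β(ω)`. -/
structure IsMolecule (α t C : ℝ) (e : X → L2) (P : ℝ → ℝ → ℂ) : Prop where
  pos : 0 < C
  cont : Continuous fun p : ℝ × ℝ => P p.1 p.2
  diff : ∀ ω, Differentiable ℝ (P ω)
  bound : ∀ ω ξ, ‖P ω ξ‖ ≤ C * √(beta α ω) * wdist α ω ξ ^ (-t)
  bound_deriv : ∀ ω ξ, ‖deriv (P ω) ξ‖ ≤ C * √(beta α ω) * beta α ω * wdist α ω ξ ^ (-t)
  fourier : ∀ z : X, ⇑(𝓕 (e z) : L2) =ᵐ[volume]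
    fun ξ => Complex.exp (-(2 * Real.pi * Complex.I * z.1 * ξ)) * P z.2 ξ

variable {α t C C' : ℝ} {e e' : X → L2} {P P' : ℝ → ℝ → ℂ}

lemma conj_exp_phase (x ξ : ℝ) :
    starRingEnd ℂ (Complex.exp (-(2 * Real.pi * Complex.I * x * ξ))) =
      Complex.exp (2 * Real.pi * Complex.I * x * ξ) := by
  rw [← Complex.exp_conj]
  congr 1
  simp only [map_neg, map_mul, Complex.conj_ofReal, Complex.conj_I, Complex.conj_ofNat]
  ring

lemma norm_exp_phase (x ξ : ℝ) : ‖Complex.exp (2 * Real.pi * Complex.I * x * ξ)‖ = 1 := by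
  rw [show (2 * Real.pi * Complex.I * x * ξ : ℂ) = ((2 * Real.pi * x * ξ : ℝ) : ℂ) * Complex.I by
    push_cast; ring, Complex.norm_exp_ofReal_mul_I]

lemma IsMolecule.ip_right (he : IsMolecule α t C e P) (f : L2) (z : X) :
    ip f (e z) = ∫ ξ : ℝ, Complex.exp (2 * Real.pi * Complex.I * z.1 * ξ) *
      ((𝓕 f : L2) ξ * starRingEnd ℂ (P z.2 ξ)) := by
  rw [← ip_fourier, ip_eq_integral]
  refine integral_congr_ae ?_
  filter_upwards [he.fourier z] with ξ hξ
  rw [hξ, map_mul, conj_exp_phase]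
  ring

lemma IsMolecule.measurable_ip (he : IsMolecule α t C e P) (f : L2) :
    StronglyMeasurable fun z => ip f (e z) := by
  simp only [he.ip_right f]
  refine StronglyMeasurable.integral_prod_right (ν := (volume : Measure ℝ)) (f := fun (z : X) (ξ : ℝ) =>
    Complex.exp (2 * Real.pi * Complex.I * z.1 * ξ) *
      ((𝓕 f : L2) ξ * starRingEnd ℂ (P z.2 ξ))) ?_
  refine StronglyMeasurable.mul (Continuous.stronglyMeasurable (by fun_prop)) ?_
  refine ((Lp.stronglyMeasurable (𝓕 f : L2)).comp_measurable measurable_snd).mul ?_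
  have : Continuous fun p : X × ℝ => P p.1.2 p.2 :=
    he.cont.comp (by fun_prop : Continuous fun p : X × ℝ => (p.1.2, p.2))
  exact (Complex.continuous_conj.comp this).stronglyMeasurable

/-- The two phases combine to `e^{-2πi(x-x')ξ}`. The kernel depends on the positions only through
their difference, so its `L¹` norm in `x` is that of a single Fourier transform. -/
lemma IsMolecule.ip_eq (he : IsMolecule α t C e P) (he' : IsMolecule α t C' e' P') (z z' : X) :
    ip (e z) (e' z') = 𝓕 (fun ξ => P z.2 ξ * starRingEnd ℂ (P' z'.2 ξ)) (z.1 - z'.1) := by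
  rw [he'.ip_right, Real.fourier_real_eq_integral_exp_smul]
  refine integral_congr_ae ?_
  filter_upwards [he.fourier z] with ξ hξ
  have hE : Complex.exp (↑(-2 * Real.pi * ξ * (z.1 - z'.1)) * Complex.I) =
      Complex.exp (2 * Real.pi * Complex.I * z'.1 * ξ) *
        Complex.exp (-(2 * Real.pi * Complex.I * z.1 * ξ)) := by
    rw [← Complex.exp_add]
    congr 1
    push_cast
    ring
  rw [hξ, smul_eq_mul, hE]
  ring

/-- No measurability of `z ↦ e z` is part of the notion of molecule; joint measurability is read off
from the integral formula and the continuity of the profiles. -/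
lemma IsMolecule.measurable_kernel (he : IsMolecule α t C e P) (he' : IsMolecule α t C' e' P') :
    StronglyMeasurable fun p : X × X => ip (e p.1) (e' p.2) := by
  simp only [he.ip_eq he', Real.fourier_real_eq_integral_exp_smul]
  refine StronglyMeasurable.integral_prod_right (ν := (volume : Measure ℝ)) (f := fun (p : X × X) (ξ : ℝ) =>
    Complex.exp (↑(-2 * Real.pi * ξ * (p.1.1 - p.2.1)) * Complex.I) •
      (P p.1.2 ξ * starRingEnd ℂ (P' p.2.2 ξ))) ?_
  have h1 : Continuous fun p : (X × X) × ℝ => P p.1.1.2 p.2 :=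
    he.cont.comp (by fun_prop : Continuous fun p : (X × X) × ℝ => (p.1.1.2, p.2))
  have h2 : Continuous fun p : (X × X) × ℝ => P' p.1.2.2 p.2 :=
    he'.cont.comp (by fun_prop : Continuous fun p : (X × X) × ℝ => (p.1.2.2, p.2))
  refine Continuous.stronglyMeasurable ?_
  have h3 := Complex.continuous_conj.comp h2
  simp only [Function.comp_def] at h3
  exact (Continuous.cexp (by fun_prop)).smul (h1.mul h3)

/-! ### Weights and overlap of frequency localizations -/

lemma continuous_polyWeight (s : ℝ) : Continuous (polyWeight s) := by
  unfold polyWeight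
  exact (by fun_prop : Continuous fun z : X => 1 + |z.2|).rpow_const
    fun z => Or.inl (by positivity)

lemma continuous_ratioWeight (s : ℝ) :
    Continuous fun p : X × X => ratioWeight (polyWeight s) p.1 p.2 := by
  have h1 := (continuous_polyWeight s).comp (continuous_fst (X := X) (Y := X))
  have h2 := (continuous_polyWeight s).comp (continuous_snd (X := X) (Y := X))
  unfold ratioWeight
  exact (h1.div h2 fun p => (polyWeight_pos _ _).ne').max
    (h2.div h1 fun p => (polyWeight_pos _ _).ne')

lemma measurable_wdist (hα1 : α < 1) (ω : ℝ) : Measurable (wdist α ω) := by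
  have := (warp_strictMono hα1).monotone.measurable
  unfold wdist
  exact measurable_const.add (continuous_abs.measurable.comp (measurable_const.sub this))

/-- The larger of `A` and `B` is at least `D/2`, so its power can be pulled out. This is the source
of the off-diagonal decay of kernels. -/
lemma mul_rpow_neg_le {A B D N : ℝ} (hA : 1 ≤ A) (hB : 1 ≤ B) (hD : 0 < D) (h : D ≤ A + B)
    (hN : 0 ≤ N) : A ^ (-N) * B ^ (-N) ≤ (D / 2) ^ (-N) * (A ^ (-N) + B ^ (-N)) := by
  have pA := Real.rpow_pos_of_pos (by linarith : 0 < A) (-N)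
  have pB := Real.rpow_pos_of_pos (by linarith : 0 < B) (-N)
  have pD := Real.rpow_pos_of_pos (by linarith : 0 < D / 2) (-N)
  rcases le_total A B with hAB | hAB
  · have : B ^ (-N) ≤ (D / 2) ^ (-N) :=
      Real.rpow_le_rpow_of_nonpos (by linarith) (by linarith) (by linarith)
    nlinarith [mul_pos pD pB]
  · have : A ^ (-N) ≤ (D / 2) ^ (-N) :=
      Real.rpow_le_rpow_of_nonpos (by linarith) (by linarith) (by linarith)
    nlinarith [mul_pos pD pA]

/-- The constant in the frequency localization integral. -/
noncomputable def locConst (α N : ℝ) : ℝ :=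
  -- The summand 1 makes the constant positive for every `N`, also when the integral is infinite and
  -- `toReal` returns 0.
  (ENNReal.ofReal (1 / (1 - α)) * decayInt (N - α / (1 - α))).toReal + 1

lemma locConst_pos (α N : ℝ) : 0 < locConst α N := by unfold locConst; positivity

lemma lintegral_wdist_le_locConst (hα0 : 0 ≤ α) (hα1 : α < 1) {N : ℝ}
    (hN : 1 + α / (1 - α) < N) (ω : ℝ) :
    ∫⁻ ξ, ENNReal.ofReal (wdist α ω ξ ^ (-N)) ≤ ENNReal.ofReal (locConst α N * (beta α ω)⁻¹) := by
  refine (lintegral_wdist_le hα0 hα1 ω).trans ?_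
  have hfin : ENNReal.ofReal (1 / (1 - α)) * decayInt (N - α / (1 - α)) ≠ ∞ :=
    ENNReal.mul_ne_top ENNReal.ofReal_ne_top (decayInt_lt_top (by linarith)).ne
  rw [mul_comm, ENNReal.ofReal_mul (locConst_pos _ _).le]
  gcongr
  rw [← ENNReal.ofReal_toReal hfin]
  exact ENNReal.ofReal_le_ofReal (by unfold locConst; linarith)

lemma lintegral_wdist_mul_le (hα0 : 0 ≤ α) (hα1 : α < 1) {N : ℝ}
    (hN : 1 + α / (1 - α) < N) (ω ω' : ℝ) :
    ∫⁻ ξ, ENNReal.ofReal (wdist α ω ξ ^ (-N) * wdist α ω' ξ ^ (-N)) ≤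
      ENNReal.ofReal ((wdist α ω ω' / 2) ^ (-N) * (locConst α N *
        ((beta α ω)⁻¹ + (beta α ω')⁻¹))) := by
  have hN0 : 0 ≤ N := by
    have : 0 ≤ α / (1 - α) := div_nonneg hα0 (by linarith)
    linarith
  have hp : ∀ ω ξ, 0 ≤ wdist α ω ξ ^ (-N) := fun ω ξ => Real.rpow_nonneg (wdist_pos _ _ _).le _
  have hD : 0 ≤ (wdist α ω ω' / 2) ^ (-N) :=
    Real.rpow_nonneg (by linarith [wdist_pos α ω ω']) _
  have hβ := beta_pos α ω
  have hβ' := beta_pos α ω'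
  have hm : Measurable fun ξ => ENNReal.ofReal (wdist α ω ξ ^ (-N)) :=
    ((measurable_wdist hα1 ω).pow_const _).ennreal_ofReal
  calc _ ≤ ∫⁻ ξ, ENNReal.ofReal ((wdist α ω ω' / 2) ^ (-N)) *
        (ENNReal.ofReal (wdist α ω ξ ^ (-N)) + ENNReal.ofReal (wdist α ω' ξ ^ (-N))) := by
        refine lintegral_mono fun ξ => ?_
        rw [← ENNReal.ofReal_add (hp _ _) (hp _ _), ← ENNReal.ofReal_mul hD]
        exact ENNReal.ofReal_le_ofReal (mul_rpow_neg_le (one_le_wdist _ _ _) (one_le_wdist _ _ _)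
          (wdist_pos _ _ _) (wdist_le_add _ _ _ _) hN0)
    _ ≤ ENNReal.ofReal ((wdist α ω ω' / 2) ^ (-N)) *
        (ENNReal.ofReal (locConst α N * (beta α ω)⁻¹) +
          ENNReal.ofReal (locConst α N * (beta α ω')⁻¹)) := by
        rw [lintegral_const_mul' _ _ ENNReal.ofReal_ne_top, lintegral_add_left hm]
        gcongr
        · exact lintegral_wdist_le_locConst hα0 hα1 hN ω
        · exact lintegral_wdist_le_locConst hα0 hα1 hN ω'
    _ = _ := by
        have := locConst_pos α N
        rw [← ENNReal.ofReal_add (by positivity) (by positivity), ← ENNReal.ofReal_mul hD,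
          ← mul_add]

end AlphaMod

namespace AlphaMod

/-! ### The kernel estimate -/

variable {α t C C' : ℝ} {e e' : X → L2} {P P' : ℝ → ℝ → ℂ}

lemma hasDerivAt_mul_conj {p q : ℝ → ℂ} (hp : Differentiable ℝ p) (hq : Differentiable ℝ q)
    (ξ : ℝ) : HasDerivAt (fun ξ => p ξ * starRingEnd ℂ (q ξ))
      (deriv p ξ * starRingEnd ℂ (q ξ) + p ξ * starRingEnd ℂ (deriv q ξ)) ξ :=
  (hp ξ).hasDerivAt.mul (hq ξ).hasDerivAt.star

lemma integrable_of_norm_le_wdist (hα0 : 0 ≤ α) (hα1 : α < 1) (ht : 1 + α / (1 - α) < t)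
    {G : ℝ → ℂ} (hG : AEStronglyMeasurable G volume) {K : ℝ} (ω : ℝ)
    (hb : ∀ ξ, ‖G ξ‖ ≤ K * wdist α ω ξ ^ (-t)) : Integrable G := by
  refine ⟨hG, ?_⟩
  rw [hasFiniteIntegral_iff_norm]
  calc ∫⁻ ξ, ENNReal.ofReal ‖G ξ‖ ≤ ∫⁻ ξ, ENNReal.ofReal |K| * ENNReal.ofReal (wdist α ω ξ ^ (-t)) := by
        refine lintegral_mono fun ξ => ?_
        rw [← ENNReal.ofReal_mul (abs_nonneg _)]
        refine ENNReal.ofReal_le_ofReal ((hb ξ).trans ?_)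
        gcongr
        · exact Real.rpow_nonneg (wdist_pos _ _ _).le _
        · exact le_abs_self K
    _ < ∞ := by
        rw [lintegral_const_mul' _ _ ENNReal.ofReal_ne_top]
        exact ENNReal.mul_lt_top ENNReal.ofReal_lt_top
          ((lintegral_wdist_le_locConst hα0 hα1 ht ω).trans_lt ENNReal.ofReal_lt_top)

lemma rpow_neg_sq {D t : ℝ} (hD : 0 < D) : (D ^ (-t)) ^ 2 = D ^ (-(2 * t)) := by
  rw [← Real.rpow_natCast, ← Real.rpow_mul hD.le]
  congr 1
  push_cast
  ring

lemma lintegral_sq_le_of_norm_le (hα0 : 0 ≤ α) (hα1 : α < 1) (ht : 1 + α / (1 - α) < t)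
    {G : ℝ → ℂ} {K : ℝ} (ω ω' : ℝ)
    (hb : ∀ ξ, ‖G ξ‖ ≤ K * (wdist α ω ξ ^ (-t) * wdist α ω' ξ ^ (-t))) :
    ∫⁻ ξ, ‖G ξ‖ₑ ^ 2 ≤ ENNReal.ofReal (K ^ 2 * ((wdist α ω ω' / 2) ^ (-(2 * t)) *
      (locConst α (2 * t) * ((beta α ω)⁻¹ + (beta α ω')⁻¹)))) := by
  have ht2 : 1 + α / (1 - α) < 2 * t := by
    have : 0 ≤ α / (1 - α) := div_nonneg hα0 (by linarith)
    linarith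
  rw [ENNReal.ofReal_mul (by positivity)]
  refine le_trans ?_ (mul_le_mul_right (lintegral_wdist_mul_le hα0 hα1 ht2 ω ω') _)
  rw [← lintegral_const_mul' _ _ ENNReal.ofReal_ne_top]
  refine lintegral_mono fun ξ => ?_
  rw [← ofReal_norm, ← ENNReal.ofReal_pow (norm_nonneg _), ← ENNReal.ofReal_mul (by positivity)]
  refine ENNReal.ofReal_le_ofReal ((pow_le_pow_left₀ (norm_nonneg _) (hb ξ) 2).trans_eq ?_)
  rw [mul_pow, mul_pow, rpow_neg_sq (wdist_pos _ _ _), rpow_neg_sq (wdist_pos _ _ _)]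

/-- The constant in the kernel estimate. -/
noncomputable def kerConst (α t : ℝ) : ℝ :=
  (Real.pi + 2) * ((1 / 2) ^ (-t) * √(locConst α (2 * t)))

lemma kerConst_nonneg (α t : ℝ) : 0 ≤ kerConst α t := by
  unfold kerConst
  have := Real.pi_pos
  positivity

/-- Differentiating the product of profiles costs `β(ω)` or `β(ω')`, depending on the factor hit.
Hence `lintegral_fourier_le` applies at scale `l = β(ω) + β(ω')`. -/
theorem IsMolecule.lintegral_fourier_mul_conj_le (hα0 : 0 ≤ α) (hα1 : α < 1)
    (ht : 1 + α / (1 - α) < t) (he : IsMolecule α t C e P) (he' : IsMolecule α t C' e' P')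
    (ω ω' : ℝ) :
    ∫⁻ x, ‖𝓕 (fun ξ => P ω ξ * starRingEnd ℂ (P' ω' ξ)) x‖ₑ ≤
      ENNReal.ofReal (kerConst α t * (C * C') *
        ((beta α ω + beta α ω') * wdist α ω ω' ^ (-t))) := by
  have hβ := beta_pos α ω
  have hβ' := beta_pos α ω'
  have hC := he.pos
  have hC' := he'.pos
  have ht0 : 0 ≤ t := by
    have : 0 ≤ α / (1 - α) := div_nonneg hα0 (by linarith)
    linarith
  set G : ℝ → ℂ := fun ξ => P ω ξ * starRingEnd ℂ (P' ω' ξ) with hG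
  have hder : ∀ ξ, HasDerivAt G (deriv (P ω) ξ * starRingEnd ℂ (P' ω' ξ) +
      P ω ξ * starRingEnd ℂ (deriv (P' ω') ξ)) ξ :=
    fun ξ => hasDerivAt_mul_conj (he.diff ω) (he'.diff ω') ξ
  have hdiff : Differentiable ℝ G := fun ξ => (hder ξ).differentiableAt
  set K : ℝ := C * C' * (√(beta α ω) * √(beta α ω')) with hK
  have hK0 : 0 < K := by
    have := Real.sqrt_pos.2 hβ
    have := Real.sqrt_pos.2 hβ'
    positivity
  have hw : ∀ ω ξ, 0 < wdist α ω ξ ^ (-t) := fun ω ξ => Real.rpow_pos_of_pos (wdist_pos _ _ _) _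
  have hw1 : ∀ ω ξ, wdist α ω ξ ^ (-t) ≤ 1 := fun ω ξ =>
    Real.rpow_le_one_of_one_le_of_nonpos (one_le_wdist _ _ _) (by linarith)
  have b0 : ∀ ξ, ‖G ξ‖ ≤ K * (wdist α ω ξ ^ (-t) * wdist α ω' ξ ^ (-t)) := by
    intro ξ
    rw [hG, norm_mul, RCLike.norm_conj]
    refine (mul_le_mul (he.bound ω ξ) (he'.bound ω' ξ) (norm_nonneg _) ?_).trans_eq ?_
    · have := hw ω ξ
      positivity
    · rw [hK]; ring
  have b1 : ∀ ξ, ‖deriv G ξ‖ ≤ K * (beta α ω + beta α ω') *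
      (wdist α ω ξ ^ (-t) * wdist α ω' ξ ^ (-t)) := by
    intro ξ
    have h1 := hw ω ξ
    have h2 := hw ω' ξ
    rw [(hder ξ).deriv]
    refine (norm_add_le _ _).trans ?_
    rw [norm_mul, norm_mul, RCLike.norm_conj, RCLike.norm_conj]
    refine (add_le_add
      (mul_le_mul (he.bound_deriv ω ξ) (he'.bound ω' ξ) (norm_nonneg _) (by positivity))
      (mul_le_mul (he.bound ω ξ) (he'.bound_deriv ω' ξ) (norm_nonneg _) (by positivity))).trans_eq ?_
    rw [hK]; ring
  have i0 : Integrable G := by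
    refine integrable_of_norm_le_wdist hα0 hα1 ht (K := K)
      hdiff.continuous.aestronglyMeasurable ω fun ξ => (b0 ξ).trans ?_
    have h1 := hw ω ξ
    exact mul_le_mul_of_nonneg_left (mul_le_of_le_one_right h1.le (hw1 ω' ξ)) hK0.le
  have i1 : Integrable (deriv G) := by
    refine integrable_of_norm_le_wdist hα0 hα1 ht (K := K * (beta α ω + beta α ω'))
      (measurable_deriv G).aestronglyMeasurable ω fun ξ => (b1 ξ).trans ?_
    have h1 := hw ω ξ
    exact mul_le_mul_of_nonneg_left (mul_le_of_le_one_right h1.le (hw1 ω' ξ)) (by positivity)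
  have m0 := lintegral_sq_le_of_norm_le hα0 hα1 ht ω ω' b0
  have m1 := lintegral_sq_le_of_norm_le hα0 hα1 ht ω ω' b1
  set R : ℝ := (wdist α ω ω' / 2) ^ (-(2 * t)) *
      (locConst α (2 * t) * ((beta α ω)⁻¹ + (beta α ω')⁻¹)) with hR
  have hR0 : 0 < R := by
    have := locConst_pos α (2 * t)
    have := Real.rpow_pos_of_pos (by linarith [wdist_pos α ω ω'] : 0 < wdist α ω ω' / 2) (-(2 * t))
    positivity
  rw [show (K * (beta α ω + beta α ω')) ^ 2 * R = (beta α ω + beta α ω') ^ 2 * (K ^ 2 * R) by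
    ring] at m1
  refine (lintegral_fourier_le hdiff i0 i1 (by positivity) (by positivity) m0 m1).trans_eq ?_
  congr 1
  have hD := wdist_pos α ω ω'
  -- The quantity under the root is a square up to `locConst`, because `(β+β') · ββ' · (1/β + 1/β')
  -- = (β+β')²`.
  have e1 : (beta α ω + beta α ω') * (K ^ 2 * R) =
      (C * C' * (beta α ω + beta α ω') * (wdist α ω ω' / 2) ^ (-t)) ^ 2 * locConst α (2 * t) := by
    rw [hR, hK, mul_pow (C * C'), mul_pow (√ _), Real.sq_sqrt hβ.le, Real.sq_sqrt hβ'.le,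
      ← rpow_neg_sq (by positivity)]
    field_simp
    ring
  have h3 := Real.rpow_pos_of_pos (by linarith [wdist_pos α ω ω'] : 0 < wdist α ω ω' / 2) (-t)
  rw [e1, Real.sqrt_mul (by positivity), Real.sqrt_sq (by positivity), div_eq_mul_one_div,
    Real.mul_rpow hD.le (by norm_num), kerConst]
  ring

/-- Any two families of molecules have an integrable cross kernel. -/
theorem IsMolecule.lintegral_kernel_le (hα0 : 0 ≤ α) (hα1 : α < 1) {s : ℝ} (hs : 0 ≤ s)
    (ht : 1 + s / (1 - α) + α / (1 - α) < t)
    (he : IsMolecule α t C e P) (he' : IsMolecule α t C' e' P') (z' : X) :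
    ∫⁻ z : X, ‖ip (e z) (e' z')‖ₑ * ENNReal.ofReal (ratioWeight (polyWeight s) z z') ≤
      ENNReal.ofReal (2 * (kerConst α t * (C * C'))) *
        (ENNReal.ofReal (1 / (1 - α)) * decayInt (t - s / (1 - α) - α / (1 - α))) := by
  have ha : 0 < 1 - α := by linarith
  have hs' : 0 ≤ s / (1 - α) := by positivity
  have hC := he.pos
  have hC' := he'.pos
  have hk := kerConst_nonneg α t
  have hm : Measurable fun z : X => ‖ip (e z) (e' z')‖ₑ *
      ENNReal.ofReal (ratioWeight (polyWeight s) z z') := by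
    have h1 := (he.measurable_kernel he').measurable.comp
      (measurable_id.prodMk (measurable_const (a := z')))
    have h2 := (continuous_ratioWeight s).measurable.comp
      (measurable_id.prodMk (measurable_const (a := z')))
    exact h1.enorm.mul h2.ennreal_ofReal
  -- The position variable is integrated first, for fixed `ω`. The weight does not depend on it.
  rw [Measure.volume_eq_prod, lintegral_prod_symm' _ hm]
  refine le_trans ?_ (mul_le_mul_right (lintegral_beta_wdist_le hα1 z'.2) _)
  rw [← lintegral_const_mul' _ _ ENNReal.ofReal_ne_top]
  refine lintegral_mono fun ω => ?_
  have hβ := beta_pos α ω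
  have hD := wdist_pos α ω z'.2
  calc ∫⁻ x, ‖ip (e (x, ω)) (e' z')‖ₑ * ENNReal.ofReal (ratioWeight (polyWeight s) (x, ω) z')
      ≤ ∫⁻ x, ‖𝓕 (fun ξ => P ω ξ * starRingEnd ℂ (P' z'.2 ξ)) (x - z'.1)‖ₑ *
          ENNReal.ofReal (wdist α ω z'.2 ^ (s / (1 - α))) := by
        refine lintegral_mono fun x => ?_
        rw [he.ip_eq he']
        gcongr
        exact ratioWeight_polyWeight_le hα1 hs _ _
    _ ≤ ENNReal.ofReal (kerConst α t * (C * C') *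
          ((beta α ω + beta α z'.2) * wdist α ω z'.2 ^ (-t))) *
          ENNReal.ofReal (wdist α ω z'.2 ^ (s / (1 - α))) := by
        rw [lintegral_mul_const' _ _ ENNReal.ofReal_ne_top, lintegral_sub_right_eq_self
          (fun x => ‖𝓕 (fun ξ => P ω ξ * starRingEnd ℂ (P' z'.2 ξ)) x‖ₑ)]
        gcongr
        exact he.lintegral_fourier_mul_conj_le hα0 hα1 (by linarith) he' ω z'.2
    _ ≤ _ := by
        have p1 := Real.rpow_pos_of_pos hD (-t)
        have p2 := Real.rpow_pos_of_pos hD (s / (1 - α))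
        have p3 := Real.rpow_pos_of_pos hD (α / (1 - α))
        have hβ' := beta_pos α z'.2
        rw [← ENNReal.ofReal_mul (by positivity), ← ENNReal.ofReal_mul (by positivity)]
        refine ENNReal.ofReal_le_ofReal ?_
        have h1 := beta_le hα0 hα1 z'.2 ω
        rw [wdist_comm] at h1
        have h2 : 1 ≤ wdist α ω z'.2 ^ (α / (1 - α)) :=
          Real.one_le_rpow (one_le_wdist _ _ _) (by positivity)
        -- `β(ω)` has to remain, being the density of the warped substitution. Trading `β(z'.2)` for
        -- it costs the power `α/(1-α)`.
        have h3 : beta α ω + beta α z'.2 ≤ 2 * (beta α ω * wdist α ω z'.2 ^ (α / (1 - α))) := by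
          nlinarith
        rw [show -(t - s / (1 - α) - α / (1 - α)) = α / (1 - α) + (-t + s / (1 - α)) by ring,
          Real.rpow_add hD, Real.rpow_add hD]
        calc _ ≤ kerConst α t * (C * C') * ((2 * (beta α ω * wdist α ω z'.2 ^ (α / (1 - α)))) *
              wdist α ω z'.2 ^ (-t)) * wdist α ω z'.2 ^ (s / (1 - α)) := by gcongr
          _ = _ := by ring

end AlphaMod

namespace AlphaMod

open scoped BoundedContinuousFunction

/-! ### Fourier multipliers -/

lemma memLp_bounded_mul (b : ℝ →ᵇ ℂ) (f : L2) : MemLp (fun ξ => b ξ * f ξ) 2 volume :=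
  (Lp.memLp f).of_le_mul (c := ‖b‖)
    (b.continuous.aestronglyMeasurable.mul (Lp.aestronglyMeasurable f))
    (Filter.Eventually.of_forall fun ξ => by
      rw [norm_mul]
      exact mul_le_mul_of_nonneg_right (b.norm_coe_le_norm ξ) (norm_nonneg _))

/-- Multiplication by a bounded continuous function on `L²(ℝ)`. -/
noncomputable def mulL2 (b : ℝ →ᵇ ℂ) : L2 →L[ℂ] L2 :=
  LinearMap.mkContinuous
    { toFun := fun f => (memLp_bounded_mul b f).toLp _
      map_add' := fun f g => by
        rw [← MemLp.toLp_add]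
        refine MemLp.toLp_congr _ _ ?_
        filter_upwards [Lp.coeFn_add f g] with ξ h
        rw [h]
        simp [mul_add]
      map_smul' := fun c f => by
        rw [RingHom.id_apply, ← MemLp.toLp_const_smul]
        refine MemLp.toLp_congr _ _ ?_
        filter_upwards [Lp.coeFn_smul c f] with ξ h
        rw [h]
        simp only [Pi.smul_apply, smul_eq_mul]
        ring }
    ‖b‖ fun f => by
      refine Lp.norm_le_mul_norm_of_ae_le_mul ?_
      filter_upwards [(memLp_bounded_mul b f).coeFn_toLp] with ξ h
      simp only [LinearMap.coe_mk, AddHom.coe_mk]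
      rw [h, norm_mul]
      exact mul_le_mul_of_nonneg_right (b.norm_coe_le_norm ξ) (norm_nonneg _)

lemma mulL2_ae (b : ℝ →ᵇ ℂ) (f : L2) : ⇑(mulL2 b f) =ᵐ[volume] fun ξ => b ξ * f ξ :=
  (memLp_bounded_mul b f).coeFn_toLp

/-- The Fourier multiplier with symbol `b`. -/
noncomputable def fmul (b : ℝ →ᵇ ℂ) : L2 →L[ℂ] L2 :=
  ((Lp.fourierTransformₗᵢ ℝ ℂ).symm.toContinuousLinearEquiv : L2 →L[ℂ] L2) ∘L mulL2 b ∘L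
    ((Lp.fourierTransformₗᵢ ℝ ℂ).toContinuousLinearEquiv : L2 →L[ℂ] L2)

lemma fmul_apply (b : ℝ →ᵇ ℂ) (f : L2) : fmul b f = 𝓕⁻ (mulL2 b (𝓕 f)) := rfl

lemma fourier_fmul_ae (b : ℝ →ᵇ ℂ) (f : L2) :
    ⇑(𝓕 (fmul b f) : L2) =ᵐ[volume] fun ξ => b ξ * (𝓕 f : L2) ξ := by
  rw [fmul_apply, FourierTransform.fourier_fourierInv_eq]
  exact mulL2_ae b _

lemma fourier_injective : Function.Injective (𝓕 : L2 → L2) :=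
  (Lp.fourierTransformₗᵢ ℝ ℂ).injective

lemma fmul_mul (b c : ℝ →ᵇ ℂ) : fmul b * fmul c = fmul (b * c) := by
  ext1 f
  refine fourier_injective (Lp.ext ?_)
  rw [mul_apply_eq_comp]
  filter_upwards [fourier_fmul_ae b (fmul c f), fourier_fmul_ae c f, fourier_fmul_ae (b * c) f]
    with ξ h1 h2 h3
  rw [h1, h2, h3, BoundedContinuousFunction.mul_apply, mul_assoc]

lemma fmul_one : fmul 1 = 1 := by
  ext1 f
  refine fourier_injective (Lp.ext ?_)
  filter_upwards [fourier_fmul_ae 1 f] with ξ h1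
  rw [h1]
  simp

lemma fmul_pow (b : ℝ →ᵇ ℂ) (k : ℕ) : fmul b ^ k = fmul (b ^ k) := by
  induction k with
  | zero => rw [pow_zero, pow_zero, fmul_one]
  | succ k ih => rw [pow_succ, pow_succ, ih, fmul_mul]

lemma ip_fmul (b : ℝ →ᵇ ℂ) (f h : L2) :
    ip (fmul b f) h = ∫ ξ, b ξ * ((𝓕 f : L2) ξ * starRingEnd ℂ ((𝓕 h : L2) ξ)) := by
  rw [← ip_fourier, ip_eq_integral]
  refine integral_congr_ae ?_
  filter_upwards [fourier_fmul_ae b f] with ξ h1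
  rw [h1, mul_assoc]

/-- Symbols `b` with `|b'| ≲ β`. -/
def IsSymbol (α : ℝ) (b : ℝ →ᵇ ℂ) : Prop :=
  Differentiable ℝ b ∧ ∃ B : ℝ, ∀ ξ, ‖deriv b ξ‖ ≤ B * beta α ξ

variable {α : ℝ}

lemma isSymbol_one : IsSymbol α 1 := by
  refine ⟨differentiable_const (1 : ℂ), 0, fun ξ => ?_⟩
  have : ⇑(1 : ℝ →ᵇ ℂ) = fun _ => (1 : ℂ) := rfl
  rw [this, deriv_const]
  simp

lemma IsSymbol.mul {b c : ℝ →ᵇ ℂ} (hb : IsSymbol α b) (hc : IsSymbol α c) :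
    IsSymbol α (b * c) := by
  obtain ⟨db, B, hB⟩ := hb
  obtain ⟨dc, B', hB'⟩ := hc
  have e : ⇑(b * c) = ⇑b * ⇑c := rfl
  refine ⟨by rw [e]; exact db.mul dc, B * ‖c‖ + ‖b‖ * B', fun ξ => ?_⟩
  rw [e, deriv_mul (db ξ) (dc ξ)]
  refine (norm_add_le _ _).trans ?_
  rw [norm_mul, norm_mul]
  have h1 := mul_le_mul (hB ξ) (c.norm_coe_le_norm ξ) (norm_nonneg _)
    ((norm_nonneg _).trans (hB ξ))
  have h2 := mul_le_mul (b.norm_coe_le_norm ξ) (hB' ξ) (norm_nonneg _) (norm_nonneg _)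
  linarith

lemma IsSymbol.pow {b : ℝ →ᵇ ℂ} (hb : IsSymbol α b) (k : ℕ) : IsSymbol α (b ^ k) := by
  induction k with
  | zero => rw [pow_zero]; exact isSymbol_one
  | succ k ih => rw [pow_succ]; exact ih.mul hb

/-! ### Atoms are molecules -/

lemma FourierDecay.exists_bound {r : ℝ} {ψ : L2} (h : FourierDecay r ψ) :
    ∃ g : ℝ → ℂ, Differentiable ℝ g ∧ (⇑(𝓕 ψ : L2) =ᵐ[volume] g) ∧ ∃ C : ℝ, 0 < C ∧
      (∀ ξ, ‖g ξ‖ ≤ C * (1 + |ξ|) ^ (-r)) ∧ ∀ ξ, ‖deriv g ξ‖ ≤ C * (1 + |ξ|) ^ (-r) := by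
  obtain ⟨g, hg, hae, C, hC⟩ := h
  have key : ∀ ξ, C * (1 + |ξ|) ^ (-r) ≤ max C 1 * (1 + |ξ|) ^ (-r) := fun ξ =>
    mul_le_mul_of_nonneg_right (le_max_left _ _) (by positivity)
  refine ⟨g, hg.differentiable (by norm_num), hae, max C 1, by positivity, fun ξ => ?_, fun ξ => ?_⟩
  · have := hC 0 (by norm_num) ξ
    rw [iteratedDeriv_zero] at this
    exact this.trans (key ξ)
  · have := hC 1 (by norm_num) ξ
    rw [iteratedDeriv_one] at this
    exact this.trans (key ξ)

lemma integrable_of_decay {r C : ℝ} (hr : 1 < r) {g : ℝ → ℂ} (hg : Continuous g)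
    (hb : ∀ ξ, ‖g ξ‖ ≤ C * (1 + |ξ|) ^ (-r)) : Integrable g := by
  have h : Integrable (fun x : ℝ => (1 + ‖x‖) ^ (-r)) :=
    integrable_one_add_norm (by simpa using hr)
  exact (h.const_mul C).mono' hg.aestronglyMeasurable (Filter.Eventually.of_forall hb)

/-- The frequency profile of the atoms with window `g = ψ̂`. -/
noncomputable def profile (α : ℝ) (g : ℝ → ℂ) (ω ξ : ℝ) : ℂ :=
  (√(beta α ω) : ℂ) * g (beta α ω * (ξ - ω))

lemma hasDerivAt_profile {g : ℝ → ℂ} (hg : Differentiable ℝ g) (ω ξ : ℝ) :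
    HasDerivAt (profile α g ω) ((√(beta α ω) : ℂ) * (beta α ω * deriv g (beta α ω * (ξ - ω)))) ξ := by
  have h1 : HasDerivAt (fun ξ => beta α ω * (ξ - ω)) (beta α ω) ξ := by
    simpa using ((hasDerivAt_id' ξ).sub_const ω).const_mul (beta α ω)
  have h2 := (hg (beta α ω * (ξ - ω))).hasDerivAt.scomp ξ h1
  rw [Complex.real_smul] at h2
  exact h2.const_mul _

/-- Seen from `ω`, the warped distance grows at most at the rate `3β(ω)`; the factor `3 ^ r` comes
from there. -/
lemma decay_le_wdist (hα0 : 0 ≤ α) (hα1 : α < 1) {r : ℝ} (hr : 0 ≤ r) (ω ξ : ℝ) :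
    (1 + |beta α ω * (ξ - ω)|) ^ (-r) ≤ 3 ^ r * wdist α ω ξ ^ (-r) := by
  have h := wdist_le hα0 hα1 ω ξ
  have hD := wdist_pos α ω ξ
  rw [abs_mul, abs_of_pos (beta_pos α ω), abs_sub_comm]
  calc (1 + beta α ω * |ω - ξ|) ^ (-r) ≤ (wdist α ω ξ / 3) ^ (-r) :=
        Real.rpow_le_rpow_of_nonpos (by positivity) (by linarith) (by linarith)
    _ = _ := by
        rw [Real.div_rpow hD.le (by norm_num), Real.rpow_neg (by norm_num : (0 : ℝ) ≤ 3), div_inv_eq_mul,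
          mul_comm]

lemma memLp_two_of_decay {r C : ℝ} (hr : 1 < r) {g : ℝ → ℂ} (hg : Continuous g)
    (hb : ∀ ξ, ‖g ξ‖ ≤ C * (1 + |ξ|) ^ (-r)) : MemLp g 2 volume := by
  have h1 := integrable_of_decay hr hg hb
  have hbd : ∀ ξ, ‖g ξ‖ ≤ |C| := fun ξ => by
    refine (hb ξ).trans ((mul_le_mul_of_nonneg_right (le_abs_self C) (by positivity)).trans ?_)
    exact mul_le_of_le_one_right (abs_nonneg _)
      (Real.rpow_le_one_of_one_le_of_nonpos (by linarith [abs_nonneg ξ]) (by linarith))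
  rw [memLp_two_iff_integrable_sq_norm hg.aestronglyMeasurable]
  refine (h1.norm.const_mul |C|).mono' (hg.norm.pow 2).aestronglyMeasurable
    (Filter.Eventually.of_forall fun ξ => ?_)
  rw [Real.norm_of_nonneg (by positivity), sq]
  exact mul_le_mul_of_nonneg_right (hbd ξ) (norm_nonneg _)

end AlphaMod

namespace AlphaMod

open scoped BoundedContinuousFunction

variable {α : ℝ}

/-! ### The Fourier transform of an atom -/

lemma fourierInv_eq_integral (f : ℝ → ℂ) (t : ℝ) :
    𝓕⁻ f t = ∫ ξ : ℝ, Complex.exp (2 * Real.pi * Complex.I * ξ * t) * f ξ := by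
  rw [Real.fourierInv_eq']
  refine integral_congr_ae (Filter.Eventually.of_forall fun ξ => ?_)
  simp only [smul_eq_mul, RCLike.inner_apply, conj_trivial]
  congr 2
  push_cast
  ring

/-- The inverse Fourier transform of a modulated, dilated and translated function. -/
lemma fourierInv_profile (g : ℝ → ℂ) {a : ℝ} (ha : 0 < a) (x ω t : ℝ) :
    𝓕⁻ (fun ξ : ℝ => Complex.exp (-(2 * Real.pi * Complex.I * x * ξ)) *
      ((√a : ℂ) * g (a * (ξ - ω)))) t =
    Complex.exp (2 * Real.pi * Complex.I * ω * (t - x : ℝ)) *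
      (((1 / √a : ℝ) : ℂ) * 𝓕⁻ g ((t - x) / a)) := by
  rw [fourierInv_eq_integral, fourierInv_eq_integral]
  set F : ℝ → ℂ := fun η => Complex.exp (2 * Real.pi * Complex.I * η * ((t - x) / a : ℝ)) * g η
    with hF
  have hs : (√a : ℂ) * √a = a := by
    rw [← Complex.ofReal_mul, Real.mul_self_sqrt ha.le]
  have ha' : (a : ℂ) ≠ 0 := by exact_mod_cast ha.ne'
  have hsa : (√a : ℂ) ≠ 0 := by
    have := Real.sqrt_pos.2 ha
    exact_mod_cast this.ne'
  have h1 : ∀ ξ : ℝ, Complex.exp (2 * Real.pi * Complex.I * ξ * t) *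
      (Complex.exp (-(2 * Real.pi * Complex.I * x * ξ)) * ((√a : ℂ) * g (a * (ξ - ω)))) =
      Complex.exp (2 * Real.pi * Complex.I * ω * (t - x : ℝ)) * (√a : ℂ) * F (a * (ξ - ω)) := by
    intro ξ
    have : Complex.exp (2 * Real.pi * Complex.I * ξ * t) *
        Complex.exp (-(2 * Real.pi * Complex.I * x * ξ)) =
        Complex.exp (2 * Real.pi * Complex.I * ω * (t - x : ℝ)) *
        Complex.exp (2 * Real.pi * Complex.I * (a * (ξ - ω) : ℝ) * ((t - x) / a : ℝ)) := by
      rw [← Complex.exp_add, ← Complex.exp_add]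
      congr 1
      push_cast
      field_simp
      ring
    rw [hF, ← mul_assoc, this]
    ring
  simp only [h1]
  rw [integral_const_mul, integral_sub_right_eq_self (fun ξ => F (a * ξ)),
    Measure.integral_comp_mul_left, abs_of_pos (inv_pos.2 ha), Complex.real_smul, mul_assoc]
  congr 1
  rw [← mul_assoc]
  congr 1
  push_cast
  field_simp
  rw [sq, hs]

lemma rep_ae (g : AffineWH) (hτ : g.τ = 0) {f : L2} {h : ℝ → ℂ} (hf : ⇑f =ᵐ[volume] h) :
    ⇑(rep g f) =ᵐ[volume] fun t => Complex.exp (2 * Real.pi * Complex.I * g.ω * (t - g.x : ℝ)) *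
      (((1 / √g.a : ℝ) : ℂ) * h ((t - g.x) / g.a)) := by
  have hrep : rep g f = translation g.x (modulation g.ω (dilation g.a g.a_pos f)) := by
    simp [rep, hτ]
  have q1 : Measure.QuasiMeasurePreserving (fun t : ℝ => t - g.x) volume volume :=
    (measurePreserving_sub_right volume g.x).quasiMeasurePreserving
  -- Translations and dilations pull null sets back to null sets, so the representative `h` may be
  -- substituted inside them.
  have q2 : Measure.QuasiMeasurePreserving (fun t : ℝ => t / g.a) volume volume := by
    refine ⟨by fun_prop, ?_⟩
    simp only [div_eq_mul_inv]
    rw [Real.map_volume_mul_right (inv_ne_zero g.a_pos.ne')]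
    exact Measure.smul_absolutelyContinuous
  have h1 : ⇑(dilation g.a g.a_pos f) =ᵐ[volume] fun t => ((1 / √g.a : ℝ) : ℂ) * h (t / g.a) := by
    filter_upwards [(memLp_dilation g.a g.a_pos f).coeFn_toLp, q2.ae hf] with t e1 e2
    rw [dilation, e1, e2]
  have h2 : ⇑(modulation g.ω (dilation g.a g.a_pos f)) =ᵐ[volume]
      fun t => Complex.exp (2 * Real.pi * Complex.I * g.ω * t) *
        (((1 / √g.a : ℝ) : ℂ) * h (t / g.a)) := by
    filter_upwards [(memLp_modulation g.ω (dilation g.a g.a_pos f)).coeFn_toLp, h1] with t e1 e2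
    rw [modulation, e1, e2]
  rw [hrep]
  filter_upwards [(memLp_translation g.x (modulation g.ω (dilation g.a g.a_pos f))).coeFn_toLp,
    q1.ae h2] with t e1 e2
  rw [translation, e1, e2]

lemma continuous_profile {g : ℝ → ℂ} (hg : Continuous g) :
    Continuous fun p : ℝ × ℝ => profile α g p.1 p.2 := by
  have hb := (continuous_beta α).comp (continuous_fst (X := ℝ) (Y := ℝ))
  simp only [Function.comp_def] at hb
  unfold profile
  exact (Complex.continuous_ofReal.comp hb.sqrt).mul
    (hg.comp (hb.mul (continuous_snd.sub continuous_fst)))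

/-- The Fourier transform of an atom. -/
theorem fourier_atom_ae {r C : ℝ} (hr : 1 < r) {ψ : L2} {g : ℝ → ℂ} (hg : Continuous g)
    (hae : ⇑(𝓕 ψ : L2) =ᵐ[volume] g) (hb : ∀ ξ, ‖g ξ‖ ≤ C * (1 + |ξ|) ^ (-r)) (z : X) :
    ⇑(𝓕 (atom α ψ z) : L2) =ᵐ[volume]
      fun ξ => Complex.exp (-(2 * Real.pi * Complex.I * z.1 * ξ)) * profile α g z.2 ξ := by
  have hβ := beta_pos α z.2
  have g1 := integrable_of_decay hr hg hb
  have g2 := memLp_two_of_decay hr hg hb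
  set Q : ℝ → ℂ := fun ξ => Complex.exp (-(2 * Real.pi * Complex.I * z.1 * ξ)) *
    profile α g z.2 ξ with hQ
  have hnQ : ∀ ξ, ‖Q ξ‖ = ‖profile α g z.2 ξ‖ := fun ξ => by
    rw [hQ, norm_mul, ← RCLike.norm_conj (Complex.exp _), conj_exp_phase, norm_exp_phase, one_mul]
  have hpc : Continuous (profile α g z.2) :=
    (continuous_profile hg).comp (by fun_prop : Continuous fun ξ : ℝ => (z.2, ξ))
  have hQc : Continuous Q := (by fun_prop : Continuous fun ξ : ℝ =>
    Complex.exp (-(2 * Real.pi * Complex.I * z.1 * ξ))).mul hpc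
  have p1 : Integrable (profile α g z.2) :=
    ((g1.comp_mul_left' hβ.ne').comp_sub_right z.2).const_mul _
  have Q1 : Integrable Q :=
    p1.mono hQc.aestronglyMeasurable (Filter.Eventually.of_forall fun ξ => (hnQ ξ).le)
  have p2 : MemLp (profile α g z.2) 2 volume := by
    rw [memLp_two_iff_integrable_sq_norm hpc.aestronglyMeasurable]
    have := (memLp_two_iff_integrable_sq_norm hg.aestronglyMeasurable).1 g2
    have h3 := ((this.comp_mul_left' hβ.ne').comp_sub_right z.2).const_mul (‖(√(beta α z.2) : ℂ)‖ ^ 2)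
    refine h3.congr (Filter.Eventually.of_forall fun ξ => ?_)
    simp only [profile, norm_mul, mul_pow]
  have Q2 : MemLp Q 2 volume :=
    p2.of_le hQc.aestronglyMeasurable (Filter.Eventually.of_forall fun ξ => (hnQ ξ).le)
  -- On the Fourier integral `𝓕⁻ g` the action of `T_x M_ω D_a` is an explicit substitution,
  -- `fourierInv_profile`; transforming back gives the claim.
  have hψ : ⇑ψ =ᵐ[volume] 𝓕⁻ g := by
    have e : (𝓕 ψ : L2) = g2.toLp g := Lp.ext (hae.trans g2.coeFn_toLp.symm)
    have e' : ψ = (𝓕⁻ (g2.toLp g) : L2) := by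
      rw [← e, FourierTransform.fourierInv_fourier_eq]
    rw [e']
    exact fourierInv_toLp_ae g1 g2
  have hatom : atom α ψ z = (𝓕⁻ (Q2.toLp Q) : L2) := by
    refine Lp.ext ?_
    filter_upwards [rep_ae (sect α z) rfl hψ, fourierInv_toLp_ae Q1 Q2] with t h1 h2
    rw [h2, atom, h1]
    exact (fourierInv_profile g hβ z.1 z.2 t).symm
  rw [hatom, FourierTransform.fourier_fourierInv_eq]
  exact Q2.coeFn_toLp

/-- Fourier multipliers with admissible symbols map atoms to molecules. -/
theorem isMolecule_fmul_atom (hα0 : 0 ≤ α) (hα1 : α < 1) {r C : ℝ} (hr : 1 < r) {ψ : L2}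
    {g : ℝ → ℂ} (hg : Differentiable ℝ g) (hae : ⇑(𝓕 ψ : L2) =ᵐ[volume] g) (hC : 0 < C)
    (hb : ∀ ξ, ‖g ξ‖ ≤ C * (1 + |ξ|) ^ (-r)) (hb' : ∀ ξ, ‖deriv g ξ‖ ≤ C * (1 + |ξ|) ^ (-r))
    {b : ℝ →ᵇ ℂ} (hs : IsSymbol α b) :
    ∃ C', IsMolecule α (r - α / (1 - α)) C' (fun z => fmul b (atom α ψ z))
      (fun ω ξ => b ξ * profile α g ω ξ) := by
  obtain ⟨db, B, hB⟩ := hs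
  have hB0 : 0 ≤ B := nonneg_of_mul_nonneg_left ((norm_nonneg _).trans (hB 0)) (beta_pos α 0)
  have hρ : 0 ≤ α / (1 - α) := div_nonneg hα0 (by linarith)
  have bp : ∀ ω ξ, ‖profile α g ω ξ‖ ≤ C * 3 ^ r * √(beta α ω) * wdist α ω ξ ^ (-r) := by
    intro ω ξ
    rw [profile, norm_mul, Complex.norm_real, Real.norm_of_nonneg (Real.sqrt_nonneg _)]
    have h := (hb (beta α ω * (ξ - ω))).trans
      (mul_le_mul_of_nonneg_left (decay_le_wdist hα0 hα1 (by linarith) ω ξ) hC.le)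
    calc _ ≤ _ := mul_le_mul_of_nonneg_left h (Real.sqrt_nonneg _)
      _ = _ := by ring
  have bp' : ∀ ω ξ, ‖deriv (profile α g ω) ξ‖ ≤
      C * 3 ^ r * √(beta α ω) * beta α ω * wdist α ω ξ ^ (-r) := by
    intro ω ξ
    have hβ := beta_pos α ω
    rw [(hasDerivAt_profile hg ω ξ).deriv, norm_mul, norm_mul, Complex.norm_real, Complex.norm_real,
      Real.norm_of_nonneg (Real.sqrt_nonneg _), Real.norm_of_nonneg hβ.le]
    have h := (hb' (beta α ω * (ξ - ω))).trans
      (mul_le_mul_of_nonneg_left (decay_le_wdist hα0 hα1 (by linarith) ω ξ) hC.le)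
    calc _ ≤ _ := mul_le_mul_of_nonneg_left (mul_le_mul_of_nonneg_left h hβ.le) (Real.sqrt_nonneg _)
      _ = _ := by ring
  have hw : ∀ ω ξ, wdist α ω ξ ^ (-(r - α / (1 - α))) =
      wdist α ω ξ ^ (α / (1 - α)) * wdist α ω ξ ^ (-r) := fun ω ξ => by
    rw [← Real.rpow_add (wdist_pos _ _ _)]; congr 1; ring
  have h1w : ∀ ω ξ, 1 ≤ wdist α ω ξ ^ (α / (1 - α)) := fun ω ξ =>
    Real.one_le_rpow (one_le_wdist _ _ _) hρ
  refine ⟨(‖b‖ + B + 1) * (C * 3 ^ r), ⟨by positivity, ?_, ?_, ?_, ?_, ?_⟩⟩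
  · exact (b.continuous.comp continuous_snd).mul (continuous_profile hg.continuous)
  · exact fun ω => db.mul fun ξ => (hasDerivAt_profile hg ω ξ).differentiableAt
  · intro ω ξ
    have hW := Real.rpow_pos_of_pos (wdist_pos α ω ξ) (-r)
    rw [norm_mul, hw]
    calc _ ≤ ‖b‖ * (C * 3 ^ r * √(beta α ω) * wdist α ω ξ ^ (-r)) :=
          mul_le_mul (b.norm_coe_le_norm ξ) (bp ω ξ) (norm_nonneg _) (norm_nonneg _)
      _ ≤ (‖b‖ + B + 1) * (C * 3 ^ r * √(beta α ω) *
          (wdist α ω ξ ^ (α / (1 - α)) * wdist α ω ξ ^ (-r))) := by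
          gcongr
          · linarith
          · exact le_mul_of_one_le_left hW.le (h1w ω ξ)
      _ = _ := by ring
  · intro ω ξ
    have hβ := beta_pos α ω
    have hW := Real.rpow_pos_of_pos (wdist_pos α ω ξ) (-r)
    have hd : HasDerivAt (fun ξ => b ξ * profile α g ω ξ) _ ξ :=
      (db ξ).hasDerivAt.mul (hasDerivAt_profile (α := α) hg ω ξ).differentiableAt.hasDerivAt
    rw [hd.deriv, hw]
    refine (norm_add_le _ _).trans ?_
    rw [norm_mul, norm_mul]
    -- The symbol varies at the rate `β(ξ)`, whereas a molecule requires `β(ω)`. The exchange costs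
    -- `d^{α/(1-α)}`, which is why the decay drops from `r` to `r - α/(1-α)`.
    have hBβ : ‖deriv b ξ‖ ≤ B * (beta α ω * wdist α ω ξ ^ (α / (1 - α))) := by
      refine (hB ξ).trans (mul_le_mul_of_nonneg_left ?_ hB0)
      rw [wdist_comm]
      exact beta_le hα0 hα1 ξ ω
    calc _ ≤ B * (beta α ω * wdist α ω ξ ^ (α / (1 - α))) *
            (C * 3 ^ r * √(beta α ω) * wdist α ω ξ ^ (-r)) +
          ‖b‖ * (C * 3 ^ r * √(beta α ω) * beta α ω * wdist α ω ξ ^ (-r)) :=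
          add_le_add (mul_le_mul hBβ (bp ω ξ) (norm_nonneg _) ((norm_nonneg _).trans hBβ))
            (mul_le_mul (b.norm_coe_le_norm ξ) (bp' ω ξ) (norm_nonneg _) (norm_nonneg _))
      _ ≤ B * (beta α ω * wdist α ω ξ ^ (α / (1 - α))) *
            (C * 3 ^ r * √(beta α ω) * wdist α ω ξ ^ (-r)) +
          (‖b‖ + 1) * (C * 3 ^ r * √(beta α ω) * beta α ω *
            (wdist α ω ξ ^ (α / (1 - α)) * wdist α ω ξ ^ (-r))) := by
          gcongr
          · linarith
          · exact le_mul_of_one_le_left hW.le (h1w ω ξ)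
      _ = _ := by ring
  · intro z
    filter_upwards [fourier_fmul_ae b (atom α ψ z),
      fourier_atom_ae (α := α) hr hg.continuous hae hb z] with ξ h1 h2
    rw [h1, h2]
    ring

end AlphaMod

namespace AlphaMod

open scoped BoundedContinuousFunction

/-! ### The frame operator as a Fourier multiplier -/

/-- The symbol of the frame operator of a family with frequency profile `P`. -/
noncomputable def frameSymbol (P : ℝ → ℝ → ℂ) (ξ : ℝ) : ℂ :=
  ∫ ω, P ω ξ * starRingEnd ℂ (P ω ξ)

variable {α t C : ℝ} {e : X → L2} {P : ℝ → ℝ → ℂ}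

lemma IsMolecule.norm_sq_le (he : IsMolecule α t C e P) (ω ξ : ℝ) :
    ‖P ω ξ‖ ^ 2 ≤ C ^ 2 * (beta α ω * wdist α ω ξ ^ (-(2 * t))) := by
  refine (pow_le_pow_left₀ (norm_nonneg _) (he.bound ω ξ) 2).trans_eq ?_
  rw [mul_pow, mul_pow, Real.sq_sqrt (beta_pos α ω).le, rpow_neg_sq (wdist_pos _ _ _)]
  ring

/-- An upper bound for the frame symbol. -/
noncomputable def symConst (α t C : ℝ) : ℝ≥0∞ :=
  ENNReal.ofReal (C ^ 2) * (ENNReal.ofReal (1 / (1 - α)) * decayInt (2 * t))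

lemma symConst_lt_top (ht : 1 < t) : symConst α t C < ∞ :=
  ENNReal.mul_lt_top ENNReal.ofReal_lt_top
    (ENNReal.mul_lt_top ENNReal.ofReal_lt_top (decayInt_lt_top (by linarith)))

lemma IsMolecule.lintegral_sq_le (hα1 : α < 1) (he : IsMolecule α t C e P) (ξ : ℝ) :
    ∫⁻ ω, ‖P ω ξ‖ₑ ^ 2 ≤ symConst α t C := by
  unfold symConst
  refine le_trans ?_ (mul_le_mul_right (lintegral_beta_wdist_le hα1 ξ) _)
  rw [← lintegral_const_mul' _ _ ENNReal.ofReal_ne_top]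
  refine lintegral_mono fun ω => ?_
  rw [← ofReal_norm, ← ENNReal.ofReal_pow (norm_nonneg _), ← ENNReal.ofReal_mul (by positivity)]
  exact ENNReal.ofReal_le_ofReal (he.norm_sq_le ω ξ)

lemma IsMolecule.continuous_left (he : IsMolecule α t C e P) (ξ : ℝ) :
    Continuous fun ω => P ω ξ :=
  he.cont.comp (by fun_prop : Continuous fun ω : ℝ => (ω, ξ))

lemma IsMolecule.norm_le (hα0 : 0 ≤ α) (ht : 0 ≤ t) (he : IsMolecule α t C e P) (ω ξ : ℝ) :
    ‖P ω ξ‖ ≤ C := by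
  refine (he.bound ω ξ).trans ?_
  have h1 : √(beta α ω) ≤ 1 := Real.sqrt_le_one.2 (beta_le_one hα0 ω)
  have h2 : wdist α ω ξ ^ (-t) ≤ 1 :=
    Real.rpow_le_one_of_one_le_of_nonpos (one_le_wdist _ _ _) (by linarith)
  have h3 := Real.rpow_nonneg (wdist_pos α ω ξ).le (-t)
  have hC := he.pos
  calc C * √(beta α ω) * wdist α ω ξ ^ (-t) ≤ C * 1 * 1 := by gcongr
    _ = C := by ring

lemma IsMolecule.memLp_right (he : IsMolecule α t C e P) (ω : ℝ) : MemLp (P ω) 2 volume := by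
  refine (Lp.memLp (𝓕 (e (0, ω)) : L2)).ae_eq ((he.fourier (0, ω)).trans ?_)
  exact Filter.Eventually.of_forall fun ξ => by simp

lemma IsMolecule.ip_eq_fourierInv (he : IsMolecule α t C e P) (f : L2) (x ω : ℝ) :
    ip f (e (x, ω)) = 𝓕⁻ (fun ξ => (𝓕 f : L2) ξ * starRingEnd ℂ (P ω ξ)) x := by
  rw [he.ip_right, fourierInv_eq_integral]
  refine integral_congr_ae (Filter.Eventually.of_forall fun ξ => ?_)
  simp only
  congr 2
  ring

lemma IsMolecule.integrable_fourier_mul (he : IsMolecule α t C e P) (f : L2) (ω : ℝ) :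
    Integrable fun ξ => (𝓕 f : L2) ξ * starRingEnd ℂ (P ω ξ) := by
  have h : MemLp (fun ξ => starRingEnd ℂ (P ω ξ)) 2 volume := (he.memLp_right ω).star
  exact (Lp.memLp (𝓕 f : L2)).integrable_mul h

lemma IsMolecule.memLp_fourier_mul (hα0 : 0 ≤ α) (ht : 0 ≤ t) (he : IsMolecule α t C e P) (f : L2)
    (ω : ℝ) : MemLp (fun ξ => (𝓕 f : L2) ξ * starRingEnd ℂ (P ω ξ)) 2 volume := by
  refine (Lp.memLp (𝓕 f : L2)).of_le_mul (c := C)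
    (he.integrable_fourier_mul f ω).aestronglyMeasurable (Filter.Eventually.of_forall fun ξ => ?_)
  rw [norm_mul, RCLike.norm_conj, mul_comm]
  exact mul_le_mul_of_nonneg_right (he.norm_le hα0 ht ω ξ) (norm_nonneg _)

lemma lintegral_enorm_sq_coe (f : L2) : ∫⁻ ξ, ‖f ξ‖ₑ ^ 2 = ENNReal.ofReal ‖f‖ ^ 2 := by
  rw [lintegral_enorm_sq_eq, ← Lp.enorm_def, ofReal_norm]

/-- The `L²` function `(ω, ξ) ↦ f̂(ξ) conj P(ω, ξ)`. -/
lemma IsMolecule.stronglyMeasurable_prod (he : IsMolecule α t C e P) (f : L2) :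
    StronglyMeasurable fun p : ℝ × ℝ => (𝓕 f : L2) p.2 * starRingEnd ℂ (P p.1 p.2) :=
  ((Lp.stronglyMeasurable (𝓕 f : L2)).comp_measurable measurable_snd).mul
    (Complex.continuous_conj.comp he.cont).stronglyMeasurable

lemma IsMolecule.lintegral_prod_le (hα1 : α < 1) (he : IsMolecule α t C e P) (f : L2) :
    ∫⁻ ω, ∫⁻ ξ, ‖(𝓕 f : L2) ξ * starRingEnd ℂ (P ω ξ)‖ₑ ^ 2 ≤
      symConst α t C * ENNReal.ofReal ‖f‖ ^ 2 := by
  rw [lintegral_lintegral_swap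
    ((he.stronglyMeasurable_prod f).measurable.enorm.pow_const 2).aemeasurable]
  calc ∫⁻ ξ, ∫⁻ ω, ‖(𝓕 f : L2) ξ * starRingEnd ℂ (P ω ξ)‖ₑ ^ 2
      ≤ ∫⁻ ξ, ‖(𝓕 f : L2) ξ‖ₑ ^ 2 * symConst α t C := by
        refine lintegral_mono fun ξ => ?_
        simp only [enorm_mul, mul_pow, RCLike.enorm_conj]
        rw [lintegral_const_mul' _ _ (by simp)]
        gcongr
        exact he.lintegral_sq_le hα1 ξ
    _ = symConst α t C * ENNReal.ofReal ‖f‖ ^ 2 := by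
        rw [lintegral_mul_const _ ((Lp.stronglyMeasurable (𝓕 f : L2)).measurable.enorm.pow_const 2),
          lintegral_enorm_sq_coe, Lp.norm_fourier_eq, mul_comm]

lemma memLp_two_of_lintegral_sq_prod {f : ℝ × ℝ → ℂ} (hf : AEStronglyMeasurable f volume)
    (h : ∫⁻ x, ‖f x‖ₑ ^ 2 < ∞) : MemLp f 2 volume := by
  refine ⟨hf, ?_⟩
  have := eLpNorm_nnreal_pow_eq_lintegral (f := f) (μ := (volume : Measure (ℝ × ℝ)))
    (p := 2) (by norm_num)
  simp only [NNReal.coe_ofNat, ENNReal.rpow_ofNat, ENNReal.coe_ofNat] at this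
  rw [← this] at h
  exact lt_top_iff_ne_top.2 fun H => by simp [H] at h

lemma IsMolecule.memLp_prod (hα1 : α < 1) (ht : 1 < t) (he : IsMolecule α t C e P) (f : L2) :
    MemLp (fun p : ℝ × ℝ => (𝓕 f : L2) p.2 * starRingEnd ℂ (P p.1 p.2)) 2 volume := by
  refine memLp_two_of_lintegral_sq_prod (he.stronglyMeasurable_prod f).aestronglyMeasurable ?_
  rw [Measure.volume_eq_prod, lintegral_prod _
    ((he.stronglyMeasurable_prod f).measurable.enorm.pow_const 2).aemeasurable]
  refine (he.lintegral_prod_le hα1 f).trans_lt (ENNReal.mul_lt_top (symConst_lt_top ht) ?_)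
  exact ENNReal.pow_lt_top ENNReal.ofReal_lt_top

/-- The voice transform of a molecule is square integrable. -/
lemma IsMolecule.memLp_ip (hα0 : 0 ≤ α) (hα1 : α < 1) (ht : 1 < t) (he : IsMolecule α t C e P)
    (f : L2) : MemLp (fun z => ip f (e z)) 2 volume := by
  refine memLp_two_of_lintegral_sq_prod (he.measurable_ip f).aestronglyMeasurable ?_
  rw [Measure.volume_eq_prod, lintegral_prod_symm' _
    ((he.measurable_ip f).measurable.enorm.pow_const 2)]
  refine lt_of_eq_of_lt (lintegral_congr fun ω => ?_) ((he.lintegral_prod_le hα1 f).trans_lt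
    (ENNReal.mul_lt_top (symConst_lt_top ht) (ENNReal.pow_lt_top ENNReal.ofReal_lt_top)))
  simp only [he.ip_eq_fourierInv f]
  have h1 := he.integrable_fourier_mul f ω
  have h2 := he.memLp_fourier_mul hα0 (by linarith) f ω
  rw [lintegral_enorm_sq_eq, eLpNorm_fourierInv_eq h1 h2, ← lintegral_enorm_sq_eq]

lemma ip_conj (f g : L2) : starRingEnd ℂ (ip f g) = ip g f := inner_conj_symm _ _

/-- For fixed `ω` the voice transform is, in `x`, the inverse Fourier integral of `f̂ conj P(ω,·)`,
so Parseval turns the `x`-integral into a `ξ`-integral. Fubini, justified by square integrability of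
`f̂ conj P` and `ĥ conj P` on the plane, then isolates `∫ |P(ω,ξ)|² dω`. -/
theorem IsMolecule.frame_formula (hα0 : 0 ≤ α) (hα1 : α < 1) (ht : 1 < t)
    (he : IsMolecule α t C e P) (f h : L2) :
    Integrable (fun z : X => ip f (e z) * ip (e z) h) ∧
    ∫ z : X, ip f (e z) * ip (e z) h =
      ∫ ξ, frameSymbol P ξ * ((𝓕 f : L2) ξ * starRingEnd ℂ ((𝓕 h : L2) ξ)) := by
  have hf := he.memLp_ip hα0 hα1 ht f
  have hh : MemLp (fun z => ip (e z) h) 2 volume := by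
    have : MemLp (fun z => starRingEnd ℂ (ip h (e z))) 2 volume := (he.memLp_ip hα0 hα1 ht h).star
    simpa only [ip_conj] using this
  have hi : Integrable (fun z : X => ip f (e z) * ip (e z) h) := hf.integrable_mul hh
  refine ⟨hi, ?_⟩
  have hi2 : Integrable (fun p : ℝ × ℝ => ((𝓕 f : L2) p.2 * starRingEnd ℂ (P p.1 p.2)) *
      starRingEnd ℂ ((𝓕 h : L2) p.2 * starRingEnd ℂ (P p.1 p.2))) :=
    (he.memLp_prod hα1 ht f).integrable_mul (he.memLp_prod hα1 ht h).star
  rw [Measure.volume_eq_prod] at hi hi2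
  rw [Measure.volume_eq_prod, integral_prod_symm _ hi]
  calc ∫ ω, ∫ x, ip f (e (x, ω)) * ip (e (x, ω)) h
      = ∫ ω, ∫ ξ, ((𝓕 f : L2) ξ * starRingEnd ℂ (P ω ξ)) *
          starRingEnd ℂ ((𝓕 h : L2) ξ * starRingEnd ℂ (P ω ξ)) := by
        refine integral_congr_ae (Filter.Eventually.of_forall fun ω => ?_)
        simp only
        rw [← parseval_fourierInv (he.integrable_fourier_mul f ω)
          (he.memLp_fourier_mul hα0 (by linarith) f ω) (he.integrable_fourier_mul h ω)
          (he.memLp_fourier_mul hα0 (by linarith) h ω)]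
        refine integral_congr_ae (Filter.Eventually.of_forall fun x => ?_)
        simp only
        rw [← he.ip_eq_fourierInv, ← he.ip_eq_fourierInv, ip_conj]
    _ = ∫ ξ, ∫ ω, ((𝓕 f : L2) ξ * starRingEnd ℂ (P ω ξ)) *
          starRingEnd ℂ ((𝓕 h : L2) ξ * starRingEnd ℂ (P ω ξ)) :=
        integral_integral_swap hi2
    _ = _ := by
        refine integral_congr_ae (Filter.Eventually.of_forall fun ξ => ?_)
        simp only [frameSymbol]
        rw [← integral_mul_const]
        refine integral_congr_ae (Filter.Eventually.of_forall fun ω => ?_)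
        simp only [map_mul, RCLike.conj_conj]
        ring

/-! ### Regularity of the frame symbol -/

/-- Moving `ξ` by at most 1 changes `warp α ξ` by at most 3, since `β ≤ 1`. This supplies a
dominating function, uniform near `ξ₀`, for differentiation under the integral. -/
lemma wdist_le_of_abs_sub_le (hα0 : 0 ≤ α) (hα1 : α < 1) {ω ξ ξ₀ : ℝ} (h : |ξ - ξ₀| ≤ 1) :
    wdist α ω ξ₀ ≤ 4 * wdist α ω ξ := by
  have h1 := abs_warp_sub_le hα0 hα1 ξ ξ₀
  have h2 : beta α ξ * |ξ - ξ₀| ≤ 1 * 1 :=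
    mul_le_mul (beta_le_one hα0 ξ) h (abs_nonneg _) zero_le_one
  have h3 := abs_sub_le (warp α ω) (warp α ξ) (warp α ξ₀)
  have h4 := abs_nonneg (warp α ω - warp α ξ)
  unfold wdist
  linarith

lemma IsMolecule.norm_deriv_mul_conj_le (he : IsMolecule α t C e P) (ω ξ : ℝ) :
    ‖deriv (P ω) ξ * starRingEnd ℂ (P ω ξ) + P ω ξ * starRingEnd ℂ (deriv (P ω) ξ)‖ ≤
      2 * C ^ 2 * (beta α ω * (beta α ω * wdist α ω ξ ^ (-(2 * t)))) := by
  have hβ := beta_pos α ω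
  have hC := he.pos
  have hW := Real.rpow_pos_of_pos (wdist_pos α ω ξ) (-t)
  refine (norm_add_le _ _).trans ?_
  rw [norm_mul, norm_mul, RCLike.norm_conj, RCLike.norm_conj, ← rpow_neg_sq (wdist_pos _ _ _)]
  have h := mul_le_mul (he.bound_deriv ω ξ) (he.bound ω ξ) (norm_nonneg _) (by positivity)
  have e1 : C * √(beta α ω) * beta α ω * wdist α ω ξ ^ (-t) *
      (C * √(beta α ω) * wdist α ω ξ ^ (-t)) =
      C ^ 2 * (beta α ω * (beta α ω * (wdist α ω ξ ^ (-t)) ^ 2)) := by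
    have := Real.sq_sqrt hβ.le
    calc _ = C ^ 2 * (√(beta α ω) ^ 2 * (beta α ω * (wdist α ω ξ ^ (-t)) ^ 2)) := by ring
      _ = _ := by rw [this]
  rw [e1] at h
  rw [mul_comm ‖P ω ξ‖]
  linarith

lemma measurable_beta_wdist (hα1 : α < 1) (N c : ℝ) :
    Measurable fun ω => beta α ω * wdist α ω c ^ (-N) := by
  have : (fun ω => beta α ω * wdist α ω c ^ (-N)) = fun ω => beta α ω * wdist α c ω ^ (-N) := by
    ext ω; rw [wdist_comm]
  rw [this]
  exact (continuous_beta α).measurable.mul ((measurable_wdist hα1 c).pow_const _)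

lemma integrable_beta_wdist (hα1 : α < 1) {N : ℝ} (hN : 1 < N) (c : ℝ) :
    Integrable fun ω => beta α ω * wdist α ω c ^ (-N) := by
  refine ⟨(measurable_beta_wdist hα1 N c).aestronglyMeasurable, ?_⟩
  rw [hasFiniteIntegral_iff_ofReal (Filter.Eventually.of_forall fun ω =>
    mul_nonneg (beta_pos _ _).le (Real.rpow_nonneg (wdist_pos _ _ _).le _))]
  exact (lintegral_beta_wdist_le hα1 c).trans_lt
    (ENNReal.mul_lt_top ENNReal.ofReal_lt_top (decayInt_lt_top hN))

theorem IsMolecule.hasDerivAt_frameSymbol (hα0 : 0 ≤ α) (hα1 : α < 1) (ht : 1 < t)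
    (he : IsMolecule α t C e P) (ξ₀ : ℝ) :
    HasDerivAt (frameSymbol P) (∫ ω, (deriv (P ω) ξ₀ * starRingEnd ℂ (P ω ξ₀) +
      P ω ξ₀ * starRingEnd ℂ (deriv (P ω) ξ₀))) ξ₀ := by
  have hC := he.pos
  refine (hasDerivAt_integral_of_dominated_loc_of_deriv_le (μ := volume)
    (F := fun ξ ω => P ω ξ * starRingEnd ℂ (P ω ξ))
    (F' := fun ξ ω => deriv (P ω) ξ * starRingEnd ℂ (P ω ξ) +
      P ω ξ * starRingEnd ℂ (deriv (P ω) ξ))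
    (bound := fun ω => 2 * C ^ 2 * 4 ^ (2 * t) * (beta α ω * wdist α ω ξ₀ ^ (-(2 * t))))
    (s := Metric.ball ξ₀ 1) (Metric.ball_mem_nhds ξ₀ one_pos) ?_ ?_ ?_ ?_ ?_ ?_).2
  · refine Filter.Eventually.of_forall fun ξ => ?_
    have h := he.continuous_left ξ
    exact (h.mul (Complex.continuous_conj.comp h)).aestronglyMeasurable
  · refine ((integrable_beta_wdist hα1 (by linarith : 1 < 2 * t) ξ₀).const_mul (C ^ 2)).mono' ?_ ?_
    · have h := he.continuous_left ξ₀
      exact (h.mul (Complex.continuous_conj.comp h)).aestronglyMeasurable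
    · refine Filter.Eventually.of_forall fun ω => ?_
      rw [norm_mul, RCLike.norm_conj, ← sq]
      exact he.norm_sq_le ω ξ₀
  · have hd : Measurable fun ω => deriv (P ω) ξ₀ :=
      (measurable_deriv_with_param he.cont).comp
        (measurable_id.prodMk (measurable_const (a := ξ₀)))
    have h := (he.continuous_left ξ₀).measurable
    have hc := Complex.continuous_conj.measurable
    exact ((hd.mul (hc.comp h)).add (h.mul (hc.comp hd))).aestronglyMeasurable
  · refine Filter.Eventually.of_forall fun ω ξ hξ => ?_
    have hβ := beta_pos α ω
    refine (he.norm_deriv_mul_conj_le ω ξ).trans ?_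
    have hd : |ξ - ξ₀| ≤ 1 := by
      have := Metric.mem_ball.1 hξ
      rw [Real.dist_eq] at this
      exact this.le
    have h4 : wdist α ω ξ ^ (-(2 * t)) ≤ 4 ^ (2 * t) * wdist α ω ξ₀ ^ (-(2 * t)) := by
      have h5 := wdist_le_of_abs_sub_le (ω := ω) hα0 hα1 hd
      have hp := wdist_pos α ω ξ₀
      calc wdist α ω ξ ^ (-(2 * t)) ≤ (wdist α ω ξ₀ / 4) ^ (-(2 * t)) :=
            Real.rpow_le_rpow_of_nonpos (by positivity) (by linarith) (by linarith)
        _ = _ := by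
            rw [Real.div_rpow hp.le (by norm_num), Real.rpow_neg (by norm_num : (0 : ℝ) ≤ 4),
              div_inv_eq_mul, mul_comm]
    have hW := Real.rpow_pos_of_pos (wdist_pos α ω ξ) (-(2 * t))
    calc 2 * C ^ 2 * (beta α ω * (beta α ω * wdist α ω ξ ^ (-(2 * t))))
        ≤ 2 * C ^ 2 * (1 * (beta α ω * (4 ^ (2 * t) * wdist α ω ξ₀ ^ (-(2 * t))))) := by
          gcongr
          exact beta_le_one hα0 ω
      _ = _ := by ring
  · exact (integrable_beta_wdist hα1 (by linarith : 1 < 2 * t) ξ₀).const_mul _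
  · exact Filter.Eventually.of_forall fun ω ξ _ => hasDerivAt_mul_conj (he.diff ω) (he.diff ω) ξ

/-- The differentiated integrand is `≲ β(ω)² d^{-2t}`. One factor `β(ω)` is traded for `β(ξ)
d^{α/(1-α)}` and leaves the integral; the other is the density of the warped substitution. -/
theorem IsMolecule.exists_norm_deriv_frameSymbol_le (hα0 : 0 ≤ α) (hα1 : α < 1)
    (ht : 1 + α / (1 - α) < t) (he : IsMolecule α t C e P) :
    ∃ B, ∀ ξ, ‖deriv (frameSymbol P) ξ‖ ≤ B * beta α ξ := by
  have hρ : 0 ≤ α / (1 - α) := div_nonneg hα0 (by linarith)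
  have hC := he.pos
  set K : ℝ≥0∞ := ENNReal.ofReal (1 / (1 - α)) * decayInt (2 * t - α / (1 - α)) with hK
  have hKt : K ≠ ∞ := (ENNReal.mul_lt_top ENNReal.ofReal_lt_top (decayInt_lt_top (by linarith))).ne
  refine ⟨2 * C ^ 2 * K.toReal, fun ξ => ?_⟩
  have hβ := beta_pos α ξ
  rw [(he.hasDerivAt_frameSymbol hα0 hα1 (by linarith) ξ).deriv]
  refine (norm_integral_le_lintegral_norm _).trans ?_
  refine ENNReal.toReal_le_of_le_ofReal (by positivity) ?_
  rw [show 2 * C ^ 2 * K.toReal * beta α ξ = 2 * C ^ 2 * beta α ξ * K.toReal by ring,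
    ENNReal.ofReal_mul (by positivity), ENNReal.ofReal_toReal hKt]
  refine le_trans ?_ (mul_le_mul_right (lintegral_beta_wdist_le hα1 ξ) _)
  rw [← lintegral_const_mul' _ _ ENNReal.ofReal_ne_top]
  refine lintegral_mono fun ω => ?_
  have hD := wdist_pos α ω ξ
  have hβω := beta_pos α ω
  rw [← ENNReal.ofReal_mul (by positivity)]
  refine ENNReal.ofReal_le_ofReal ((he.norm_deriv_mul_conj_le ω ξ).trans ?_)
  have p1 := Real.rpow_pos_of_pos hD (-(2 * t))
  rw [show -(2 * t - α / (1 - α)) = α / (1 - α) + -(2 * t) by ring, Real.rpow_add hD]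
  calc _ ≤ 2 * C ^ 2 * ((beta α ξ * wdist α ω ξ ^ (α / (1 - α))) *
        (beta α ω * wdist α ω ξ ^ (-(2 * t)))) := by
        gcongr
        exact beta_le hα0 hα1 ω ξ
    _ = _ := by ring

lemma IsMolecule.norm_frameSymbol_le (hα1 : α < 1) (ht : 1 < t) (he : IsMolecule α t C e P)
    (ξ : ℝ) : ‖frameSymbol P ξ‖ ≤ (symConst α t C).toReal := by
  refine (norm_integral_le_lintegral_norm _).trans
    (ENNReal.toReal_mono (symConst_lt_top ht).ne ((he.lintegral_sq_le hα1 ξ).trans' ?_))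
  refine lintegral_mono fun ω => ?_
  rw [norm_mul, RCLike.norm_conj, ENNReal.ofReal_mul (norm_nonneg _), ofReal_norm, sq]

end AlphaMod

namespace AlphaMod

open scoped BoundedContinuousFunction

/-! ### The frame symbol is bounded below -/

variable {α : ℝ}

/-- Intermediate value theorem: since `α < 1`, the continuous function `β(ω)(ξ - ω)` is unbounded in
both directions. -/
lemma exists_beta_mul_sub_eq (hα0 : 0 ≤ α) (hα1 : α < 1) (ξ t₀ : ℝ) :
    ∃ ω, beta α ω * (ξ - ω) = t₀ := by
  have ha : 0 < 1 - α := by linarith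
  set M : ℝ := |ξ| + 1 + |t₀| with hM
  have hM1 : 1 ≤ M := by rw [hM]; linarith [abs_nonneg ξ, abs_nonneg t₀]
  -- Chosen so that `β(u)(1+u) = (1+u)^(1-α) = M`. The values at `u` and `-u` are then at most
  -- `-|t₀|` and at least `|t₀|`.
  set u : ℝ := M ^ (1 / (1 - α)) - 1 with hu
  have hu1 : 1 ≤ M ^ (1 / (1 - α)) := Real.one_le_rpow hM1 (by positivity)
  have hu0 : 0 ≤ u := by linarith
  have hβ := beta_pos α u
  have hβ1 := beta_le_one hα0 u
  have hβu : beta α u * (1 + u) = M := by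
    have e : (1 + |u|) = M ^ (1 / (1 - α)) := by rw [abs_of_nonneg hu0, hu]; ring
    have e2 : 1 + u = M ^ (1 / (1 - α)) := by rw [hu]; ring
    have hpos : (0 : ℝ) < M ^ (1 / (1 - α)) := by linarith
    rw [beta, e, e2]
    nth_rw 2 [← Real.rpow_one (M ^ (1 / (1 - α)))]
    rw [← Real.rpow_add hpos, ← Real.rpow_mul (by linarith), show -α + 1 = 1 - α by ring,
      one_div_mul_cancel ha.ne', Real.rpow_one]
  have hβn : beta α (-u) = beta α u := by simp [beta]
  have hc : Continuous fun ω => beta α ω * (ξ - ω) :=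
    (continuous_beta α).mul (continuous_const.sub continuous_id)
  have key := mem_range_of_exists_le_of_exists_ge (c := t₀) hc ⟨u, ?_⟩ ⟨-u, ?_⟩
  · exact key
  · have : beta α u * (ξ + 1) ≤ |ξ| + 1 := by
      nlinarith [le_abs_self ξ, neg_abs_le ξ, abs_nonneg ξ]
    have h2 := neg_abs_le t₀
    have : beta α u * (ξ - u) = beta α u * (ξ + 1) - M := by rw [← hβu]; ring
    linarith
  · have h1 : -(|ξ| + 1) ≤ beta α u * (ξ - 1) := by
      nlinarith [le_abs_self ξ, neg_abs_le ξ, abs_nonneg ξ]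
    have h2 := le_abs_self t₀
    have : beta α (-u) * (ξ - -u) = beta α u * (ξ - 1) + M := by rw [hβn, ← hβu]; ring
    linarith

/-- The ratio minus one is, up to sign, `β(ω₀)` times an increment of `(1+|·|)^α`, and that
increment is at most `|ω - ω₀|`. So `β` is almost constant on small multiples of its own scale. -/
lemma abs_beta_div_sub_one_le (hα0 : 0 ≤ α) (hα1 : α < 1) {ω ω₀ ε : ℝ}
    (h : beta α ω₀ * |ω - ω₀| ≤ ε) : |beta α ω₀ / beta α ω - 1| ≤ ε := by
  have hA : 0 < 1 + |ω₀| := by positivity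
  have hB : 0 < 1 + |ω| := by positivity
  have hβ₀ := beta_pos α ω₀
  have key := abs_rpow_sub_rpow_le hα0 hα1.le hA hB
  have e1 : beta α ω₀ / beta α ω - 1 = -(beta α ω₀ * ((1 + |ω₀|) ^ α - (1 + |ω|) ^ α)) := by
    have p1 := Real.rpow_pos_of_pos hA α
    have p2 := Real.rpow_pos_of_pos hB α
    rw [beta, beta, Real.rpow_neg hA.le, Real.rpow_neg hB.le]
    field_simp
    ring
  rw [e1, abs_neg, abs_mul, abs_of_pos hβ₀]
  refine le_trans ?_ h
  refine mul_le_mul_of_nonneg_left (key.trans ?_) hβ₀.le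
  have h1 : (1 + |ω₀|) ^ (α - 1) ≤ 1 :=
    Real.rpow_le_one_of_one_le_of_nonpos (by linarith [abs_nonneg ω₀]) (by linarith)
  have h2 : |1 + |ω₀| - (1 + |ω|)| ≤ |ω - ω₀| := by
    rw [add_sub_add_left_eq_sub, abs_sub_comm ω]
    exact abs_abs_sub_abs_le _ _
  calc _ ≤ 1 * |ω - ω₀| := mul_le_mul h1 h2 (abs_nonneg _) zero_le_one
    _ = _ := one_mul _

/-- For each `ξ` choose `ω₀` with `β(ω₀)(ξ-ω₀) = t₀`. On the interval of radius `η/β(ω₀)` about `ω₀`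
the argument of `g` stays close to `t₀`, so the integrand is at least `β(ω₀)δ²/2`. The length
`2η/β(ω₀)` cancels `β(ω₀)`, and the bound is uniform in `ξ`. -/
lemma exists_le_integral_profile (hα0 : 0 ≤ α) (hα1 : α < 1) {g : ℝ → ℂ} (hg : Continuous g)
    {t₀ : ℝ} (ht₀ : g t₀ ≠ 0) (hint : ∀ ξ, Integrable fun ω => ‖profile α g ω ξ‖ ^ 2) :
    ∃ c, 0 < c ∧ ∀ ξ, c ≤ ∫ ω, ‖profile α g ω ξ‖ ^ 2 := by
  set δ : ℝ := ‖g t₀‖ / 2 with hδ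
  have hδ0 : 0 < δ := by have := norm_pos_iff.2 ht₀; positivity
  obtain ⟨ε, hε, hgε⟩ : ∃ ε > 0, ∀ t, |t - t₀| < ε → δ < ‖g t‖ := by
    have : ∀ᶠ t in nhds t₀, δ < ‖g t‖ :=
      hg.norm.continuousAt.eventually_const_lt (by rw [hδ]; linarith [norm_pos_iff.2 ht₀])
    obtain ⟨ε, h1, h2⟩ := Metric.eventually_nhds_iff.1 this
    exact ⟨ε, h1, fun t ht => h2 (by rwa [Real.dist_eq])⟩
  have hT : 0 < |t₀| + 1 := by positivity
  -- With `η ≤ 1/2` the ratio `y` of the two `β` values is at least `1/2`, so the argument of `g` is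
  -- off by at most `2η(|t₀|+1) ≤ ε/2`.
  set η : ℝ := min (1 / 2) (ε / (4 * (|t₀| + 1))) with hη
  have hη0 : 0 < η := lt_min (by norm_num) (by positivity)
  have hη1 : η ≤ 1 / 2 := min_le_left _ _
  have hη2 : η * (4 * (|t₀| + 1)) ≤ ε := (le_div_iff₀ (by positivity)).1 (min_le_right _ _)
  refine ⟨η * δ ^ 2, by positivity, fun ξ => ?_⟩
  obtain ⟨ω₀, hω₀⟩ := exists_beta_mul_sub_eq hα0 hα1 ξ t₀
  have hβ₀ := beta_pos α ω₀
  set S : Set ℝ := Set.Icc (ω₀ - η / beta α ω₀) (ω₀ + η / beta α ω₀) with hS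
  have hlow : ∀ ω ∈ S, beta α ω₀ / 2 * δ ^ 2 ≤ ‖profile α g ω ξ‖ ^ 2 := by
    intro ω hω
    have hβ := beta_pos α ω
    have hd : beta α ω₀ * |ω - ω₀| ≤ η := by
      have : |ω - ω₀| ≤ η / beta α ω₀ := abs_le.2 ⟨by linarith [hω.1], by linarith [hω.2]⟩
      rwa [le_div_iff₀ hβ₀, mul_comm] at this
    have hy := abs_beta_div_sub_one_le hα0 hα1 hd
    set y : ℝ := beta α ω₀ / beta α ω with hydef
    have hy1 : 1 / 2 ≤ y := by linarith [(abs_le.1 hy).1]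
    have hy2 : y ≤ 2 := by linarith [(abs_le.1 hy).2]
    have hy0 : 0 < y := by linarith
    have hβy : beta α ω = beta α ω₀ / y := by rw [hydef]; field_simp
    have harg : |beta α ω * (ξ - ω) - t₀| < ε := by
      have e : beta α ω * (ξ - ω) - t₀ = (t₀ * (1 - y) + beta α ω₀ * (ω₀ - ω)) / y := by
        rw [hβy, eq_div_iff hy0.ne', ← hω₀]
        field_simp
        ring
      rw [e, abs_div, abs_of_pos hy0, div_lt_iff₀ hy0]
      have h1 : |t₀ * (1 - y)| ≤ |t₀| * η := by
        rw [abs_mul, abs_sub_comm]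
        exact mul_le_mul_of_nonneg_left hy (abs_nonneg _)
      have h2 : |beta α ω₀ * (ω₀ - ω)| ≤ η := by
        rw [abs_mul, abs_of_pos hβ₀, abs_sub_comm]
        exact hd
      have h3 := abs_add_le (t₀ * (1 - y)) (beta α ω₀ * (ω₀ - ω))
      nlinarith
    have hg' := hgε _ harg
    rw [profile, norm_mul, mul_pow, Complex.norm_real, Real.norm_of_nonneg (Real.sqrt_nonneg _),
      Real.sq_sqrt hβ.le]
    have h5 : beta α ω₀ / 2 ≤ beta α ω := by
      rw [hβy]
      exact div_le_div_of_nonneg_left hβ₀.le hy0 hy2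
    gcongr
  have hvol : volume.real S = 2 * (η / beta α ω₀) := by
    rw [hS, Real.volume_real_Icc_of_le (by have : 0 < η / beta α ω₀ := by positivity
                                           linarith)]
    ring
  calc η * δ ^ 2 = ∫ ω in S, beta α ω₀ / 2 * δ ^ 2 := by
        rw [setIntegral_const, hvol, smul_eq_mul]
        field_simp
    _ ≤ ∫ ω in S, ‖profile α g ω ξ‖ ^ 2 :=
        setIntegral_mono_on (integrableOn_const (by rw [hS, Real.volume_Icc]; simp) enorm_ne_top)
          (hint ξ).integrableOn measurableSet_Icc hlow
    _ ≤ ∫ ω, ‖profile α g ω ξ‖ ^ 2 :=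
        setIntegral_le_integral (hint ξ) (Filter.Eventually.of_forall fun ω => by positivity)

lemma frameSymbol_eq_ofReal (P : ℝ → ℝ → ℂ) (ξ : ℝ) :
    frameSymbol P ξ = ((∫ ω, ‖P ω ξ‖ ^ 2 : ℝ) : ℂ) := by
  rw [frameSymbol, ← integral_complex_ofReal]
  refine integral_congr_ae (Filter.Eventually.of_forall fun ω => ?_)
  simp only [Complex.mul_conj, Complex.normSq_eq_norm_sq]

/-! ### Admissibility -/

/-- `e` is a family of molecules of some profile. -/
def IsMoleculeFamily (α t : ℝ) (e : X → L2) : Prop := ∃ C P, IsMolecule α t C e P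

lemma FourierDecay.isMoleculeFamily (hα0 : 0 ≤ α) (hα1 : α < 1) {r : ℝ} (hr : 1 < r) {φ : L2}
    (hφ : FourierDecay r φ) {b : ℝ →ᵇ ℂ} (hb : IsSymbol α b) :
    IsMoleculeFamily α (r - α / (1 - α)) fun z => fmul b (atom α φ z) := by
  obtain ⟨g, hg, hae, C, hC, h0, h1⟩ := hφ.exists_bound
  obtain ⟨C', h⟩ := isMolecule_fmul_atom hα0 hα1 hr hg hae hC h0 h1 hb
  exact ⟨C', _, h⟩

/-- Here `b` is the frame symbol `m` and `c = 1/m`. The lower bound on `m` makes `c` bounded, and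
`c' = -m'/m²` inherits the bound by `β`. -/
theorem FourierDecay.exists_symbol (hα0 : 0 ≤ α) (hα1 : α < 1) {r : ℝ}
    (hr : 1 + 2 * (α / (1 - α)) < r) {ψ : L2} (hψ0 : ψ ≠ 0) (hψ : FourierDecay r ψ) :
    ∃ b c : ℝ →ᵇ ℂ, IsSymbol α c ∧ b * c = 1 ∧ IsFrameOperator α ψ (fmul b) := by
  have hρ : 0 ≤ α / (1 - α) := div_nonneg hα0 (by linarith)
  obtain ⟨g, hg, hae, C, hC, h0, h1⟩ := hψ.exists_bound
  obtain ⟨C', he⟩ := isMolecule_fmul_atom hα0 hα1 (by linarith) hg hae hC h0 h1 isSymbol_one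
  have e1 : (fun z => fmul 1 (atom α ψ z)) = atom α ψ := by
    ext1 z; rw [fmul_one]; rfl
  have e2 : (fun ω ξ => (1 : ℝ →ᵇ ℂ) ξ * profile α g ω ξ) = profile α g := by
    ext ω ξ; simp
  rw [e1, e2] at he
  set t := r - α / (1 - α) with ht
  have ht1 : 1 + α / (1 - α) < t := by rw [ht]; linarith
  obtain ⟨t₀, ht₀⟩ : ∃ t₀, g t₀ ≠ 0 := by
    by_contra! H
    apply hψ0
    apply fourier_injective
    have : (𝓕 (0 : L2) : L2) = 0 := (Lp.fourierTransformₗᵢ ℝ ℂ).map_zero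
    rw [this]
    refine Lp.ext (hae.trans ?_)
    filter_upwards [Lp.coeFn_zero ℂ 2 (volume : Measure ℝ)] with ξ hξ
    rw [H ξ, hξ]; rfl
  have hint : ∀ ξ, Integrable fun ω => ‖profile α g ω ξ‖ ^ 2 := by
    intro ξ
    refine ((integrable_beta_wdist hα1 (by linarith : 1 < 2 * t) ξ).const_mul (C' ^ 2)).mono'
      ((he.continuous_left ξ).norm.pow 2).aestronglyMeasurable
      (Filter.Eventually.of_forall fun ω => ?_)
    rw [Real.norm_of_nonneg (by positivity)]
    exact he.norm_sq_le ω ξ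
  obtain ⟨c₀, hc₀, hlow⟩ := exists_le_integral_profile hα0 hα1 hg.continuous ht₀ hint
  set m : ℝ → ℂ := frameSymbol (profile α g) with hm
  have hmlow : ∀ ξ, c₀ ≤ ‖m ξ‖ := fun ξ => by
    rw [hm, frameSymbol_eq_ofReal, Complex.norm_real]
    exact (hlow ξ).trans (le_abs_self _)
  have hm0 : ∀ ξ, m ξ ≠ 0 := fun ξ => norm_pos_iff.1 (hc₀.trans_le (hmlow ξ))
  have hmd : Differentiable ℝ m := fun ξ =>
    (he.hasDerivAt_frameSymbol hα0 hα1 (by linarith) ξ).differentiableAt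
  obtain ⟨B, hB⟩ := he.exists_norm_deriv_frameSymbol_le hα0 hα1 ht1
  have hB0 : 0 ≤ B := nonneg_of_mul_nonneg_left ((norm_nonneg _).trans (hB 0)) (beta_pos α 0)
  let b : ℝ →ᵇ ℂ := BoundedContinuousFunction.ofNormedAddCommGroup m hmd.continuous _
    (he.norm_frameSymbol_le hα1 (by linarith))
  let c : ℝ →ᵇ ℂ := BoundedContinuousFunction.ofNormedAddCommGroup (fun ξ => (m ξ)⁻¹)
    (hmd.continuous.inv₀ hm0) c₀⁻¹ fun ξ => by
      rw [norm_inv]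
      exact inv_anti₀ hc₀ (hmlow ξ)
  have hder : ∀ ξ, HasDerivAt c (-deriv m ξ / m ξ ^ 2) ξ := fun ξ =>
    (hmd ξ).hasDerivAt.inv (hm0 ξ)
  refine ⟨b, c, ⟨fun ξ => (hder ξ).differentiableAt, B * (c₀ ^ 2)⁻¹, fun ξ => ?_⟩, ?_, ?_⟩
  · rw [(hder ξ).deriv, norm_div, norm_neg, norm_pow, div_eq_mul_inv, mul_right_comm]
    have hp := hc₀.trans_le (hmlow ξ)
    exact mul_le_mul (hB ξ) (inv_anti₀ (by positivity) (pow_le_pow_left₀ hc₀.le (hmlow ξ) 2))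
      (by positivity) (mul_nonneg hB0 (beta_pos _ _).le)
  · ext ξ
    exact mul_inv_cancel₀ (hm0 ξ)
  · intro f h
    obtain ⟨k1, k2⟩ := he.frame_formula hα0 hα1 (by linarith) f h
    refine ⟨k1, ?_⟩
    rw [k2, ip_fmul]
    rfl

/-! ### Dual pairs from the frame operator -/

/-- `(d, e)` is a pair of dual families: `f = ∫ ⟨f, d(y)⟩ e(y) dy` weakly. -/
def IsDualPair (d e : X → L2) : Prop :=
  ∀ f h : L2, Integrable (fun y : X => ip f (d y) * ip (e y) h) ∧
    ip f h = ∫ y : X, ip f (d y) * ip (e y) h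

lemma IsFrameOperator.symm {ψ : L2} {A : L2 →L[ℂ] L2} (hA : IsFrameOperator α ψ A) (f h : L2) :
    ip (A f) h = ip f (A h) := by
  rw [← ip_conj (A h) f, (hA f h).2, (hA h f).2, ← integral_conj]
  refine integral_congr_ae (Filter.Eventually.of_forall fun z => ?_)
  simp only [map_mul, ip_conj]
  ring

/-- Symmetry of `A` passes to its inverse `B`. Inserting `B f`, respectively `B h`, into the weak
formula for `A` gives the two expansions. -/
lemma IsFrameOperator.isDualPair {ψ : L2} {A B : L2 →L[ℂ] L2} (hA : IsFrameOperator α ψ A)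
    (hAB : A * B = 1) :
    IsDualPair (fun z => B (atom α ψ z)) (atom α ψ) ∧
      IsDualPair (atom α ψ) (fun z => B (atom α ψ z)) := by
  have hAB' : ∀ f, A (B f) = f := fun f => by
    rw [← mul_apply_eq_comp, hAB]; rfl
  have hB : ∀ f h, ip f (B h) = ip (B f) h := fun f h => by
    have := hA.symm (B f) (B h)
    rwa [hAB', hAB'] at this
  refine ⟨fun f h => ?_, fun f h => ?_⟩
  · have := hA (B f) h
    simp only [← hB, hAB'] at this
    exact this
  · have := hA f (B h)
    rw [hA.symm, hAB'] at this
    simp only [hB] at this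
    exact this

/-- The structure of the frame operator and of the dual frame. -/
theorem FourierDecay.admissible (hα0 : 0 ≤ α) (hα1 : α < 1) {r : ℝ}
    (hr : 1 + 2 * (α / (1 - α)) < r) {ψ : L2} (hψ0 : ψ ≠ 0) (hψ : FourierDecay r ψ) :
    Admissible α ψ ∧ (∃ c, IsSymbol α c ∧ frameInv α ψ = fmul c) ∧
      IsDualPair (dualAtom α ψ) (atom α ψ) ∧ IsDualPair (atom α ψ) (dualAtom α ψ) := by
  obtain ⟨b, c, hc, hbc, hA⟩ := hψ.exists_symbol hα0 hα1 hr hψ0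
  have h1 : fmul b * fmul c = 1 := by rw [fmul_mul, hbc, fmul_one]
  have h2 : fmul c * fmul b = 1 := by rw [fmul_mul, mul_comm, hbc, fmul_one]
  have hu : IsUnit (fmul b) := ⟨⟨fmul b, fmul c, h1, h2⟩, rfl⟩
  have hinv : frameInv α ψ = fmul c := by
    rw [frameInv, frameOp_eq hA]
    exact Ring.inverse_unit ⟨fmul b, fmul c, h1, h2⟩
  refine ⟨⟨hψ0, _, hA, hu⟩, ⟨c, hc, hinv⟩, ?_⟩
  have hd : dualAtom α ψ = fun z => fmul c (atom α ψ z) := by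
    ext1 z; rw [dualAtom, hinv]
  rw [hd]
  exact hA.isDualPair h1

end AlphaMod

namespace AlphaMod

/-! ### Extension of functionals and measurability of `L¹`-valued maps -/

/-- Hahn-Banach: a functional dominated by `u ↦ ‖J u‖` factors through `J`. -/
lemma exists_continuousLinearMap_comp_eq {E L : Type*} [AddCommGroup E] [Module ℂ E]
    [NormedAddCommGroup L] [NormedSpace ℂ L] (J : E →ₗ[ℂ] L) (f : E →ₗ[ℂ] ℂ) {C : ℝ}
    (h : ∀ u, ‖f u‖ ≤ C * ‖J u‖) : ∃ Φ : L →L[ℂ] ℂ, ∀ u, Φ (J u) = f u := by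
  -- `J` need not be injective. The domination makes `f` vanish on its kernel, so the choice of
  -- preimage is immaterial.
  obtain ⟨g, hg⟩ := LinearMap.exists_rightInverse_of_surjective J.rangeRestrict
    J.range_rangeRestrict
  have hJg : ∀ y : LinearMap.range J, J (g y) = y := fun y =>
    congrArg Subtype.val (LinearMap.congr_fun hg y)
  obtain ⟨Φ, hΦ, -⟩ := exists_extension_norm_eq (LinearMap.range J)
    ((f ∘ₗ g).mkContinuous C fun y => by
      have := h (g y)
      rwa [hJg] at this)
  refine ⟨Φ, fun u => ?_⟩
  have h1 := hΦ (J.rangeRestrict u)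
  have h2 : f (g (J.rangeRestrict u) - u) = 0 := by
    have h3 := h (g (J.rangeRestrict u) - u)
    rw [map_sub J, hJg] at h3
    simpa using h3
  rw [map_sub, sub_eq_zero] at h2
  exact h1.trans h2

/-- By second countability the balls generate the Borel sets. For maps into `L¹` this reduces
measurability to that of distances, which are integrals depending on a parameter. -/
lemma measurable_of_measurable_edist {Y E : Type*} [MeasurableSpace Y] [PseudoEMetricSpace E]
    [SecondCountableTopology E] [MeasurableSpace E] [BorelSpace E] {f : Y → E}
    (h : ∀ c, Measurable fun y => edist (f y) c) : Measurable f := by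
  have hb : TopologicalSpace.IsTopologicalBasis
      {s : Set E | ∃ c ε, s = Metric.eball c ε} := by
    refine TopologicalSpace.isTopologicalBasis_of_isOpen_of_nhds ?_ ?_
    · rintro _ ⟨c, ε, rfl⟩
      exact Metric.isOpen_eball
    · intro a u ha hu
      obtain ⟨ε, hε, hs⟩ := EMetric.isOpen_iff.1 hu a ha
      exact ⟨_, ⟨a, ε, rfl⟩, Metric.mem_eball_self hε, hs⟩
  rw [‹BorelSpace E›.measurable_eq, hb.borel_eq_generateFrom]
  refine measurable_generateFrom ?_
  rintro _ ⟨c, ε, rfl⟩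
  exact measurableSet_lt (h c) measurable_const

/-- A jointly measurable kernel with integrable sections gives a measurable map into `L¹`. -/
lemma stronglyMeasurable_toLp_one {Y : Type*} [MeasurableSpace Y] {K : Y → X → ℂ}
    (hK : StronglyMeasurable fun p : Y × X => K p.1 p.2)
    (hm : ∀ y, MemLp (K y) 1 volume) :
    StronglyMeasurable fun y => (hm y).toLp (K y) := by
  let _ : MeasurableSpace (Lp ℂ 1 (volume : Measure X)) := borel _
  have : BorelSpace (Lp ℂ 1 (volume : Measure X)) := ⟨rfl⟩
  have : Fact ((1 : ℝ≥0∞) ≠ ∞) := ⟨ENNReal.one_ne_top⟩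
  refine Measurable.stronglyMeasurable (measurable_of_measurable_edist fun c => ?_)
  have hc := Lp.stronglyMeasurable c
  have e : ∀ y, edist ((hm y).toLp (K y)) c = ∫⁻ z, ‖K y z - c z‖ₑ := fun y => by
    rw [Lp.edist_def, eLpNorm_one_eq_lintegral_enorm]
    refine lintegral_congr_ae ?_
    filter_upwards [(hm y).coeFn_toLp] with z hz
    simp [hz]
  simp only [e]
  exact Measurable.lintegral_prod_right
    (f := fun (y : Y) (z : X) => ‖K y z - c z‖ₑ)
    (hK.sub (hc.comp_measurable measurable_snd)).measurable.enorm

/-! ### The Schur test -/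

/-- Jensen's inequality for the measure `k dμ`, whose total mass is at most `M`. -/
lemma lintegral_mul_rpow_le {Y : Type*} [MeasurableSpace Y] {μ : Measure Y} {k F : Y → ℝ≥0∞}
    (hk : Measurable k) (hF : Measurable F) {M : ℝ≥0∞} (hM : ∫⁻ y, k y ∂μ ≤ M) {q : ℝ}
    (hq : 1 ≤ q) :
    (∫⁻ y, k y * F y ∂μ) ^ q ≤ M ^ (q - 1) * ∫⁻ y, k y * F y ^ q ∂μ := by
  have hq0 : 0 < q := by linarith
  have h := eLpNorm_le_eLpNorm_mul_rpow_measure_univ (μ := μ.withDensity k) (f := F)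
    (p := 1) (q := ENNReal.ofReal q) (by simpa using hq) hF.aestronglyMeasurable
  rw [eLpNorm_one_eq_lintegral_enorm, eLpNorm_eq_lintegral_rpow_enorm_toReal
    (by simpa using hq0) ENNReal.ofReal_ne_top, ENNReal.toReal_ofReal hq0.le] at h
  simp only [enorm_eq_self, ENNReal.toReal_one] at h
  rw [lintegral_withDensity_eq_lintegral_mul _ hk hF,
    lintegral_withDensity_eq_lintegral_mul _ hk (hF.pow_const q),
    withDensity_apply _ MeasurableSet.univ, setLIntegral_univ] at h
  have h2 := ENNReal.rpow_le_rpow h hq0.le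
  rw [ENNReal.mul_rpow_of_nonneg _ _ hq0.le, ← ENNReal.rpow_mul, ← ENNReal.rpow_mul,
    one_div_mul_cancel hq0.ne', ENNReal.rpow_one,
    show (1 / 1 - 1 / q) * q = q - 1 by field_simp] at h2
  refine h2.trans ?_
  rw [mul_comm]
  exact mul_le_mul_left (ENNReal.rpow_le_rpow hM (by linarith)) _

/-- Schur's test on `L^p`, `1 ≤ p ≤ ∞`, for positive kernels. -/
theorem eLpNorm_lintegral_le {Y Z : Type*} [MeasurableSpace Y] [MeasurableSpace Z]
    {μ : Measure Y} {ν : Measure Z} [SFinite μ] [SFinite ν] {k : Y → Z → ℝ≥0∞}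
    (hk : Measurable fun p : Y × Z => k p.1 p.2) {M : ℝ≥0∞} (hMt : M ≠ ∞)
    (h1 : ∀ z, ∫⁻ y, k y z ∂μ ≤ M) (h2 : ∀ y, ∫⁻ z, k y z ∂ν ≤ M)
    {F : Y → ℝ≥0∞} (hF : Measurable F) {p : ℝ≥0∞} (hp : 1 ≤ p) :
    eLpNorm (fun z => ∫⁻ y, k y z * F y ∂μ) p ν ≤ M * eLpNorm F p μ := by
  have hkz : ∀ z, Measurable fun y => k y z := fun z =>
    hk.comp (measurable_id.prodMk measurable_const)
  by_cases hpt : p = ∞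
  · subst hpt
    simp only [eLpNorm_exponent_top]
    refine eLpNormEssSup_le_of_ae_enorm_bound (Filter.Eventually.of_forall fun z => ?_)
    rw [enorm_eq_self]
    calc ∫⁻ y, k y z * F y ∂μ ≤ ∫⁻ y, k y z * eLpNormEssSup F μ ∂μ := by
          refine lintegral_mono_ae ?_
          filter_upwards [enorm_ae_le_eLpNormEssSup F μ] with y hy
          rw [enorm_eq_self] at hy
          gcongr
      _ = (∫⁻ y, k y z ∂μ) * eLpNormEssSup F μ := lintegral_mul_const _ (hkz z)
      _ ≤ M * eLpNormEssSup F μ := by gcongr; exact h1 z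
  have hp0 : p ≠ 0 := (zero_lt_one.trans_le hp).ne'
  have hq : 1 ≤ p.toReal := by
    rw [← ENNReal.toReal_one]
    exact ENNReal.toReal_mono hpt hp
  set q := p.toReal with hqdef
  have hq0 : 0 < q := by linarith
  rw [eLpNorm_eq_lintegral_rpow_enorm_toReal hp0 hpt, eLpNorm_eq_lintegral_rpow_enorm_toReal hp0 hpt,
    ← hqdef]
  simp only [enorm_eq_self]
  calc (∫⁻ z, (∫⁻ y, k y z * F y ∂μ) ^ q ∂ν) ^ (1 / q)
      ≤ (∫⁻ z, M ^ (q - 1) * ∫⁻ y, k y z * F y ^ q ∂μ ∂ν) ^ (1 / q) := by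
        gcongr with z
        exact lintegral_mul_rpow_le (hkz z) hF (h1 z) hq
    _ = (M ^ (q - 1) * ∫⁻ y, (∫⁻ z, k y z ∂ν) * F y ^ q ∂μ) ^ (1 / q) := by
        rw [lintegral_const_mul' _ _ (ENNReal.rpow_ne_top_of_nonneg (by linarith) hMt),
          lintegral_lintegral_swap]
        · congr 2
          refine lintegral_congr fun y => ?_
          exact lintegral_mul_const _ (hk.comp (measurable_const.prodMk measurable_id))
        · exact ((hk.comp measurable_swap).mul
            ((hF.pow_const q).comp measurable_snd)).aemeasurable
    _ ≤ (M ^ (q - 1) * ∫⁻ y, M * F y ^ q ∂μ) ^ (1 / q) := by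
        gcongr with y
        exact h2 y
    _ = M * (∫⁻ y, F y ^ q ∂μ) ^ (1 / q) := by
        rw [lintegral_const_mul' _ _ hMt, ← mul_assoc, ENNReal.mul_rpow_of_nonneg _ _ (by positivity)]
        congr 1
        have : M ^ (q - 1) * M = M ^ q := by
          nth_rw 2 [← ENNReal.rpow_one M]
          rw [← ENNReal.rpow_add_of_nonneg _ _ (by linarith) zero_le_one, sub_add_cancel]
        rw [this, ← ENNReal.rpow_mul, mul_one_div_cancel hq0.ne', ENNReal.rpow_one]

end AlphaMod

namespace AlphaMod

/-! ### Kernels bounded on weighted spaces -/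

/-- The cross kernel of `a` and `b` is bounded on the weighted `L^p` spaces by Schur's test. -/
structure KernelBound (v : X → ℝ) (M : ℝ≥0) (a b : X → L2) : Prop where
  meas : StronglyMeasurable fun p : X × X => ip (a p.1) (b p.2)
  left : ∀ z', ∫⁻ z, ‖ip (a z) (b z')‖ₑ * ENNReal.ofReal (ratioWeight v z z') ≤ M
  right : ∀ z, ∫⁻ z', ‖ip (a z) (b z')‖ₑ * ENNReal.ofReal (ratioWeight v z z') ≤ M

lemma enorm_ip_comm (f g : L2) : ‖ip f g‖ₑ = ‖ip g f‖ₑ := by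
  rw [← ip_conj f g, RCLike.enorm_conj]

/-- Both `|⟨a(z), b(z')⟩|` and the weight are symmetric, so the second Schur bound is the first one
with the families exchanged. -/
lemma IsMoleculeFamily.exists_kernelBound {α s t : ℝ} (hα0 : 0 ≤ α) (hα1 : α < 1) (hs : 0 ≤ s)
    (ht : 1 + s / (1 - α) + α / (1 - α) < t) {a b : X → L2} (ha : IsMoleculeFamily α t a)
    (hb : IsMoleculeFamily α t b) : ∃ M, KernelBound (polyWeight s) M a b := by
  obtain ⟨C, P, ha⟩ := ha
  obtain ⟨C', P', hb⟩ := hb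
  set M : ℝ≥0∞ := ENNReal.ofReal (2 * (kerConst α t * (C * C'))) *
    (ENNReal.ofReal (1 / (1 - α)) * decayInt (t - s / (1 - α) - α / (1 - α))) with hM
  have hMt : M ≠ ∞ := (ENNReal.mul_lt_top ENNReal.ofReal_lt_top
    (ENNReal.mul_lt_top ENNReal.ofReal_lt_top (decayInt_lt_top (by linarith)))).ne
  refine ⟨M.toNNReal, ha.measurable_kernel hb, fun z' => ?_, fun z => ?_⟩
  · rw [ENNReal.coe_toNNReal hMt]
    exact ha.lintegral_kernel_le hα0 hα1 hs ht hb z'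
  · rw [ENNReal.coe_toNNReal hMt, hM, mul_comm C C']
    simp only [enorm_ip_comm (a z), ratioWeight_comm _ z]
    exact hb.lintegral_kernel_le hα0 hα1 hs ht ha z

lemma weight_le_ratioWeight_mul {v : X → ℝ} (hv : ∀ z, 0 < v z) (y z : X) :
    v z ≤ ratioWeight v y z * v y := by
  rw [← div_le_iff₀ (hv y)]
  exact le_max_right _ _

lemma enorm_mul_weight {v : X → ℝ} (hv : ∀ z, 0 < v z) (c : ℂ) (z : X) :
    ‖c * (v z : ℂ)‖ₑ = ‖c‖ₑ * ENNReal.ofReal (v z) := by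
  rw [enorm_mul, ← ofReal_norm (v z : ℂ), Complex.norm_real, Real.norm_of_nonneg (hv z).le]

lemma measurable_ratioWeight {v : X → ℝ} (hvm : Measurable v) :
    Measurable fun p : X × X => ratioWeight v p.1 p.2 := by
  have h1 : Measurable fun p : X × X => v p.1 := hvm.comp measurable_fst
  have h2 : Measurable fun p : X × X => v p.2 := hvm.comp measurable_snd
  exact (h1.div h2).max (h2.div h1)

/-- The integral operator with kernel `⟨a(y), b(z)⟩` is bounded on all weighted spaces. -/
theorem KernelBound.wNorm_integral_le {v : X → ℝ} (hvm : Measurable v) (hv : ∀ z, 0 < v z)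
    {M : ℝ≥0} {a b : X → L2} (hab : KernelBound v M a b) {Φ : X → ℂ} (hΦ : StronglyMeasurable Φ)
    {p : ℝ≥0∞} (hp : 1 ≤ p) :
    wNorm p v (fun z => ∫ y, Φ y * ip (a y) (b z)) ≤ M * wNorm p v Φ := by
  have hF : Measurable fun y => ‖Φ y * (v y : ℂ)‖ₑ :=
    (hΦ.measurable.mul (Complex.measurable_ofReal.comp hvm)).enorm
  have hk : Measurable fun p : X × X => ‖ip (a p.1) (b p.2)‖ₑ *
      ENNReal.ofReal (ratioWeight v p.1 p.2) :=
    hab.meas.measurable.enorm.mul (measurable_ratioWeight hvm).ennreal_ofReal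
  have hS := eLpNorm_lintegral_le (μ := (volume : Measure X)) (ν := (volume : Measure X))
    (k := fun y z => ‖ip (a y) (b z)‖ₑ * ENNReal.ofReal (ratioWeight v y z)) hk
    ENNReal.coe_ne_top hab.left hab.right hF hp
  rw [eLpNorm_enorm] at hS
  refine (eLpNorm_mono_enorm fun z => ?_).trans hS
  rw [enorm_eq_self, enorm_mul_weight hv]
  calc ‖∫ y, Φ y * ip (a y) (b z)‖ₑ * ENNReal.ofReal (v z)
      ≤ (∫⁻ y, ‖Φ y * ip (a y) (b z)‖ₑ) * ENNReal.ofReal (v z) := by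
        gcongr
        exact enorm_integral_le_lintegral_enorm _
    _ = ∫⁻ y, ‖Φ y * ip (a y) (b z)‖ₑ * ENNReal.ofReal (v z) :=
        (lintegral_mul_const' _ _ ENNReal.ofReal_ne_top).symm
    _ ≤ _ := by
        refine lintegral_mono fun y => ?_
        simp only
        rw [enorm_mul_weight hv, enorm_mul]
        have h0 : 0 ≤ ratioWeight v y z :=
          le_max_of_le_left (div_nonneg (hv y).le (hv z).le)
        calc ‖Φ y‖ₑ * ‖ip (a y) (b z)‖ₑ * ENNReal.ofReal (v z)
            ≤ ‖Φ y‖ₑ * ‖ip (a y) (b z)‖ₑ * ENNReal.ofReal (ratioWeight v y z * v y) := by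
              gcongr
              exact weight_le_ratioWeight_mul hv y z
          _ = _ := by
              rw [ENNReal.ofReal_mul h0]
              ring

lemma KernelBound.stronglyMeasurable_integral {v : X → ℝ} {M : ℝ≥0} {a b : X → L2}
    (hab : KernelBound v M a b) {Φ : X → ℂ} (hΦ : StronglyMeasurable Φ) :
    StronglyMeasurable fun z => ∫ y, Φ y * ip (a y) (b z) := by
  refine StronglyMeasurable.integral_prod_left (μ := (volume : Measure X))
    (f := fun (y : X) (z : X) => Φ y * ip (a y) (b z)) ?_
  exact (hΦ.comp_measurable measurable_fst).mul hab.meas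

lemma stronglyMeasurable_mul_weight {v : X → ℝ} (hvm : Measurable v) {Φ : X → ℂ}
    (hΦ : StronglyMeasurable Φ) : StronglyMeasurable fun z => Φ z * (v z : ℂ) :=
  hΦ.mul (Complex.measurable_ofReal.comp hvm).stronglyMeasurable

lemma KernelBound.memLpv_integral {v : X → ℝ} (hvm : Measurable v) (hv : ∀ z, 0 < v z)
    {M : ℝ≥0} {a b : X → L2} (hab : KernelBound v M a b) {Φ : X → ℂ} (hΦ : StronglyMeasurable Φ)
    {p : ℝ≥0∞} (hp : 1 ≤ p) (h : MemLpv p v Φ) :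
    MemLpv p v (fun z => ∫ y, Φ y * ip (a y) (b z)) :=
  ⟨(stronglyMeasurable_mul_weight hvm (hab.stronglyMeasurable_integral hΦ)).aestronglyMeasurable,
    (hab.wNorm_integral_le hvm hv hΦ hp).trans_lt (ENNReal.mul_lt_top ENNReal.coe_lt_top h.2)⟩

/-- The vectors `a(z)` belong to the reservoir of `b`, with norm at most `M v(z)`. -/
lemma KernelBound.wNorm_one_le {v : X → ℝ} (hv : ∀ z, 0 < v z)
    {M : ℝ≥0} {a b : X → L2} (hab : KernelBound v M a b) (z : X) :
    wNorm 1 v (fun y => ip (a z) (b y)) ≤ M * ENNReal.ofReal (v z) := by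
  rw [wNorm, eLpNorm_one_eq_lintegral_enorm]
  calc ∫⁻ y, ‖ip (a z) (b y) * (v y : ℂ)‖ₑ
      ≤ ∫⁻ y, ‖ip (a z) (b y)‖ₑ * ENNReal.ofReal (ratioWeight v z y) * ENNReal.ofReal (v z) := by
        refine lintegral_mono fun y => ?_
        simp only
        have h0 : 0 ≤ ratioWeight v z y :=
          le_max_of_le_left (div_nonneg (hv z).le (hv y).le)
        rw [enorm_mul_weight hv, mul_assoc, ← ENNReal.ofReal_mul h0]
        gcongr
        exact weight_le_ratioWeight_mul hv z y
    _ ≤ M * ENNReal.ofReal (v z) := by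
        rw [lintegral_mul_const' _ _ ENNReal.ofReal_ne_top]
        gcongr
        exact hab.right z

lemma KernelBound.mem_reservoir {v : X → ℝ} (hvm : Measurable v) (hv : ∀ z, 0 < v z)
    {M : ℝ≥0} {a b : X → L2} (hab : KernelBound v M a b) (z : X) : a z ∈ reservoir v b := by
  refine ⟨(stronglyMeasurable_mul_weight hvm ?_).aestronglyMeasurable,
    (hab.wNorm_one_le hv z).trans_lt (ENNReal.mul_lt_top ENNReal.coe_lt_top ENNReal.ofReal_lt_top)⟩
  exact hab.meas.comp_measurable (measurable_const.prodMk measurable_id)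

/-! ### Comparison of reservoirs -/

/-- Testing the expansion of `f` against `e' z` displays one voice transform as the integral
operator with kernel `⟨e(y), e'(z)⟩` applied to the other. -/
lemma IsDualPair.wNorm_le {v : X → ℝ} (hvm : Measurable v) (hv : ∀ z, 0 < v z) {M : ℝ≥0}
    {d e e' : X → L2} (hde : IsDualPair d e) (hk : KernelBound v M e e') (f : L2)
    (hf : StronglyMeasurable fun z => ip f (d z)) :
    wNorm 1 v (fun z => ip f (e' z)) ≤ M * wNorm 1 v (fun z => ip f (d z)) := by
  have h := hk.wNorm_integral_le hvm hv hf le_rfl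
  simpa only [← (hde f _).2] using h

lemma IsDualPair.reservoir_le {v : X → ℝ} (hvm : Measurable v) (hv : ∀ z, 0 < v z) {M : ℝ≥0}
    {d e e' : X → L2} (hde : IsDualPair d e) (hk : KernelBound v M e e')
    (hd : ∀ f, StronglyMeasurable fun z => ip f (d z)) : reservoir v d ≤ reservoir v e' := by
  intro f hf
  have h := hk.memLpv_integral hvm hv (hd f) le_rfl hf
  simp only [← (hde f _).2] at h
  exact h

/-! ### Functionals on reservoirs -/

lemma memLp_of_reservoir {v : X → ℝ} {e : X → L2} (u : reservoir v e) :
    MemLp (fun z => ip (u : L2) (e z) * (v z : ℂ)) 1 volume := u.2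

/-- The embedding of the reservoir of `e` into `L¹`. -/
noncomputable def reservoirToL1 (v : X → ℝ) (e : X → L2) :
    reservoir v e →ₗ[ℂ] Lp ℂ 1 (volume : Measure X) where
  toFun u := (memLp_of_reservoir u).toLp _
  map_add' f g := by
    rw [← MemLp.toLp_add]
    refine MemLp.toLp_congr _ _ (Filter.Eventually.of_forall fun z => ?_)
    simp only [Pi.add_apply, ip, Submodule.coe_add, inner_add_right]
    ring
  map_smul' c f := by
    rw [RingHom.id_apply, ← MemLp.toLp_const_smul]
    refine MemLp.toLp_congr _ _ (Filter.Eventually.of_forall fun z => ?_)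
    simp only [Pi.smul_apply, ip, Submodule.coe_smul, inner_smul_right, smul_eq_mul]
    ring

lemma norm_reservoirToL1 (v : X → ℝ) (e : X → L2) (u : reservoir v e) :
    ‖reservoirToL1 v e u‖ = (wNorm 1 v fun z => ip (u : L2) (e z)).toReal :=
  Lp.norm_toLp _ u.2

lemma reservoirToL1_ae (v : X → ℝ) (e : X → L2) (u : reservoir v e) :
    ⇑(reservoirToL1 v e u) =ᵐ[volume] fun z => ip (u : L2) (e z) * (v z : ℂ) :=
  MemLp.coeFn_toLp u.2

/-- Integration over a set as a functional on `L¹`. -/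
noncomputable def setIntegralL1 (S : Set X) : Lp ℂ 1 (volume : Measure X) →L[ℂ] ℂ where
  toFun f := ∫ x in S, f x
  map_add' f g := by
    have h : ∀ f : Lp ℂ 1 (volume : Measure X), Integrable f := fun f =>
      memLp_one_iff_integrable.1 (Lp.memLp f)
    rw [← integral_add (h f).integrableOn (h g).integrableOn]
    exact integral_congr_ae (ae_restrict_of_ae (Lp.coeFn_add f g))
  map_smul' c f := by
    rw [RingHom.id_apply, smul_eq_mul, ← integral_const_mul]
    exact integral_congr_ae (ae_restrict_of_ae (Lp.coeFn_smul c f))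
  cont := continuous_setIntegral S

/-- The weak expansion `u = ∫ ⟨u, d(y)⟩ e(y) dy` of elements of the reservoir of `e₀` converges in
the norm of the reservoir. -/
theorem IsDualPair.integral_reservoirToL1 {v : X → ℝ} (hvm : Measurable v) (hv : ∀ z, 0 < v z)
    {M : ℝ≥0} {d e e₀ : X → L2} (hde : IsDualPair d e) (hk : KernelBound v M e e₀)
    (u : reservoir v e₀) (hu : MemLpv 1 v fun z => ip (u : L2) (d z))
    (hum : StronglyMeasurable fun z => ip (u : L2) (d z)) :
    Integrable (fun y => ip (u : L2) (d y) •
      reservoirToL1 v e₀ ⟨e y, hk.mem_reservoir hvm hv y⟩) ∧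
    ∫ y, ip (u : L2) (d y) • reservoirToL1 v e₀ ⟨e y, hk.mem_reservoir hvm hv y⟩ =
      reservoirToL1 v e₀ u := by
  set k : X → Lp ℂ 1 (volume : Measure X) :=
    fun y => reservoirToL1 v e₀ ⟨e y, hk.mem_reservoir hvm hv y⟩ with hkdef
  set c : X → ℂ := fun y => ip (u : L2) (d y) with hc
  have hKm : StronglyMeasurable fun p : X × X => ip (e p.1) (e₀ p.2) * (v p.2 : ℂ) :=
    hk.meas.mul ((Complex.measurable_ofReal.comp hvm).comp measurable_snd).stronglyMeasurable
  have hkm : StronglyMeasurable k :=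
    stronglyMeasurable_toLp_one (K := fun y z => ip (e y) (e₀ z) * (v z : ℂ)) hKm
      fun y => hk.mem_reservoir hvm hv y
  have hfin : (∫⁻ y, ‖c y * (v y : ℂ)‖ₑ) < ∞ := by
    have := hu.2
    rwa [eLpNorm_one_eq_lintegral_enorm] at this
  have hcv : ∀ y, ‖c y‖ₑ * (M * ENNReal.ofReal (v y)) = M * ‖c y * (v y : ℂ)‖ₑ := fun y => by
    rw [enorm_mul_weight hv]; ring
  have hknorm : ∀ y, ‖k y‖ₑ ≤ M * ENNReal.ofReal (v y) := fun y => by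
    refine le_trans (le_of_eq ?_) (hk.wNorm_one_le hv y)
    rw [← ofReal_norm, hkdef, norm_reservoirToL1, ENNReal.ofReal_toReal]
    exact (hk.mem_reservoir hvm hv y).2.ne
  -- The vector `e y` has reservoir norm at most `M v(y)`, while `c v` is integrable; this gives
  -- absolute convergence in `L¹`.
  have hint : Integrable (fun y => c y • k y) := by
    refine ⟨(hum.smul hkm).aestronglyMeasurable, ?_⟩
    calc ∫⁻ y, ‖c y • k y‖ₑ ≤ ∫⁻ y, M * ‖c y * (v y : ℂ)‖ₑ := by
          refine lintegral_mono fun y => ?_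
          rw [enorm_smul, ← hcv]
          gcongr
          exact hknorm y
      _ < ∞ := by
          rw [lintegral_const_mul' _ _ ENNReal.coe_ne_top]
          exact ENNReal.mul_lt_top ENNReal.coe_lt_top hfin
  refine ⟨hint, Lp.ext ?_⟩
  have hL1 : ∀ f : Lp ℂ 1 (volume : Measure X), Integrable f := fun f =>
      memLp_one_iff_integrable.1 (Lp.memLp f)
  -- Equality in `L¹` is tested by integrals over sets `S`. These are continuous functionals and
  -- commute with the Bochner integral, so a scalar Fubini argument remains.
  refine Integrable.ae_eq_of_forall_setIntegral_eq _ _ (hL1 _) (hL1 _) fun S hS _ => ?_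
  change setIntegralL1 S (∫ y, c y • k y) = setIntegralL1 S (reservoirToL1 v e₀ u)
  rw [← ContinuousLinearMap.integral_comp_comm _ hint]
  have h1 : ∀ w : reservoir v e₀, setIntegralL1 S (reservoirToL1 v e₀ w) =
      ∫ z in S, ip (w : L2) (e₀ z) * (v z : ℂ) := fun w =>
    integral_congr_ae (ae_restrict_of_ae (reservoirToL1_ae v e₀ w))
  simp only [map_smul, smul_eq_mul, hkdef, h1]
  have hprod : Integrable (Function.uncurry fun (y z : X) =>
      c y * (ip (e y) (e₀ z) * (v z : ℂ))) (volume.prod (volume.restrict S)) := by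
    have hm : StronglyMeasurable (Function.uncurry fun (y z : X) =>
        c y * (ip (e y) (e₀ z) * (v z : ℂ))) := (hum.comp_measurable measurable_fst).mul hKm
    refine ⟨hm.aestronglyMeasurable, ?_⟩
    rw [HasFiniteIntegral, lintegral_prod _ hm.measurable.enorm.aemeasurable]
    calc ∫⁻ y, ∫⁻ z in S, ‖c y * (ip (e y) (e₀ z) * (v z : ℂ))‖ₑ
        ≤ ∫⁻ y, M * ‖c y * (v y : ℂ)‖ₑ := by
          refine lintegral_mono fun y => ?_
          simp only [enorm_mul (c y)]
          rw [lintegral_const_mul' _ _ enorm_ne_top, ← enorm_mul (c y), ← hcv]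
          gcongr
          refine (setLIntegral_le_lintegral _ _).trans ?_
          have := hk.wNorm_one_le hv y
          rwa [wNorm, eLpNorm_one_eq_lintegral_enorm] at this
      _ < ∞ := by
          rw [lintegral_const_mul' _ _ ENNReal.coe_ne_top]
          exact ENNReal.mul_lt_top ENNReal.coe_lt_top hfin
  calc ∫ y, c y * ∫ z in S, ip (e y) (e₀ z) * (v z : ℂ)
      = ∫ y, ∫ z in S, c y * (ip (e y) (e₀ z) * (v z : ℂ)) := by
        simp only [integral_const_mul]
    _ = ∫ z in S, ∫ y, c y * (ip (e y) (e₀ z) * (v z : ℂ)) := integral_integral_swap hprod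
    _ = ∫ z in S, ip (u : L2) (e₀ z) * (v z : ℂ) := by
        refine integral_congr_ae (Filter.Eventually.of_forall fun z => ?_)
        simp only
        rw [(hde u (e₀ z)).2, ← integral_mul_const]
        simp only [hc, mul_assoc]

lemma AntiFunctional.pair_of_mem (F : AntiFunctional) {u : L2} (h : u ∈ F.domain) :
    F.pair u = F.toFun ⟨u, h⟩ := dif_pos h

/-- Bounded functionals on a reservoir are determined by their voice transform:
`F(u) = ∫ F(e(y)) ⟨d(y), u⟩ dy`. -/
theorem IsDualPair.pair_eq_integral {v : X → ℝ} (hvm : Measurable v) (hv : ∀ z, 0 < v z)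
    {M : ℝ≥0} {d e e₀ : X → L2} (hde : IsDualPair d e) (hk : KernelBound v M e e₀)
    (hd : ∀ f, StronglyMeasurable fun z => ip f (d z)) {F : AntiFunctional}
    (hF : F ∈ antiDual v e₀) :
    (StronglyMeasurable fun y => F.pair (e y)) ∧
      ∀ u ∈ reservoir v e₀, u ∈ reservoir v d →
        F.pair u = ∫ y, F.pair (e y) * ip (d y) u := by
  obtain ⟨D, T⟩ := F
  obtain ⟨hD, C, hC⟩ := hF
  simp only at hD hC
  subst hD
  -- Conjugation makes the functional linear, so that Hahn-Banach extends it to `Φ` on `L¹`. The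
  -- continuous `Φ` can then be moved inside the Bochner integral of the expansion.
  let f : reservoir v e₀ →ₗ[ℂ] ℂ :=
    { toFun := fun u => starRingEnd ℂ (T u)
      map_add' := fun u w => by simp
      map_smul' := fun c u => by simp }
  obtain ⟨Φ, hΦ⟩ := exists_continuousLinearMap_comp_eq (reservoirToL1 v e₀) f (C := C)
    (fun u => by
      rw [norm_reservoirToL1]
      change ‖starRingEnd ℂ (T u)‖ ≤ _
      rw [RCLike.norm_conj]
      exact hC u)
  have hpair : ∀ u (hu : u ∈ reservoir v e₀), AntiFunctional.pair ⟨reservoir v e₀, T⟩ u =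
      starRingEnd ℂ (Φ (reservoirToL1 v e₀ ⟨u, hu⟩)) := fun u hu => by
    rw [AntiFunctional.pair_of_mem _ hu, hΦ]
    exact (RCLike.conj_conj _).symm
  have hmem := hk.mem_reservoir hvm hv
  have hKm : StronglyMeasurable fun p : X × X => ip (e p.1) (e₀ p.2) * (v p.2 : ℂ) :=
    hk.meas.mul ((Complex.measurable_ofReal.comp hvm).comp measurable_snd).stronglyMeasurable
  have hkm : StronglyMeasurable fun y => reservoirToL1 v e₀ ⟨e y, hmem y⟩ :=
    stronglyMeasurable_toLp_one (K := fun y z => ip (e y) (e₀ z) * (v z : ℂ)) hKm hmem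
  refine ⟨?_, fun u hu hud => ?_⟩
  · simp only [fun y => hpair _ (hmem y)]
    exact (Complex.continuous_conj.comp Φ.continuous).comp_stronglyMeasurable hkm
  · obtain ⟨h1, h2⟩ := hde.integral_reservoirToL1 hvm hv hk ⟨u, hu⟩ hud (hd u)
    rw [hpair u hu, ← h2, ← ContinuousLinearMap.integral_comp_comm _ h1, ← integral_conj]
    refine integral_congr_ae (Filter.Eventually.of_forall fun y => ?_)
    simp only [map_smul, smul_eq_mul, map_mul, ip_conj]
    rw [hpair _ (hmem y), mul_comm]

end AlphaMod

namespace AlphaMod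

/-! ### Independence of the coorbit spaces of the analyzing family -/

/-- A family of molecules with a dual family of molecules. -/
def IsMoleculeFrame (α t : ℝ) (e : X → L2) : Prop :=
  IsMoleculeFamily α t e ∧ ∃ d, IsMoleculeFamily α t d ∧ IsDualPair d e ∧ IsDualPair e d

lemma IsMoleculeFamily.stronglyMeasurable_ip {α t : ℝ} {e : X → L2} (he : IsMoleculeFamily α t e)
    (f : L2) : StronglyMeasurable fun z => ip f (e z) := by
  obtain ⟨C, P, h⟩ := he
  exact h.measurable_ip f

lemma IsMoleculeFamily.mem_reservoir {α s t : ℝ} (hα0 : 0 ≤ α) (hα1 : α < 1) (hs : 0 ≤ s)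
    (ht : 1 + s / (1 - α) + α / (1 - α) < t) {e e' : X → L2}
    (he : IsMoleculeFamily α t e) (he' : IsMoleculeFamily α t e')
    (z : X) : e z ∈ reservoir (polyWeight s) e' := by
  obtain ⟨M, hM⟩ := he.exists_kernelBound hα0 hα1 hs ht he'
  exact hM.mem_reservoir (continuous_polyWeight s).measurable (polyWeight_pos s) z

lemma IsMoleculeFrame.exists_wNorm_le {α s t : ℝ} (hα0 : 0 ≤ α) (hα1 : α < 1) (hs : 0 ≤ s)
    (ht : 1 + s / (1 - α) + α / (1 - α) < t) {e e' : X → L2}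
    (he : IsMoleculeFrame α t e)
    (he' : IsMoleculeFamily α t e') : ∃ M : ℝ≥0, ∀ f,
      wNorm 1 (polyWeight s) (fun z => ip f (e' z)) ≤
        M * wNorm 1 (polyWeight s) (fun z => ip f (e z)) := by
  obtain ⟨hm, d, hd, -, hed⟩ := he
  obtain ⟨M, hM⟩ := hd.exists_kernelBound hα0 hα1 hs ht he'
  exact ⟨M, fun f => hed.wNorm_le (continuous_polyWeight s).measurable (polyWeight_pos s) hM f
    (hm.stronglyMeasurable_ip f)⟩

lemma IsMoleculeFrame.reservoir_le {α s t : ℝ} (hα0 : 0 ≤ α) (hα1 : α < 1) (hs : 0 ≤ s)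
    (ht : 1 + s / (1 - α) + α / (1 - α) < t) {e e' : X → L2}
    (he : IsMoleculeFrame α t e)
    (he' : IsMoleculeFamily α t e') : reservoir (polyWeight s) e ≤ reservoir (polyWeight s) e' := by
  obtain ⟨hm, d, hd, -, hed⟩ := he
  obtain ⟨M, hM⟩ := hd.exists_kernelBound hα0 hα1 hs ht he'
  exact hed.reservoir_le (continuous_polyWeight s).measurable (polyWeight_pos s) hM
    hm.stronglyMeasurable_ip

lemma IsMoleculeFrame.reservoir_eq {α s t : ℝ} (hα0 : 0 ≤ α) (hα1 : α < 1) (hs : 0 ≤ s)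
    (ht : 1 + s / (1 - α) + α / (1 - α) < t) {e e' : X → L2}
    (he : IsMoleculeFrame α t e) (he' : IsMoleculeFrame α t e') :
    reservoir (polyWeight s) e = reservoir (polyWeight s) e' :=
  le_antisymm (he.reservoir_le hα0 hα1 hs ht he'.1) (he'.reservoir_le hα0 hα1 hs ht he.1)

lemma IsMoleculeFrame.antiDual_subset {α s t : ℝ} (hα0 : 0 ≤ α) (hα1 : α < 1) (hs : 0 ≤ s)
    (ht : 1 + s / (1 - α) + α / (1 - α) < t) {e e' : X → L2}
    (he : IsMoleculeFrame α t e)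
    (he' : IsMoleculeFrame α t e') :
    antiDual (polyWeight s) e ⊆ antiDual (polyWeight s) e' := by
  rintro F ⟨hD, C, hC⟩
  have hD' := hD.trans (he.reservoir_eq hα0 hα1 hs ht he')
  obtain ⟨M, hM⟩ := he'.exists_wNorm_le hα0 hα1 hs ht he.1
  -- The constant `C` of a bounded functional is not assumed nonnegative, hence `|C|`.
  refine ⟨hD', |C| * M, fun u => (hC u).trans ?_⟩
  have hu : (u : L2) ∈ reservoir (polyWeight s) e' := hD' ▸ u.2
  have hfin : wNorm 1 (polyWeight s) (fun z => ip (u : L2) (e' z)) ≠ ∞ := hu.2.ne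
  have h := ENNReal.toReal_mono (ENNReal.mul_ne_top ENNReal.coe_ne_top hfin) (hM u)
  rw [ENNReal.toReal_mul, ENNReal.coe_toReal] at h
  rw [mul_assoc]
  exact mul_le_mul (le_abs_self C) h ENNReal.toReal_nonneg (abs_nonneg C)

lemma IsMoleculeFrame.antiDual_eq {α s t : ℝ} (hα0 : 0 ≤ α) (hα1 : α < 1) (hs : 0 ≤ s)
    (ht : 1 + s / (1 - α) + α / (1 - α) < t) {e e' : X → L2}
    (he : IsMoleculeFrame α t e) (he' : IsMoleculeFrame α t e') :
    antiDual (polyWeight s) e = antiDual (polyWeight s) e' :=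
  Set.Subset.antisymm (he.antiDual_subset hα0 hα1 hs ht he')
    (he'.antiDual_subset hα0 hα1 hs ht he)

/-- The extended voice transforms with respect to two families are comparable. -/
theorem IsMoleculeFrame.exists_wNorm_pair_le {α s t : ℝ} (hα0 : 0 ≤ α) (hα1 : α < 1) (hs : 0 ≤ s)
    (ht : 1 + s / (1 - α) + α / (1 - α) < t) {e e' : X → L2}
    {e₀ : X → L2} (he₀ : IsMoleculeFrame α t e₀)
    (he : IsMoleculeFrame α t e) (he' : IsMoleculeFamily α t e') :
    ∃ M : ℝ≥0, ∀ F ∈ antiDual (polyWeight s) e₀, ∀ p : ℝ≥0∞, 1 ≤ p →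
      wNorm p (polyWeight s) (fun z => F.pair (e' z)) ≤
        M * wNorm p (polyWeight s) (fun z => F.pair (e z)) ∧
      (MemLpv p (polyWeight s) (fun z => F.pair (e z)) →
        MemLpv p (polyWeight s) (fun z => F.pair (e' z))) := by
  obtain ⟨hm, d, hd, hde, hed⟩ := he
  have hvm := (continuous_polyWeight s).measurable
  have hv := polyWeight_pos s
  obtain ⟨M, hM⟩ := hd.exists_kernelBound hα0 hα1 hs ht he'
  obtain ⟨M₀, hM₀⟩ := hm.exists_kernelBound hα0 hα1 hs ht he₀.1
  refine ⟨M, fun F hF p hp => ?_⟩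
  obtain ⟨h1, h2⟩ := hde.pair_eq_integral hvm hv hM₀ hd.stronglyMeasurable_ip hF
  -- Taking `u = e' z` in the reproducing formula writes the transform along `e'` as the operator
  -- with kernel `⟨d(y), e'(z)⟩` applied to the transform along `e`.
  have h3 : (fun z => F.pair (e' z)) = fun z => ∫ y, F.pair (e y) * ip (d y) (e' z) := by
    ext z
    exact h2 _ (he'.mem_reservoir hα0 hα1 hs ht he₀.1 z) (he'.mem_reservoir hα0 hα1 hs ht hd z)
  rw [h3]
  exact ⟨hM.wNorm_integral_le hvm hv h1 hp, hM.memLpv_integral hvm hv h1 hp⟩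

/-- Coorbit spaces defined through two pairs of families coincide, with equivalent norms. -/
theorem IsMoleculeFrame.coorbit_eq {α s t : ℝ} (hα0 : 0 ≤ α) (hα1 : α < 1) (hs : 0 ≤ s)
    (ht : 1 + s / (1 - α) + α / (1 - α) < t) {e e' : X → L2}
    {e₀ e₀' : X → L2} (he₀ : IsMoleculeFrame α t e₀)
    (he₀' : IsMoleculeFrame α t e₀') (he : IsMoleculeFrame α t e) (he' : IsMoleculeFrame α t e')
    {p : ℝ≥0∞} (hp : 1 ≤ p) :
    {F | F ∈ antiDual (polyWeight s) e₀ ∧ MemLpv p (polyWeight s) fun z => F.pair (e z)} =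
      {F | F ∈ antiDual (polyWeight s) e₀' ∧ MemLpv p (polyWeight s) fun z => F.pair (e' z)} ∧
    EquivNormsOn
      {F | F ∈ antiDual (polyWeight s) e₀ ∧ MemLpv p (polyWeight s) fun z => F.pair (e z)}
      (fun F => wNorm p (polyWeight s) fun z => F.pair (e z))
      (fun F => wNorm p (polyWeight s) fun z => F.pair (e' z)) := by
  obtain ⟨M, hM⟩ := he₀.exists_wNorm_pair_le hα0 hα1 hs ht he he'.1
  obtain ⟨M', hM'⟩ := he₀.exists_wNorm_pair_le hα0 hα1 hs ht he' he.1
  rw [← he₀.antiDual_eq hα0 hα1 hs ht he₀']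
  refine ⟨?_, max M M', fun F hF => ⟨?_, ?_⟩⟩
  · ext F
    exact ⟨fun h => ⟨h.1, (hM F h.1 p hp).2 h.2⟩, fun h => ⟨h.1, (hM' F h.1 p hp).2 h.2⟩⟩
  · refine (hM' F hF.1 p hp).1.trans ?_
    gcongr
    exact le_max_right _ _
  · refine (hM F hF.1 p hp).1.trans ?_
    gcongr
    exact le_max_left _ _

/-! ### Exponents and proof of the theorem -/

/-- The argument consumes 1 for integrability in the warped scale, `s/(1-α)` for the weight, and
`α/(1-α)` twice: for the multiplier and for comparing the values of `β` in the kernel. After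
clearing denominators the slack is `7α - 2α² + 2sα ≥ 0`. -/
lemma exponent_bound {α s r : ℝ} (hα0 : 0 ≤ α) (hα1 : α < 1) (hs : 0 ≤ s)
    (hr : (2 + 2 * s + 7 * α - 4 * α ^ 2) / (2 * (1 - α) ^ 2) < r) :
    1 + s / (1 - α) + 2 * (α / (1 - α)) < r := by
  refine lt_of_le_of_lt ?_ hr
  have ha : 0 < 1 - α := by linarith
  rw [le_div_iff₀ (by positivity)]
  have e : (1 + s / (1 - α) + 2 * (α / (1 - α))) * (2 * (1 - α) ^ 2) =
      2 * (1 - α) * ((1 - α) + s + 2 * α) := by field_simp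
  rw [e]
  nlinarith [mul_nonneg hα0 hs, mul_nonneg hα0 ha.le]

lemma FourierDecay.isMoleculeFrame {α r : ℝ} (hα0 : 0 ≤ α) (hα1 : α < 1)
    (hr : 1 + 2 * (α / (1 - α)) < r) {ψ : L2} (hψ0 : ψ ≠ 0) (hψ : FourierDecay r ψ) :
    IsMoleculeFrame α (r - α / (1 - α)) (atom α ψ) ∧
      IsMoleculeFrame α (r - α / (1 - α)) (dualAtom α ψ) := by
  have hρ : 0 ≤ α / (1 - α) := div_nonneg hα0 (by linarith)
  obtain ⟨-, ⟨c, hc, hinv⟩, hd1, hd2⟩ := hψ.admissible hα0 hα1 hr hψ0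
  have h1 : IsMoleculeFamily α (r - α / (1 - α)) (atom α ψ) := by
    have := hψ.isMoleculeFamily hα0 hα1 (by linarith) isSymbol_one
    rw [fmul_one] at this
    exact this
  have h2 : IsMoleculeFamily α (r - α / (1 - α)) (dualAtom α ψ) := by
    have := hψ.isMoleculeFamily hα0 hα1 (by linarith) hc
    rwa [← hinv] at this
  exact ⟨⟨h1, _, h2, hd1, hd2⟩, ⟨h2, _, h1, hd2, hd1⟩⟩

end AlphaMod

theorem theorem5p1 (α : ℝ) (hα0 : 0 ≤ α) (hα1 : α < 1) (s : ℝ) (hs : 0 ≤ s) (r : ℝ)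
    (hr : (2 + 2 * s + 7 * α - 4 * α ^ 2) / (2 * (1 - α) ^ 2) < r)
    (ψ φ : L2) (hψ0 : ψ ≠ 0) (hψ : FourierDecay r ψ) (hφ : FourierDecay r φ) :
    -- `A_σ` is bounded and boundedly invertible, so that the kernels are defined
    Admissible α ψ ∧
    -- integrability of the kernels
    (∀ κ : ℕ, κ ≤ 2 →
      (⨆ z' : X, ∫⁻ z : X,
        ‖kernelK α κ ψ φ z z'‖ₑ * ENNReal.ofReal (ratioWeight (polyWeight s) z z')) < ∞) ∧
    -- the fundamental condition; the extended transforms are defined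
    FundamentalCondition α ψ (polyWeight s) ∧
    (∀ z : X, atom α ψ z ∈ spaceH1 α ψ (polyWeight s) ∧
      dualAtom α ψ z ∈ spaceK1 α ψ (polyWeight s)) ∧
    -- the two scales of coorbit spaces coincide, with equivalent norms
    (∀ p : ℝ≥0∞, 1 ≤ p →
      spaceH α ψ p (polyWeight s) = spaceK α ψ p (polyWeight s) ∧
      EquivNormsOn (spaceH α ψ p (polyWeight s))
        (fun F => wNorm p (polyWeight s) (extW α ψ F))
        (fun F => wNorm p (polyWeight s) (extV α ψ F))) ∧
    -- independence of the window
    (φ ≠ 0 → ∀ p : ℝ≥0∞, 1 ≤ p →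
      spaceH α ψ p (polyWeight s) = spaceH α φ p (polyWeight s) ∧
      EquivNormsOn (spaceH α ψ p (polyWeight s))
        (fun F => wNorm p (polyWeight s) (extW α ψ F))
        (fun F => wNorm p (polyWeight s) (extW α φ F))) := by
  have hρ : 0 ≤ α / (1 - α) := div_nonneg hα0 (by linarith)
  have hσ : 0 ≤ s / (1 - α) := div_nonneg hs (by linarith)
  have hr' := exponent_bound hα0 hα1 hs hr
  have hr2 : 1 + 2 * (α / (1 - α)) < r := by linarith
  have ht : 1 + s / (1 - α) + α / (1 - α) < r - α / (1 - α) := by linarith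
  obtain ⟨hadm, ⟨c, hc, hinv⟩, -, -⟩ := hψ.admissible hα0 hα1 hr2 hψ0
  obtain ⟨hV, hW⟩ := hψ.isMoleculeFrame hα0 hα1 hr2 hψ0
  refine ⟨hadm, fun κ _ => ?_, ?_, fun z => ⟨?_, ?_⟩, fun p hp => ?_, fun hφ0 p hp => ?_⟩
  -- `A_σ^{-κ}` is the multiplier with symbol `c ^ κ`, again admissible as a symbol, so the second
  -- family in the kernel consists of molecules.
  · have hk : IsMoleculeFamily α (r - α / (1 - α)) fun z => (frameInv α ψ ^ κ) (atom α φ z) := by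
      rw [hinv, fmul_pow]
      exact hφ.isMoleculeFamily hα0 hα1 (by linarith) (hc.pow κ)
    obtain ⟨M, hM⟩ := hV.1.exists_kernelBound hα0 hα1 hs ht hk
    exact (iSup_le hM.left).trans_lt ENNReal.coe_lt_top
  · obtain ⟨M, hM⟩ := hW.1.exists_kernelBound hα0 hα1 hs ht hV.1
    exact (essSup_le_of_ae_le (M : ℝ≥0∞) (Filter.Eventually.of_forall hM.left)).trans_lt
      ENNReal.coe_lt_top
  · exact hV.1.mem_reservoir hα0 hα1 hs ht hW.1 z
  · exact hW.1.mem_reservoir hα0 hα1 hs ht hV.1 z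
  -- The `H` scale uses functionals on the reservoir of the atoms, tested on dual atoms; the `K`
  -- scale has the two roles exchanged.
  · exact hV.coorbit_eq hα0 hα1 hs ht hW hW hV hp
  · obtain ⟨hV', hW'⟩ := hφ.isMoleculeFrame hα0 hα1 hr2 hφ0
    exact hV.coorbit_eq hα0 hα1 hs ht hV' hW hW' hp
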